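/- **Notation.** The letter $p$ denotes a prime, $\log_2=\log\log$, and $\tau(n)$ is the number of divisors of $n$. For $n\ge 1$ and $u\in\mathbb R$ let $\Delta(n,u):=|\{d: d\mid n,\ e^u<d\le e^{u+1}\}|$ and $M_2(n):=\int_{\mathbb R}\Delta(n,u)^2\,du$. For $z>0$, let $\mathcal M_z$ be the class of non-negative multiplicative functions $\varrho$ that are bounded on the set of prime powers and satisfy, for some $c_\varrho>0$, $$\sum_{p\le y}\varrho(p)\log p=zy+O\big(y/(\log y)^{c_\varrho}\big)\qquad(y\ge 2).$$ For $x\ge 2$ let $\mathbb P_{x,\varrho}$ be the probability carried by the squarefree integers $n\ge 1$ all of whose prime factors are $<x$, given there by $$\mathbb P_{x,\varrho}(\{n\}):=\frac{\varrho(n)}{n}\prod_{p<x}\Big(1+\frac{\varrho(p)}p\Big)^{-1},$$ and let $\mathbb E_{x,\varrho}$ be the corresponding expectation. For $t>0$ put $$\beta:=2^tz-t,\qquad z_t:=\frac{t}{2^t-1},\qquad \delta:=\mathbf 1_{\beta=z}=\mathbf 1_{z=z_t},\qquad \mathfrak b:=\frac1{2^tz\log 2-1}.$$ Write $n_y:=\prod_{p\mid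 n,\,p<y}p$. For a constant $\mathfrak c>0$ and $T\ge 3$ let $$f_T(y):=\mathfrak c\,\min\Big(\log(T\log 3y),\ \frac{(\log_2 3y-\mathfrak b\log T)^2}{\log T}\Big)\qquad(y\ge 1),$$ $$E_T^{t,z}:=\{n\text{ squarefree}:\ \tau(n_y)\le e^{-f_T(y)}\,T\log 3y\ \text{ for all } y\ge 1\},$$ $$E_T:=\{n\text{ squarefree}:\ \tau(n_y)\le T\log 3y\ \text{ for all } y\ge 1\}.$$ **Proposition 4.1.** Let $z>0$ and $\varrho\in\mathcal M_z$. Implicit constants may depend on $t$ and $\varrho$ (and, in the second estimate of (ii), on $\mathfrak c$), but not on $x$ or $T$. (i) If $t>0$ is real and $z\ge z_t$, then $$\mathbb E_{x,\varrho}\big(M_2^t/\tau^t\big)\gg(\log x)^{\beta-z}\qquad(x\ge 3).$$ (ii) If $t\ge 1$ is an integer and $z\ge z_t$, then $$\mathbb E_{x,\varrho}\big(M_2^t/\tau^t\big)\asymp(\log x)^{\beta-z}(\log_2x)^{\delta}\qquad(x\ge 3),$$ and, for every $\mathfrak c>0$, $$\mathbb E_{x,\varrho}\big(\mathbf 1_{E_T^{t,z}}M_2^{t+1}/\tau^{t+1}\big)\ll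 T(\log x)^{\beta-z}\qquad(T\ge 3,\ x\ge 3).$$ If moreover $z>z_t$, then $$\mathbb E_{x,\varrho}\big(\mathbf 1_{E_T}M_2^{t+1}/\tau^{t+1}\big)\ll T(\log x)^{\beta-z}\qquad(T\ge 3,\ x\ge 3).$$ -/

import Mathlib

namespace DeltaMoments

noncomputable section

/-- The class `𝓜_z`: non-negative multiplicative functions `ρ`, bounded on the set of prime powers,
such that for some `c > 0` one has `∑_{p ≤ y} ρ(p) log p = z y + O(y / (log y)^c)` for `y ≥ 2`. -/
structure IsClassM (z : ℝ) (ρ : ArithmeticFunction ℝ) : Prop where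
  multiplicative : ρ.IsMultiplicative
  nonneg : ∀ n : ℕ, 0 ≤ ρ n
  bounded : ∃ B : ℝ, ∀ n : ℕ, IsPrimePow n → ρ n ≤ B
  prime_sum : ∃ c : ℝ, 0 < c ∧ ∃ K : ℝ, ∀ y : ℝ, 2 ≤ y →
    |∑ p ∈ Finset.Icc 1 ⌊y⌋₊ with p.Prime, ρ p * Real.log p - z * y| ≤ K * (y / Real.log y ^ c)

/-- `Δ(n, u)`, the number of divisors `d` of `n` with `e^u < d ≤ e^(u+1)`. -/
def Delta (n : ℕ) (u : ℝ) : ℕ :=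
  (n.divisors.filter fun d : ℕ => Real.exp u < (d : ℝ) ∧ (d : ℝ) ≤ Real.exp (u + 1)).card

/-- `M_q(n) = ∫_ℝ Δ(n, u)^q du`. For `q ≥ 1` and `n ≥ 1` the integrand is a step function with
bounded support. -/
def M (q n : ℕ) : ℝ :=
  ∫ u : ℝ, (Delta n u : ℝ) ^ q

/-- The number of divisors `τ(n)`. -/
def tau (n : ℕ) : ℕ :=
  n.divisors.card

/-- `β(t, z) = 2^t z - t`. -/
def beta (t z : ℝ) : ℝ :=
  2 ^ t * z - t

/-- `z_t = t / (2^t - 1)`. -/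
def zt (t : ℝ) : ℝ :=
  t / (2 ^ t - 1)

open scoped Classical in
/-- `δ(t, z)`, equal to `1` if `β(t, z) = z` and to `0` otherwise. -/
def delta (t z : ℝ) : ℝ :=
  if beta t z = z then 1 else 0

/-- `n_y`, the product of the primes `p ∣ n` with `p < y`. -/
def lowPart (n : ℕ) (y : ℝ) : ℕ :=
  ∏ p ∈ n.primeFactors with ((p : ℕ) : ℝ) < y, p

/-- `𝔟_{t,z} = 1 / (2^t z log 2 - 1)`. -/
def bConst (t z : ℝ) : ℝ :=
  1 / (2 ^ t * z * Real.log 2 - 1)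

/-- `f_T(y) = 𝔠 min (log (T log 3y), (log log 3y - 𝔟_{t,z} log T)² / log T)`. -/
def fT (c t z T y : ℝ) : ℝ :=
  c * min (Real.log (T * Real.log (3 * y)))
    ((Real.log (Real.log (3 * y)) - bConst t z * Real.log T) ^ 2 / Real.log T)

/-- `E_T^{t,z}`, with the constant `𝔠` of `f_T` explicit: the squarefree `n` such that
`τ(n_y) ≤ e^{-f_T(y)} T log 3y` for all `y ≥ 1`. -/
def ETtz (c t z T : ℝ) : Set ℕ :=
  {n | Squarefree n ∧ ∀ y : ℝ, 1 ≤ y →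
    (tau (lowPart n y) : ℝ) ≤ Real.exp (-fT c t z T y) * T * Real.log (3 * y)}

/-- `E_T`: the squarefree `n` such that `τ(n_y) ≤ T log 3y` for all `y ≥ 1`. -/
def ET (T : ℝ) : Set ℕ :=
  {n | Squarefree n ∧ ∀ y : ℝ, 1 ≤ y → (tau (lowPart n y) : ℝ) ≤ T * Real.log (3 * y)}

/-- The finite set of primes `p < x`. -/
def primesLT (x : ℝ) : Finset ℕ :=
  Nat.primesBelow ⌈x⌉₊

lemma mem_primesLT {x : ℝ} {p : ℕ} : p ∈ primesLT x ↔ (p : ℝ) < x ∧ p.Prime := by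
  simp [primesLT, Nat.mem_primesBelow, Nat.lt_ceil]

/-- The finite set of squarefree integers all of whose prime factors are `< x`, that is, the
divisors of the product of the primes `p < x`; see `mem_sqfreeSmooth`. -/
def sqfreeSmooth (x : ℝ) : Finset ℕ :=
  (∏ p ∈ primesLT x, p).divisors

lemma mem_sqfreeSmooth {x : ℝ} {n : ℕ} :
    n ∈ sqfreeSmooth x ↔ Squarefree n ∧ ∀ p ∈ n.primeFactors, (p : ℝ) < x := by
  have hpr : ∀ p ∈ primesLT x, p.Prime := fun p hp => (mem_primesLT.1 hp).2
  have h0 : (∏ p ∈ primesLT x, p) ≠ 0 := Finset.prod_ne_zero_iff.2 fun p hp => (hpr p hp).ne_zero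
  have hsq : Squarefree (∏ p ∈ primesLT x, p) := by
    refine Finset.squarefree_prod_of_pairwise_isCoprime ?_ fun p hp => (hpr p hp).squarefree
    intro p hp q hq hpq
    exact Nat.coprime_iff_isRelPrime.1 ((Nat.coprime_primes (hpr p hp) (hpr q hq)).2 hpq)
  constructor
  · intro hn
    have hd : n ∣ ∏ p ∈ primesLT x, p := (Nat.mem_divisors.1 hn).1
    refine ⟨hsq.squarefree_of_dvd hd, fun p hp => ?_⟩
    have hp' : p ∈ (∏ p ∈ primesLT x, p).primeFactors := Nat.primeFactors_mono hd h0 hp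
    rw [Nat.primeFactors_prod hpr] at hp'
    exact (mem_primesLT.1 hp').1
  · rintro ⟨hs, hn⟩
    refine Nat.mem_divisors.2 ⟨?_, h0⟩
    rw [← Nat.prod_primeFactors_of_squarefree hs]
    exact Finset.prod_dvd_prod_of_subset _ _ _ fun p hp =>
      mem_primesLT.2 ⟨hn p hp, Nat.prime_of_mem_primeFactors hp⟩

/-- The mass `ℙ_{x,ρ}({n}) = (ρ(n)/n) ∏_{p < x} (1 + ρ(p)/p)⁻¹` of a squarefree `n` all of whose
prime factors are `< x`. -/
def mass (ρ : ArithmeticFunction ℝ) (x : ℝ) (n : ℕ) : ℝ :=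
  ρ n / n * ∏ p ∈ primesLT x, (1 + ρ p / p)⁻¹

/-- The expectation `𝔼_{x,ρ}(g)` of `g` under the probability `ℙ_{x,ρ}`, which is carried by the
squarefree integers all of whose prime factors are `< x`. -/
def expect (ρ : ArithmeticFunction ℝ) (x : ℝ) (g : ℕ → ℝ) : ℝ :=
  ∑ n ∈ sqfreeSmooth x, g n * mass ρ x n

end

end DeltaMoments

/-! ### Product-weighted sums over sets of primes. -/

namespace DeltaMoments

noncomputable section

open Finset

/-! Write `n = ∏_{p ∈ S} p` and `v_p = ρ(p)/p`. Expanding a Fejér-type kernel in Fourier integrals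
bounds `M_2(n)/τ(n)` above by a constant times `∫_0^1 ∏_{p ∈ S} (1 + cos(θ log p)) dθ`, and below by
a constant times the same integral with the weight `1 - θ` (`M_two_div_tau_le`,
`exists_le_M_two_div_tau`). The events `p ∣ n` are independent, so the `t`-th moment becomes an
integral over `[0,1]^t` of an Euler product of size about `exp(∑ v_p (∏_j (1 + cos(θ_j log p)) -
1))`.

The product of cosines expands as a weighted sum of `cos((ε·θ) log p)` over sign vectors `ε`, and
`∑_{p<y} v_p cos(λ log p) = -z log max(1/log y, |λ|) + O(1)` (`exists_abs_sum_cos_le`). Cut the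
primes at the scales `exp(B^i)`. At scale `i` only the `ε` with `|ε·θ| ≤ B^{-i}` matter; if they
span a space of dimension `r_i`, their total weight is at most `2^{r_i}` (`sum_signWeight_le`). The
exponent is thus at most `z log B ∑ (2^{r_i} - 1) + O(1)`, whereas the set of `θ` with a given rank
profile has volume `≪ B^{-∑ r_i}` (`exists_integral_cube_le`). Each scale of rank `j` therefore
contributes a factor `B^{z(2^j-1)-j}`. For `z ≥ z_t` the exponent `z(2^j-1)-j` over `0 ≤ j ≤ t` is
largest at `j = t`, with a tie only at `j = 0`, exactly when `δ = 1`. All other ranks give geometric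
series, and the tie gives `log log x` (`exists_moment_le`).

For the moment of order `t+1`, the scales of rank `t+1` would be too costly, and membership in `E_T`
controls them. On the primes below the last such scale `B^k`, the condition `τ ≤ 3TB^k` replaces one
factor `2` per prime by a total factor `TB^k`, up to a weight concentrated where `τ` is close to
that barrier. Under the weights `2^t v_p` the quantity `log τ - log(TB^k)` has positive drift
because `2^t z log 2 > 1`, so it stays near the barrier for boundedly many scales on average
(`sum_greenTerm_le`). The sum over `k` then costs only `O(1)`, uniformly in `T`. The rank-`t` scales
decay thanks to a Rankin factor (`exists_moment_ET_le`). The bound on `E_T^{t,z}` follows by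
inclusion.

The lower bounds use explicit regions of `θ`: `θ ≪ 1/log n` gives `M_2/τ ≫ τ/log n` and hence (i)
after a change of weights (`exists_le_moment`); when `δ = 1`, disjoint intervals `[η/2, η]` over `≍
log log x` scales contribute equally (`exists_log_log_le_moment`). -/

/-- The sum of `F` over the subsets of `P`, weighted by the product weights coming from `v`. -/
def subsetSum (v : ℕ → ℝ) (P : Finset ℕ) (F : Finset ℕ → ℝ) : ℝ :=
  ∑ S ∈ P.powerset, (∏ p ∈ S, v p) * F S

lemma subsetSum_prod (v g : ℕ → ℝ) (P : Finset ℕ) :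
    subsetSum v P (fun S => ∏ p ∈ S, g p) = ∏ p ∈ P, (1 + v p * g p) := by
  simp [subsetSum, Finset.prod_one_add, prod_mul_distrib]

lemma subsetSum_one (v : ℕ → ℝ) (P : Finset ℕ) :
    subsetSum v P (fun _ => 1) = ∏ p ∈ P, (1 + v p) := by
  simp [subsetSum, Finset.prod_one_add]

/-- Independence of disjoint sets of primes: a subset of `P ∪ Q` is a pair of subsets, and its
weight factors. -/
lemma subsetSum_union_mul (v : ℕ → ℝ) {P Q : Finset ℕ} (h : Disjoint P Q)
    (F H : Finset ℕ → ℝ) :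
    subsetSum v (P ∪ Q) (fun S => F (S ∩ P) * H (S ∩ Q)) =
      subsetSum v P F * subsetSum v Q H := by
  unfold subsetSum
  rw [sum_mul_sum, ← sum_product']
  symm
  refine sum_nbij' (fun x => x.1 ∪ x.2) (fun S => (S ∩ P, S ∩ Q)) ?_ ?_ ?_ ?_ ?_
  · rintro ⟨a, b⟩ hab
    simp only [mem_product, mem_powerset] at hab ⊢
    exact union_subset_union hab.1 hab.2
  · intro S _
    simp only [mem_product, mem_powerset]
    exact ⟨inter_subset_right, inter_subset_right⟩
  · rintro ⟨a, b⟩ hab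
    simp only [mem_product, mem_powerset] at hab
    have h1 : b ∩ P = ∅ := disjoint_iff_inter_eq_empty.1 (h.symm.mono_left hab.2)
    have h2 : a ∩ Q = ∅ := disjoint_iff_inter_eq_empty.1 (h.mono_left hab.1)
    simp [union_inter_distrib_right, h1, h2, inter_eq_left.2 hab.1, inter_eq_left.2 hab.2]
  · intro S hS
    simp only [mem_powerset] at hS
    simp only [← inter_union_distrib_left]
    exact inter_eq_left.2 hS
  · rintro ⟨a, b⟩ hab
    simp only [mem_product, mem_powerset] at hab
    have h1 : b ∩ P = ∅ := disjoint_iff_inter_eq_empty.1 (h.symm.mono_left hab.2)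
    have h2 : a ∩ Q = ∅ := disjoint_iff_inter_eq_empty.1 (h.mono_left hab.1)
    have h3 : Disjoint a b := h.mono hab.1 hab.2
    simp only [union_inter_distrib_right, h1, h2, inter_eq_left.2 hab.1, inter_eq_left.2 hab.2,
      prod_union h3, union_empty, empty_union]
    ring

lemma subsetSum_mono {v : ℕ → ℝ} {P : Finset ℕ} (hv : ∀ p ∈ P, 0 ≤ v p) {F H : Finset ℕ → ℝ}
    (h : ∀ S ⊆ P, F S ≤ H S) : subsetSum v P F ≤ subsetSum v P H := by
  refine sum_le_sum fun S hS => ?_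
  rw [mem_powerset] at hS
  exact mul_le_mul_of_nonneg_left (h S hS) (prod_nonneg fun p hp => hv p (hS hp))

lemma subsetSum_const_mul (v : ℕ → ℝ) (P : Finset ℕ) (c : ℝ) (F : Finset ℕ → ℝ) :
    subsetSum v P (fun S => c * F S) = c * subsetSum v P F := by
  simp only [subsetSum, mul_sum]
  exact sum_congr rfl fun S _ => by ring

/-- Change of measure: a multiplicative factor is absorbed into the weights. It is used to pass from
`ρ(p)/p` to `2^t ρ(p)/p`. -/
lemma subsetSum_prod_mul (v g : ℕ → ℝ) (P : Finset ℕ) (F : Finset ℕ → ℝ) :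
    subsetSum v P (fun S => (∏ p ∈ S, g p) * F S) = subsetSum (fun p => g p * v p) P F := by
  simp only [subsetSum, prod_mul_distrib]
  exact sum_congr rfl fun S _ => by ring

lemma subsetSum_add (v : ℕ → ℝ) (P : Finset ℕ) (F H : Finset ℕ → ℝ) :
    subsetSum v P (fun S => F S + H S) = subsetSum v P F + subsetSum v P H := by
  simp only [subsetSum, mul_add, sum_add_distrib]

lemma subsetSum_sum (v : ℕ → ℝ) (P : Finset ℕ) {ι : Type*} (s : Finset ι)
    (F : ι → Finset ℕ → ℝ) :
    subsetSum v P (fun S => ∑ i ∈ s, F i S) = ∑ i ∈ s, subsetSum v P (F i) := by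
  simp only [subsetSum, mul_sum]
  exact sum_comm

lemma subsetSum_nonneg {v : ℕ → ℝ} {P : Finset ℕ} (hv : ∀ p ∈ P, 0 ≤ v p) {F : Finset ℕ → ℝ}
    (h : ∀ S ⊆ P, 0 ≤ F S) : 0 ≤ subsetSum v P F := by
  refine sum_nonneg fun S hS => ?_
  rw [mem_powerset] at hS
  exact mul_nonneg (prod_nonneg fun p hp => hv p (hS hp)) (h S hS)

lemma squarefree_prod_primes {S : Finset ℕ} (hS : ∀ p ∈ S, p.Prime) :
    Squarefree (∏ p ∈ S, p) := by
  refine Finset.squarefree_prod_of_pairwise_isCoprime ?_ fun p hp => (hS p hp).squarefree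
  intro p hp q hq hpq
  exact Nat.coprime_iff_isRelPrime.1 ((Nat.coprime_primes (hS p hp) (hS q hq)).2 hpq)

lemma sum_divisors_prod_primes {α : Type*} [AddCommMonoid α] {P : Finset ℕ}
    (hP : ∀ p ∈ P, p.Prime) (f : ℕ → α) :
    ∑ d ∈ (∏ p ∈ P, p).divisors, f d = ∑ S ∈ P.powerset, f (∏ p ∈ S, p) := by
  have h0 : (∏ p ∈ P, p) ≠ 0 := Finset.prod_ne_zero_iff.2 fun p hp => (hP p hp).ne_zero
  have h := Nat.sum_divisors_filter_squarefree h0 (f := f)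
  rw [Nat.divisors_filter_squarefree_of_squarefree (squarefree_prod_primes hP)] at h
  rw [h]
  have : (UniqueFactorizationMonoid.normalizedFactors (∏ p ∈ P, p)).toFinset = P := by
    rw [← Nat.primeFactors_prod hP]
    ext p
    rw [Multiset.mem_toFinset, Nat.primeFactors_prod hP, Nat.factors_eq, Multiset.mem_coe,
      Nat.mem_primeFactorsList h0, ← Nat.mem_primeFactors_of_ne_zero h0,
      Nat.primeFactors_prod hP]
  rw [this]
  refine sum_congr rfl fun S _ => ?_
  rw [← Finset.prod_map_val, Multiset.map_id']

lemma expect_eq (ρ : ArithmeticFunction ℝ) (hρ : ρ.IsMultiplicative) (x : ℝ) (g : ℕ → ℝ) :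
    expect ρ x g = subsetSum (fun p => ρ p / p) (primesLT x) (fun S => g (∏ p ∈ S, p)) /
      ∏ p ∈ primesLT x, (1 + ρ p / p) := by
  have hP : ∀ p ∈ primesLT x, p.Prime := fun p hp => (mem_primesLT.1 hp).2
  unfold expect sqfreeSmooth
  rw [sum_divisors_prod_primes hP, subsetSum, sum_div]
  refine sum_congr rfl fun S hS => ?_
  rw [mem_powerset] at hS
  rw [mass, hρ.map_prod_of_prime S fun p hp => hP p (hS hp), prod_inv_distrib, prod_div_distrib]
  push_cast
  ring

end

end DeltaMoments

/-! ### The integral of `cos(λw)/w`. -/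

namespace DeltaMoments

noncomputable section

open Finset MeasureTheory intervalIntegral

/-- In the oscillating range, integration by parts gives two boundary terms and an integral, each at
most `1/(λa) ≤ 1`. -/
lemma abs_integral_cos_div_le {lam a b : ℝ} (hlam : 0 < lam) (ha : 0 < a) (hab : a ≤ b)
    (h1 : 1 ≤ lam * a) : |∫ w in a..b, Real.cos (lam * w) / w| ≤ 3 := by
  have hb : 0 < b := ha.trans_le hab
  have hpos : ∀ w ∈ Set.uIcc a b, 0 < w := fun w hw => by
    rw [Set.uIcc_of_le hab] at hw; exact ha.trans_le hw.1
  have hcu : ContinuousOn (fun w : ℝ => -(w ^ 2)⁻¹) (Set.uIcc a b) :=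
    ((continuousOn_id.pow 2).inv₀ fun w hw => (pow_pos (hpos w hw) 2).ne').neg
  have hcu' : ContinuousOn (fun w : ℝ => (w ^ 2)⁻¹) (Set.uIcc a b) :=
    (continuousOn_id.pow 2).inv₀ fun w hw => (pow_pos (hpos w hw) 2).ne'
  have hparts := integral_mul_deriv_eq_deriv_mul (a := a) (b := b)
    (u := fun w : ℝ => w⁻¹) (u' := fun w => -(w ^ 2)⁻¹)
    (v := fun w => Real.sin (lam * w) / lam) (v' := fun w => Real.cos (lam * w))
    (fun w hw => hasDerivAt_inv (hpos w hw).ne')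
    (fun w _ => by
      have := ((Real.hasDerivAt_sin (lam *
          w)).comp w ((hasDerivAt_id w).const_mul lam)).div_const lam
      rw [mul_one, mul_div_assoc, div_self hlam.ne', mul_one] at this
      exact this)
    hcu.intervalIntegrable
    (by apply Continuous.intervalIntegrable; fun_prop)
  have hI : ∫ w in a..b, Real.cos (lam * w) / w = ∫ w in a..b, w⁻¹ * Real.cos (lam * w) :=
    integral_congr fun w _ => by simp only [div_eq_mul_inv, mul_comm]
  rw [hI, hparts]
  have hsin : ∀ w, a ≤ w → |w⁻¹ * (Real.sin (lam * w) / lam)| ≤ 1 := fun w hw => by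
    have hw0 : 0 < w := ha.trans_le hw
    rw [show w⁻¹ * (Real.sin (lam * w) / lam) = Real.sin (lam * w) / (lam * w) by field_simp,
      abs_div, abs_of_pos (mul_pos hlam hw0), div_le_one (mul_pos hlam hw0)]
    exact (Real.abs_sin_le_one _).trans (h1.trans (mul_le_mul_of_nonneg_left hw hlam.le))
  have hlast : |∫ w in a..b, -(w ^ 2)⁻¹ * (Real.sin (lam * w) / lam)| ≤ 1 := by
    have hint : ∫ w in a..b, (lam)⁻¹ * (w ^ 2)⁻¹ = (lam)⁻¹ * (a⁻¹ - b⁻¹) := by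
      rw [intervalIntegral.integral_const_mul]
      congr 1
      have := integral_eq_sub_of_hasDerivAt (f := fun w : ℝ => -w⁻¹) (f' := fun w => (w ^ 2)⁻¹)
        (a := a) (b := b) (fun w hw => by
          have h := (hasDerivAt_inv (hpos w hw).ne').neg
          rw [neg_neg] at h
          exact h) hcu'.intervalIntegrable
      rw [this]; ring
    rw [← Real.norm_eq_abs]
    refine (norm_integral_le_of_norm_le (g := fun w => (lam)⁻¹ * (w ^ 2)⁻¹) hab
      (Filter.Eventually.of_forall fun w hw => ?_) ?_).trans ?_
    · have hw0 : 0 < w := ha.trans hw.1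
      rw [norm_mul, norm_neg, Real.norm_eq_abs, Real.norm_eq_abs, abs_div, abs_of_pos hlam,
        abs_of_pos (inv_pos.2 (pow_pos hw0 2)), mul_comm]
      gcongr
      rw [div_le_iff₀ hlam, inv_mul_cancel₀ hlam.ne']
      exact Real.abs_sin_le_one _
    · exact hcu'.intervalIntegrable.const_mul _
    · rw [hint]
      have : lam⁻¹ * (a⁻¹ - b⁻¹) ≤ lam⁻¹ * a⁻¹ := by
        have := inv_pos.2 hb
        have := inv_pos.2 hlam
        gcongr; linarith
      refine this.trans ?_
      rw [← mul_inv]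
      exact inv_le_one_of_one_le₀ h1
  have h2 := hsin a le_rfl
  have h3 := hsin b hab
  rw [abs_le] at *
  constructor <;> linarith [h2.1, h2.2, h3.1, h3.2, hlast.1, hlast.2]

lemma abs_integral_cos_div_sub_log_le {lam a b : ℝ} (hlam : 0 ≤ lam) (ha : 0 < a) (hab : a ≤ b)
    (h1 : lam * b ≤ 1) :
    |(∫ w in a..b, Real.cos (lam * w) / w) - (Real.log b - Real.log a)| ≤ 1 := by
  have hb : 0 < b := ha.trans_le hab
  have hpos : ∀ w ∈ Set.uIcc a b, 0 < w := fun w hw => by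
    rw [Set.uIcc_of_le hab] at hw; exact ha.trans_le hw.1
  have hne : ∀ w ∈ Set.uIcc a b, w ≠ 0 := fun w hw => (hpos w hw).ne'
  have hlog : Real.log b - Real.log a = ∫ w in a..b, 1 / w := by
    rw [integral_one_div_of_pos ha hb, Real.log_div hb.ne' ha.ne']
  have i1 : IntervalIntegrable (fun w => Real.cos (lam * w) / w) volume a b :=
    (ContinuousOn.div (by fun_prop) continuousOn_id hne).intervalIntegrable
  have i2 : IntervalIntegrable (fun w : ℝ => 1 / w) volume a b :=
    (ContinuousOn.div (by fun_prop) continuousOn_id hne).intervalIntegrable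
  rw [hlog, ← integral_sub i1 i2, ← Real.norm_eq_abs]
  refine (intervalIntegral.norm_integral_le_of_norm_le_const (C := lam) fun w hw => ?_).trans ?_
  · rw [Set.uIoc_of_le hab] at hw
    have hw0 : 0 < w := ha.trans hw.1
    have hlw : lam * w ≤ 1 := (mul_le_mul_of_nonneg_left hw.2 hlam).trans h1
    have hlw0 : 0 ≤ lam * w := mul_nonneg hlam hw0.le
    have hc1 := Real.one_sub_sq_div_two_le_cos (x := lam * w)
    have hc2 := Real.cos_le_one (lam * w)
    rw [← sub_div, norm_div, Real.norm_eq_abs, Real.norm_eq_abs, abs_of_pos hw0, div_le_iff₀ hw0,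
      abs_le]
    constructor <;> nlinarith
  · rw [abs_of_nonneg (sub_nonneg.2 hab)]
    nlinarith

/-- The integrand behaves like `1/w` up to `w = 1/|λ|` and oscillates beyond, so the integral is cut
there when `1/|λ|` lies in `[l, Y]`. -/
lemma exists_abs_integral_cos_div_add_log_le {l : ℝ} (hl : 0 < l) (Lam : ℝ) :
    ∃ C : ℝ, ∀ lam Y : ℝ, |lam| ≤ Lam → l ≤ Y →
      |(∫ w in l..Y, Real.cos (lam * w) / w) + Real.log (max Y⁻¹ |lam|)| ≤ C := by
  refine ⟨4 + |Real.log l| + |Real.log Lam|, fun lam' Y hlam hY => ?_⟩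
  have heq : ∫ w in l..Y, Real.cos (lam' * w) / w = ∫ w in l..Y, Real.cos (|lam'| * w) / w := by
    rcases abs_choice lam' with h | h <;> rw [h]
    simp only [neg_mul, Real.cos_neg]
  rw [heq]
  generalize hlam_def : |lam'| = lam at *
  have hlam0 : 0 ≤ lam := hlam_def ▸ abs_nonneg _
  have hY0 : 0 < Y := hl.trans_le hY
  have n1 := abs_nonneg (Real.log l)
  have n2 := abs_nonneg (Real.log Lam)
  have l1 := neg_abs_le (Real.log l)
  have l2 := le_abs_self (Real.log l)
  by_cases hc : lam * Y ≤ 1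
  · have : max Y⁻¹ lam = Y⁻¹ := max_eq_left (by rwa [← one_div, le_div_iff₀ hY0])
    rw [this, Real.log_inv]
    have h := abs_integral_cos_div_sub_log_le hlam0 hl hY hc
    rw [abs_le] at h ⊢
    constructor <;> linarith [h.1, h.2]
  · push Not at hc
    have hlam1 : 0 < lam := by
      rcases hlam0.eq_or_lt with h | h
      · rw [← h] at hc; linarith
      · exact h
    have : max Y⁻¹ lam = lam := max_eq_right (by rw [← one_div, div_le_iff₀ hY0]; exact hc.le)
    rw [this]
    by_cases hc2 : 1 ≤ lam * l
    · have h := abs_integral_cos_div_le hlam1 hl hY hc2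
      have h3 : Real.log lam ≤ Real.log Lam := Real.log_le_log hlam1 hlam
      have h4 : -Real.log l ≤ Real.log lam := by
        have := Real.log_nonneg hc2
        rw [Real.log_mul hlam1.ne' hl.ne'] at this; linarith
      have := le_abs_self (Real.log Lam)
      rw [abs_le] at h ⊢
      constructor <;> linarith [h.1, h.2]
    · push Not at hc2
      have hlD : l ≤ lam⁻¹ := by rw [← one_div, le_div_iff₀ hlam1, mul_comm]; exact hc2.le
      have hDY : lam⁻¹ ≤ Y := by rw [← one_div, div_le_iff₀ hlam1, mul_comm]; exact hc.le
      have hint : ∀ a b : ℝ, 0 < a → a ≤ b →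
          IntervalIntegrable (fun w => Real.cos (lam * w) / w) volume a b := fun a b h0 h1 =>
        (ContinuousOn.div (by fun_prop) continuousOn_id fun w hw => by
          rw [Set.uIcc_of_le h1] at hw; exact (h0.trans_le hw.1).ne').intervalIntegrable
      have h1 := abs_integral_cos_div_sub_log_le hlam0 hl hlD (mul_inv_cancel₀ hlam1.ne').le
      have h2 := abs_integral_cos_div_le hlam1 (inv_pos.2 hlam1) hDY (mul_inv_cancel₀ hlam1.ne').ge
      rw [← integral_add_adjacent_intervals (hint l _ hl hlD) (hint _ Y (inv_pos.2 hlam1) hDY)]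
      rw [Real.log_inv] at h1
      rw [abs_le] at h1 h2 ⊢
      constructor <;> linarith [h1.1, h1.2, h2.1, h2.2]

end

end DeltaMoments

/-! ### The kernel for partial summation over primes. -/

namespace DeltaMoments

noncomputable section

open Finset MeasureTheory intervalIntegral

/-- The function `cos (λ log t) / (t log t)`. -/
def cosKer (lam t : ℝ) : ℝ :=
  Real.cos (lam * Real.log t) / (t * Real.log t)

/-- The derivative of `cosKer`. -/
def cosKer' (lam t : ℝ) : ℝ :=
  (-Real.sin (lam * Real.log t) * (lam * t⁻¹) * (t * Real.log t) -
    Real.cos (lam * Real.log t) * (1 * Real.log t + t * t⁻¹)) / (t * Real.log t) ^ 2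

lemma hasDerivAt_cosKer (lam : ℝ) {t : ℝ} (ht : 1 < t) :
    HasDerivAt (cosKer lam) (cosKer' lam t) t := by
  have h0 : t ≠ 0 := by positivity
  have hl := Real.log_pos ht
  exact ((Real.hasDerivAt_cos _).comp t ((Real.hasDerivAt_log h0).const_mul lam)).div
    ((hasDerivAt_id t).mul (Real.hasDerivAt_log h0)) (mul_ne_zero h0 hl.ne')

lemma continuousOn_cosKer' (lam : ℝ) {a b : ℝ} (ha : 1 < a) :
    ContinuousOn (cosKer' lam) (Set.Icc a b) := by
  have h0 : ∀ t ∈ Set.Icc a b, t ≠ 0 := fun t ht => by linarith [ht.1]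
  have hl : ContinuousOn Real.log (Set.Icc a b) := Real.continuousOn_log.mono fun t ht => h0 t ht
  have hi : ContinuousOn (fun t : ℝ => t⁻¹) (Set.Icc a b) := continuousOn_id.inv₀ h0
  refine ContinuousOn.div ?_ ((continuousOn_id.mul hl).pow 2) fun t ht => ?_
  · exact (((Real.continuous_sin.comp_continuousOn (continuousOn_const.mul hl)).neg.mul
      (continuousOn_const.mul hi)).mul (continuousOn_id.mul hl)).sub
      ((Real.continuous_cos.comp_continuousOn (continuousOn_const.mul hl)).mul
        ((continuousOn_const.mul hl).add (continuousOn_id.mul hi)))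
  · exact pow_ne_zero 2 (mul_ne_zero (h0 t ht) (Real.log_pos (by linarith [ht.1])).ne')

lemma abs_cosKer_le (lam : ℝ) {t : ℝ} (ht : 1 < t) : |cosKer lam t| ≤ 1 / (t * Real.log t) := by
  have hl := Real.log_pos ht
  have : 0 < t * Real.log t := by positivity
  rw [cosKer, abs_div, abs_of_pos this]
  gcongr
  exact Real.abs_cos_le_one _

lemma abs_cosKer'_le {lam Lam : ℝ} (hlam : |lam| ≤ Lam) {t : ℝ} (ht : 2 ≤ t) :
    |cosKer' lam t| ≤ (Lam + 1 + 1 / Real.log 2) / (t ^ 2 * Real.log t) := by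
  have hl2 : 0 < Real.log 2 := Real.log_pos one_lt_two
  have hl : Real.log 2 ≤ Real.log t := Real.log_le_log two_pos ht
  have hl0 : 0 < Real.log t := hl2.trans_le hl
  have ht0 : 0 < t := by linarith
  have h1 : cosKer' lam t = (-Real.sin (lam * Real.log t) * lam * Real.log t -
    Real.cos (lam * Real.log t) * (Real.log t + 1)) / (t * Real.log t) ^ 2 := by
    unfold cosKer'; field_simp
  rw [h1, abs_div, abs_of_pos (by positivity : 0 < (t * Real.log t) ^ 2),
    div_le_div_iff₀ (by positivity) (by positivity)]
  have h2 : |-Real.sin (lam * Real.log t) * lam * Real.log t -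
      Real.cos (lam * Real.log t) * (Real.log t + 1)| ≤ Lam * Real.log t + (Real.log t + 1) := by
    refine (abs_sub _ _).trans ?_
    rw [abs_mul, abs_mul, abs_mul, abs_neg, abs_of_pos hl0,
        abs_of_pos (by linarith : 0 < Real.log t + 1)]
    have s1 := Real.abs_sin_le_one (lam * Real.log t)
    have s2 := Real.abs_cos_le_one (lam * Real.log t)
    have : |Real.sin (lam * Real.log t)| * |lam| ≤ 1 * Lam :=
      mul_le_mul s1 hlam (abs_nonneg _) zero_le_one
    nlinarith
  have h3 : 1 ≤ 1 / Real.log 2 * Real.log t := by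
    rw [one_div, ← div_eq_inv_mul, one_le_div hl2]; exact hl
  have h4 : Lam * Real.log t + (Real.log t + 1) ≤ (Lam + 1 + 1 / Real.log 2) * Real.log t := by
    linarith
  calc _ ≤ ((Lam + 1 + 1 / Real.log 2) * Real.log t) * (t ^ 2 * Real.log t) := by
        gcongr; exact h2.trans h4
    _ = _ := by ring

lemma integral_cosKer (lam : ℝ) {b : ℝ} (hb : 2 ≤ b) :
    ∫ t in (2 : ℝ)..b, cosKer lam t =
      ∫ w in (Real.log 2)..(Real.log b), Real.cos (lam * w) / w := by
  have hu : ∀ t ∈ Set.uIcc 2 b, 2 ≤ t := fun t ht => by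
    rw [Set.uIcc_of_le hb] at ht; exact ht.1
  rw [← integral_comp_mul_deriv''' (f := Real.log) (f' := fun t => t⁻¹)
    (g := fun w => Real.cos (lam * w) / w)]
  · refine integral_congr fun t ht => ?_
    simp only [cosKer, Function.comp]
    rw [mul_comm t, ← div_div, div_eq_mul_inv]
  · exact Real.continuousOn_log.mono fun t ht => by
      have := hu t ht
      simp; linarith
  · intro t ht
    rw [min_eq_left hb] at ht
    exact (Real.hasDerivAt_log (by linarith [ht.1])).hasDerivWithinAt
  · rw [min_eq_left hb, max_eq_right hb]
    refine ContinuousOn.div (by fun_prop) continuousOn_id ?_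
    rintro _ ⟨t, ht, rfl⟩
    exact (Real.log_pos (by linarith [ht.1])).ne'
  · have hcw : IntegrableOn (fun w => Real.cos (lam * w) / w)
        (Set.uIcc (Real.log 2) (Real.log b)) := by
      refine ContinuousOn.integrableOn_uIcc ?_
      refine ContinuousOn.div (by fun_prop) continuousOn_id ?_
      intro w hw
      rw [Set.uIcc_of_le (Real.log_le_log two_pos hb)] at hw
      exact ((Real.log_pos one_lt_two).trans_le hw.1).ne'
    · refine hcw.mono_set (Set.image_subset_iff.2 fun t ht => ?_)
      rw [Set.mem_preimage, Set.uIcc_of_le (Real.log_le_log two_pos hb)]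
      rw [Set.uIcc_of_le hb] at ht
      exact ⟨Real.log_le_log two_pos ht.1, Real.log_le_log (by linarith [ht.1]) ht.2⟩
  · refine ContinuousOn.integrableOn_uIcc ?_
    have h0 : ∀ t ∈ Set.uIcc 2 b, t ≠ 0 := fun t ht => by linarith [hu t ht]
    have hl : ContinuousOn Real.log (Set.uIcc 2 b) := Real.continuousOn_log.mono fun t ht => h0 t ht
    refine ContinuousOn.mul (ContinuousOn.div (Real.continuous_cos.comp_continuousOn
      (continuousOn_const.mul hl)) hl fun t ht => ?_) (continuousOn_id.inv₀ h0)
    exact (Real.log_pos (by linarith [hu t ht])).ne'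

lemma integral_inv_mul_log_rpow_le {c b : ℝ} (hc : 0 < c) (hb : 2 ≤ b) :
    IntervalIntegrable (fun t => t⁻¹ * (Real.log t ^ (-(1 + c)))) volume 2 b ∧
    ∫ t in (2 : ℝ)..b, t⁻¹ * (Real.log t ^ (-(1 + c))) ≤ Real.log 2 ^ (-c) / c := by
  have hu : ∀ t ∈ Set.uIcc 2 b, 2 ≤ t := fun t ht => by
    rw [Set.uIcc_of_le hb] at ht; exact ht.1
  have h0 : ∀ t ∈ Set.uIcc 2 b, t ≠ 0 := fun t ht => by linarith [hu t ht]
  have hl : ContinuousOn Real.log (Set.uIcc 2 b) := Real.continuousOn_log.mono fun t ht => h0 t ht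
  have hlp : ∀ t ∈ Set.uIcc 2 b, 0 < Real.log t := fun t ht => Real.log_pos (by linarith [hu t ht])
  have hi : IntervalIntegrable (fun t => t⁻¹ * (Real.log t ^ (-(1 + c)))) volume 2 b :=
    ((continuousOn_id.inv₀ h0).mul (hl.rpow_const fun t ht =>
        Or.inl (hlp t ht).ne')).intervalIntegrable
  refine ⟨hi, ?_⟩
  rw [integral_eq_sub_of_hasDerivAt (f := fun t => -(Real.log t ^ (-c) / c)) (fun t ht => ?_) hi]
  · have : 0 ≤ Real.log b ^ (-c) / c :=
      div_nonneg (Real.rpow_nonneg (Real.log_nonneg (by linarith)) _) hc.le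
    linarith
  · have h := (((Real.hasDerivAt_log (h0 t ht)).rpow_const (p :=
        -c) (Or.inl (hlp t ht).ne')).div_const c).neg
    have e : -(t⁻¹ * -c * Real.log t ^ (-c - 1) / c) = t⁻¹ * (Real.log t ^ (-(1 + c))) := by
      rw [show -(1 + c) = -c - 1 by ring]
      field_simp
    rw [e] at h
    exact h

end

end DeltaMoments

/-! ### Prime sums twisted by cosines. -/

namespace DeltaMoments

noncomputable section

open Finset MeasureTheory intervalIntegral

lemma IsClassM.exists_prime_bound {z : ℝ} {ρ : ArithmeticFunction ℝ} (hρ : IsClassM z ρ) :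
    ∃ B : ℝ, 0 < B ∧ ∀ p : ℕ, p.Prime → ρ p ≤ B := by
  obtain ⟨B, hB⟩ := hρ.bounded
  exact ⟨max B 1, by positivity, fun p hp => (hB p hp.isPrimePow).trans (le_max_left _ _)⟩

/-- Abel summation against the prime sum hypothesis. The saving `(log y)^{-c}` makes the error
integrable: it is dominated by `1/(t (log t)^{1+c})`, uniformly for bounded `λ`. -/
lemma exists_abs_sum_primes_cosKer_le {z : ℝ} {ρ : ArithmeticFunction ℝ} (hρ : IsClassM z ρ)
    (Lam : ℝ) : ∃ C : ℝ, ∀ lam b : ℝ, |lam| ≤ Lam → 2 ≤ b →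
      |∑ k ∈ Ioc ⌊(2 : ℝ)⌋₊ ⌊b⌋₊, cosKer lam k * (if k.Prime then ρ k * Real.log k else 0) -
        z * ∫ t in (2 : ℝ)..b, cosKer lam t| ≤ C := by
  obtain ⟨c, hc, K, hK⟩ := hρ.prime_sum
  set D := Lam + 1 + 1 / Real.log 2
  have hl2 : 0 < Real.log 2 := Real.log_pos one_lt_two
  refine ⟨2 * (|K| * Real.log 2 ^ (-(1 + c))) + D * |K| * (Real.log 2 ^ (-c) / c),
    fun lam b hlam hb => ?_⟩
  have hLam : 0 ≤ Lam := (abs_nonneg _).trans hlam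
  have hD : 0 ≤ D := by positivity
  set a : ℕ → ℝ := fun k => if k.Prime then ρ k * Real.log k else 0 with ha_def
  set A : ℝ → ℝ := fun t => ∑ k ∈ Icc 0 ⌊t⌋₊, a k with hA_def
  have hA : ∀ t : ℝ, 2 ≤ t → |A t - z * t| ≤ |K| * (t / Real.log t ^ c) := by
    intro t ht
    have h1 : A t = ∑ p ∈ Finset.Icc 1 ⌊t⌋₊ with p.Prime, ρ p * Real.log p := by
      rw [sum_filter]
      symm
      refine sum_subset (Icc_subset_Icc_left zero_le_one) fun k hk hk' => ?_
      have : k = 0 := by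
        simp only [mem_Icc] at hk hk'; omega
      simp [this, Nat.not_prime_zero]
    rw [h1]
    refine (hK t ht).trans ?_
    have : 0 ≤ t / Real.log t ^ c :=
      div_nonneg (by linarith) (Real.rpow_nonneg (Real.log_nonneg (by linarith)) _)
    gcongr
    exact le_abs_self K
  have hu : ∀ t ∈ Set.uIcc 2 b, 1 < t := fun t ht => by
    rw [Set.uIcc_of_le hb] at ht; linarith [ht.1]
  have hder : ∀ t ∈ Set.Icc 2 b, deriv (cosKer lam) t = cosKer' lam t := fun t ht =>
    (hasDerivAt_cosKer lam (by linarith [ht.1])).deriv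
  have hc' : ContinuousOn (cosKer' lam) (Set.Icc 2 b) := continuousOn_cosKer' lam one_lt_two
  have hint' : IntegrableOn (cosKer' lam) (Set.Icc 2 b) := hc'.integrableOn_Icc
  have habel := sum_mul_eq_sub_sub_integral_mul a (f := cosKer lam) (a := 2) (b := b) zero_le_two hb
    (fun t ht => (hasDerivAt_cosKer lam (by linarith [ht.1])).differentiableAt)
    (hint'.congr_fun (fun t ht => (hder t ht).symm) measurableSet_Icc)
  have hintA : IntervalIntegrable (fun t => cosKer' lam t * A t) volume 2 b := by
    rw [intervalIntegrable_iff_integrableOn_Icc_of_le hb]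
    exact integrableOn_mul_sum_Icc (m := 0) a zero_le_two hint'
  have hintT : IntervalIntegrable (fun t => cosKer' lam t * t) volume 2 b := by
    refine ContinuousOn.intervalIntegrable ?_
    rw [Set.uIcc_of_le hb]
    exact hc'.mul continuousOn_id
  have hI1 : ∫ t in Set.Ioc 2 b, deriv (cosKer lam) t * ∑ k ∈ Icc 0 ⌊t⌋₊, a k =
      z * (∫ t in (2 : ℝ)..b, cosKer' lam t * t) +
        ∫ t in (2 : ℝ)..b, cosKer' lam t * (A t - z * t) := by
    rw [← integral_of_le hb, ← intervalIntegral.integral_const_mul,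
      ← integral_add (hintT.const_mul z)]
    · refine integral_congr fun t ht => ?_
      rw [Set.uIcc_of_le hb] at ht
      simp only [hder t ht]
      ring
    · refine (hintA.sub (hintT.const_mul z)).congr ?_
      exact fun t _ => by ring
  have hparts : ∫ t in (2 : ℝ)..b, cosKer' lam t * t =
      cosKer lam b * b - cosKer lam 2 * 2 - ∫ t in (2 : ℝ)..b, cosKer lam t * 1 := by
    rw [integral_mul_deriv_eq_deriv_mul (u := cosKer lam) (v := fun t => t) (v' := fun _ => 1)
      (fun t ht => hasDerivAt_cosKer lam (hu t ht)) (fun t _ => hasDerivAt_id t)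
      (by rw [← Set.uIcc_of_le hb] at hc'; exact hc'.intervalIntegrable) (by simp)]
    ring
  have hend : ∀ t, 2 ≤ t → |cosKer lam t * (A t - z * t)| ≤ |K| * Real.log 2 ^ (-(1 + c)) := by
    intro t ht
    have hlt : Real.log 2 ≤ Real.log t := Real.log_le_log two_pos ht
    have hlt0 : 0 < Real.log t := hl2.trans_le hlt
    rw [abs_mul]
    calc |cosKer lam t| * |A t - z * t|
        ≤ 1 / (t * Real.log t) * (|K| * (t / Real.log t ^ c)) := by
          have h1 := abs_cosKer_le lam (t := t) (by linarith)
          have h2 := hA t ht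
          have : 0 ≤ 1 / (t * Real.log t) := by positivity
          gcongr
      _ = |K| * Real.log t ^ (-(1 + c)) := by
          rw [Real.rpow_neg hlt0.le, Real.rpow_add hlt0, Real.rpow_one]
          have : t ≠ 0 := by linarith
          field_simp
      _ ≤ _ := mul_le_mul_of_nonneg_left
          (Real.rpow_le_rpow_of_nonpos hl2 hlt (by linarith)) (abs_nonneg K)
  have herr : |∫ t in (2 : ℝ)..b, cosKer' lam t * (A t - z * t)| ≤
      D * |K| * (Real.log 2 ^ (-c) / c) := by
    obtain ⟨hi, hle⟩ := integral_inv_mul_log_rpow_le hc hb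
    rw [← Real.norm_eq_abs]
    refine (intervalIntegral.norm_integral_le_of_norm_le
      (g := fun t => D * |K| * (t⁻¹ * Real.log t ^ (-(1 + c)))) hb
      (Filter.Eventually.of_forall fun t ht => ?_) (hi.const_mul _)).trans ?_
    · have ht2 : 2 ≤ t := ht.1.le
      have ht0 : 0 < t := by linarith
      have hlt0 : 0 < Real.log t := Real.log_pos (by linarith)
      rw [Real.norm_eq_abs, abs_mul]
      calc |cosKer' lam t| * |A t - z * t|
          ≤ D / (t ^ 2 * Real.log t) * (|K| * (t / Real.log t ^ c)) := by
            have h1 := abs_cosKer'_le hlam ht2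
            have h2 := hA t ht2
            have : 0 ≤ D / (t ^ 2 * Real.log t) := by positivity
            exact mul_le_mul h1 h2 (abs_nonneg _) this
        _ = D * |K| * (t⁻¹ * Real.log t ^ (-(1 + c))) := by
            rw [Real.rpow_neg hlt0.le, Real.rpow_add hlt0, Real.rpow_one]
            field_simp
    · rw [intervalIntegral.integral_const_mul]
      gcongr
  have e1 := hend b hb
  have e2 := hend 2 le_rfl
  simp only [mul_one] at hparts
  rw [habel, hI1, hparts]
  have hsplit : cosKer lam b * (∑ k ∈ Icc 0 ⌊b⌋₊, a k) -
      cosKer lam 2 * (∑ k ∈ Icc 0 ⌊(2 : ℝ)⌋₊, a k) -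
      (z * (cosKer lam b * b - cosKer lam 2 * 2 - ∫ t in (2 : ℝ)..b, cosKer lam t) +
        ∫ t in (2 : ℝ)..b, cosKer' lam t * (A t - z * t)) -
      z * ∫ t in (2 : ℝ)..b, cosKer lam t =
      cosKer lam b * (A b - z * b) - cosKer lam 2 * (A 2 - z * 2) -
        ∫ t in (2 : ℝ)..b, cosKer' lam t * (A t - z * t) := by
    simp only [hA_def]; ring
  rw [hsplit]
  rw [abs_le] at e1 e2 herr ⊢
  constructor <;> linarith [e1.1, e1.2, e2.1, e2.2, herr.1, herr.2]

lemma primesLT_mono {x y : ℝ} (h : x ≤ y) : primesLT x ⊆ primesLT y := fun _ hp =>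
  mem_primesLT.2 ⟨(mem_primesLT.1 hp).1.trans_le h, (mem_primesLT.1 hp).2⟩

/-- The prime sums `∑_{p < y} ρ(p) cos(λ log p) / p` behave like
`-z log max(1 / log y, |λ|)`, uniformly for bounded `λ`. -/
theorem exists_abs_sum_cos_le {z : ℝ} {ρ : ArithmeticFunction ℝ} (hρ : IsClassM z ρ)
    (Lam : ℝ) : ∃ C : ℝ, ∀ lam y : ℝ, |lam| ≤ Lam → 2 ≤ y →
      |∑ p ∈ primesLT y, ρ p / p * Real.cos (lam * Real.log p) +
        z * Real.log (max (Real.log y)⁻¹ |lam|)| ≤ C := by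
  obtain ⟨B, hB0, hB⟩ := hρ.exists_prime_bound
  obtain ⟨C1, hC1⟩ := exists_abs_sum_primes_cosKer_le hρ Lam
  have hl2 : 0 < Real.log 2 := Real.log_pos one_lt_two
  obtain ⟨C2, hC2⟩ := exists_abs_integral_cos_div_add_log_le hl2 Lam
  -- One `B` is for the prime `2`, which the half-open range of the Abel sum omits; the other is for
  -- a possible prime equal to `y`, which is excluded from `primesLT y`.
  refine ⟨2 * B + C1 + |z| * C2, fun lam y hlam hy => ?_⟩
  have hfl : ⌊(2 : ℝ)⌋₊ = 2 := by norm_num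
  have h1 := hC1 lam y hlam hy
  have h2 := hC2 lam (Real.log y) hlam (Real.log_le_log two_pos hy)
  rw [integral_cosKer lam hy, hfl] at h1
  set I := ∫ w in (Real.log 2)..(Real.log y), Real.cos (lam * w) / w
  set h : ℕ → ℝ := fun p => ρ p / p * Real.cos (lam * Real.log p) with hdef
  have hbd : ∀ p : ℕ, p.Prime → |h p| ≤ B := by
    intro p hp
    have hp1 : (1 : ℝ) ≤ p := by exact_mod_cast hp.one_lt.le
    rw [hdef]
    simp only [abs_mul, abs_div, abs_of_nonneg (hρ.nonneg p), Nat.abs_cast]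
    have : ρ p / p ≤ B := (div_le_self (hρ.nonneg p) hp1).trans (hB p hp)
    have h0 : 0 ≤ ρ p / p := div_nonneg (hρ.nonneg p) (by linarith)
    nlinarith [Real.abs_cos_le_one (lam * Real.log p), abs_nonneg (Real.cos (lam * Real.log p))]
  have hsum : ∑ k ∈ Ioc 2 ⌊y⌋₊, cosKer lam k * (if k.Prime then ρ k * Real.log k else 0) =
      ∑ k ∈ (Ioc 2 ⌊y⌋₊).filter Nat.Prime, h k := by
    rw [sum_filter]
    refine sum_congr rfl fun k hk => ?_
    split_ifs with hp
    · have : (0 : ℝ) < Real.log k := Real.log_pos (by exact_mod_cast hp.one_lt)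
      rw [hdef, cosKer]
      field_simp
    · simp
  rw [hsum] at h1
  have hy0 : 0 ≤ y := by linarith
  have hfull : ∑ k ∈ (Ioc 2 ⌊y⌋₊).filter Nat.Prime, h k + h 2 =
      ∑ k ∈ (Icc 0 ⌊y⌋₊).filter Nat.Prime, h k := by
    rw [add_comm, ← sum_insert (by simp)]
    refine sum_congr ?_ fun _ _ => rfl
    ext k
    simp only [mem_insert, mem_filter, mem_Ioc, mem_Icc, zero_le, true_and]
    constructor
    · rintro (rfl | hk)
      · exact ⟨Nat.le_floor (by exact_mod_cast hy), Nat.prime_two⟩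
      · exact ⟨hk.1.2, hk.2⟩
    · rintro ⟨hk, hp⟩
      rcases hp.two_le.eq_or_lt with h | h
      · exact Or.inl h.symm
      · exact Or.inr ⟨⟨h, hk⟩, hp⟩
  have hlt : |∑ k ∈ (Icc 0 ⌊y⌋₊).filter Nat.Prime, h k - ∑ p ∈ primesLT y, h p| ≤ B := by
    have hsub : primesLT y ⊆ (Icc 0 ⌊y⌋₊).filter Nat.Prime := fun p hp => by
      rw [mem_primesLT] at hp
      simp [hp.2, Nat.le_floor hp.1.le]
    rw [← sum_sdiff hsub, add_sub_cancel_right]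
    have hs : ((Icc 0 ⌊y⌋₊).filter Nat.Prime \ primesLT y) ⊆ {⌊y⌋₊} := fun p hp => by
      simp only [mem_sdiff, mem_filter, mem_Icc, mem_primesLT, not_and, zero_le, true_and] at hp
      rw [mem_singleton]
      by_contra hne
      exact hp.2 ((Nat.cast_lt.2 (lt_of_le_of_ne hp.1.1 hne)).trans_le (Nat.floor_le hy0)) hp.1.2
    refine (abs_sum_le_sum_abs _ _).trans ?_
    refine (sum_le_card_nsmul _ _ B fun p hp => hbd p ?_).trans ?_
    · simp only [mem_sdiff, mem_filter] at hp; exact hp.1.2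
    · have := card_le_card hs
      rw [card_singleton] at this
      rw [nsmul_eq_mul]
      have : ((((Icc 0 ⌊y⌋₊).filter Nat.Prime \ primesLT y).card : ℕ) : ℝ) ≤ 1 :=
          by exact_mod_cast this
      nlinarith
  have h22 := hbd 2 Nat.prime_two
  have h3 : |z * (I + Real.log (max (Real.log y)⁻¹ |lam|))| ≤ |z| * C2 := by
    rw [abs_mul]; gcongr
  rw [← hfull] at hlt
  rw [abs_le] at *
  constructor <;> linarith [h1.1, h1.2, h22.1, h22.2, h3.1, h3.2, hlt.1, hlt.2]

end

end DeltaMoments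

/-! ### Sign vectors and their Fourier weights. -/

namespace DeltaMoments

noncomputable section

open Finset

/-- The Fourier weight `2^{-#{j : ε_j ≠ 0}}` of a sign vector. -/
def signWeight {N : ℕ} (e : Fin N → SignType) : ℝ :=
  ∏ j, if e j = 0 then 1 else 1 / 2

/-- A sign vector as a real vector. -/
def signVec {N : ℕ} (e : Fin N → SignType) : Fin N → ℝ :=
  fun j => (e j : ℝ)

/-- The inner product of a sign vector with `θ`. -/
def signDot {N : ℕ} (e : Fin N → SignType) (th : Fin N → ℝ) : ℝ :=
  ∑ j, (e j : ℝ) * th j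

lemma signWeight_nonneg {N : ℕ} (e : Fin N → SignType) : 0 ≤ signWeight e :=
  prod_nonneg fun j _ => by split_ifs <;> norm_num

lemma SignType.sum_univ {α : Type*} [AddCommMonoid α] (f : SignType → α) :
    ∑ s, f s = f 0 + f (-1) + f 1 := by
  have : (univ : Finset SignType) = {0, -1, 1} := rfl
  rw [this, sum_insert (by decide), sum_insert (by decide), sum_singleton, add_assoc]

/-- Each factor is `1 + e^{iφ}/2 + e^{-iφ}/2`, a sum over three signs; expand the product and take
real parts. -/
lemma prod_one_add_cos {N : ℕ} (th : Fin N → ℝ) (L : ℝ) :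
    ∏ j, (1 + Real.cos (th j * L)) = ∑ e, signWeight e * Real.cos (signDot e th * L) := by
  have h1 : ∀ j, ((1 + Real.cos (th j * L) : ℝ) : ℂ) = ∑ s : SignType,
      (if s = 0 then 1 else 1 / 2 : ℂ) * Complex.exp (((s : ℝ) * th j * L : ℝ) * Complex.I) := by
    intro j
    rw [SignType.sum_univ]
    simp only [Complex.ofReal_add, Complex.ofReal_one, Complex.ofReal_cos, Complex.cos]
    simp
    ring
  have h2 : ((∏ j, (1 + Real.cos (th j * L)) : ℝ) : ℂ) = ∑ e : Fin N → SignType,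
      ((signWeight e : ℝ) : ℂ) * Complex.exp ((signDot e th * L : ℝ) * Complex.I) := by
    rw [Complex.ofReal_prod, prod_congr rfl fun j _ => h1 j, prod_univ_sum, Fintype.piFinset_univ]
    refine sum_congr rfl fun e _ => ?_
    rw [prod_mul_distrib, ← Complex.exp_sum]
    congr 1
    · rw [signWeight, Complex.ofReal_prod]
      refine prod_congr rfl fun j _ => ?_
      split_ifs <;> simp
    · rw [signDot]
      push_cast
      rw [sum_mul, sum_mul]
  have h3 := congrArg Complex.re h2
  rw [Complex.ofReal_re, Complex.re_sum] at h3
  rw [h3]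
  refine sum_congr rfl fun e _ => ?_
  rw [Complex.re_ofReal_mul, Complex.exp_ofReal_mul_I_re]

lemma sum_signWeight (N : ℕ) : ∑ e : Fin N → SignType, signWeight e = 2 ^ N := by
  have h := prod_one_add_cos (N := N) (fun _ => 0) 0
  simp only [mul_zero, Real.cos_zero, mul_one] at h
  rw [← h, prod_const, card_univ, Fintype.card_fin]
  norm_num

/-- A subspace of dimension `n` is determined by `n` coordinates: cut by a coordinate hyperplane not
containing it, which lowers the dimension, and induct. -/
lemma exists_coords_injOn {N : ℕ} (n : ℕ) (W : Submodule ℝ (Fin N → ℝ))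
    (hn : Module.finrank ℝ W ≤ n) :
    ∃ J : Finset (Fin N), J.card ≤ n ∧ ∀ x ∈ W, (∀ j ∈ J, x j = 0) → x = 0 := by
  induction n generalizing W with
  | zero =>
    refine ⟨∅, by simp, fun x hx _ => ?_⟩
    rw [Nat.le_zero, Submodule.finrank_eq_zero] at hn
    rw [hn] at hx
    exact (Submodule.mem_bot ℝ).1 hx
  | succ n ih =>
    by_cases hW : W = ⊥
    · refine ⟨∅, by simp, fun x hx _ => ?_⟩
      rw [hW] at hx
      exact (Submodule.mem_bot ℝ).1 hx
    · obtain ⟨x, hx, hx0⟩ := Submodule.exists_mem_ne_zero_of_ne_bot hW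
      obtain ⟨i, hi⟩ := Function.ne_iff.1 hx0
      have hlt : W ⊓ LinearMap.ker (LinearMap.proj (R := ℝ) (φ := fun _ : Fin N => ℝ) i) < W := by
        refine lt_of_le_of_ne inf_le_left fun h => hi ?_
        rw [← h] at hx
        exact hx.2
      obtain ⟨J, hJ, hJ'⟩ :=
          ih _ (Nat.lt_succ_iff.1 ((Submodule.finrank_lt_finrank_of_lt hlt).trans_le hn))
      refine ⟨insert i J, (card_insert_le _ _).trans (by omega), fun y hy hyJ => ?_⟩
      exact hJ' y ⟨hy, hyJ i (mem_insert_self _ _)⟩ fun j hj => hyJ j (mem_insert_of_mem hj)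

open scoped Classical in
/-- The sign vectors in a subspace `W` have total weight at most `2 ^ dim W`. -/
lemma sum_signWeight_le {N : ℕ} (W : Submodule ℝ (Fin N → ℝ)) :
    ∑ e : Fin N → SignType with signVec e ∈ W, signWeight e ≤ 2 ^ Module.finrank ℝ W := by
  obtain ⟨J, hJ, hJ'⟩ := exists_coords_injOn _ W le_rfl
  have hw0 : ∀ s : SignType, (0 : ℝ) ≤ if s = 0 then 1 else 1 / 2 := fun s => by
    split_ifs <;> norm_num
  have hw1 : ∀ s : SignType, (if s = 0 then 1 else 1 / 2 : ℝ) ≤ 1 := fun s => by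
    split_ifs <;> norm_num
  calc ∑ e : Fin N → SignType with signVec e ∈ W, signWeight e
      ≤ ∑ e : Fin N → SignType with signVec e ∈ W, ∏ j : J, (if e j = 0 then 1 else 1 / 2 : ℝ) := by
        refine sum_le_sum fun e _ => ?_
        rw [signWeight, prod_coe_sort J (fun j => (if e j = 0 then 1 else 1 / 2 : ℝ)),
          ← prod_sdiff (subset_univ J)]
        exact mul_le_of_le_one_left (prod_nonneg fun j _ => hw0 _)
          (prod_le_one (fun j _ => hw0 _) fun j _ => hw1 _)
    _ = ∑ y ∈ (univ.filter fun e : Fin N → SignType => signVec e ∈ W).image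
          (fun e (j : J) => e j), ∏ j : J, (if y j = 0 then 1 else 1 / 2 : ℝ) := by
        rw [sum_image]
        -- Restriction to `J` is injective on the sign vectors in `W`: the difference of two of them
        -- lies in `W` and vanishes on `J`. Dropping the other weights, all at most `1`, leaves a
        -- full product over `J` in which each factor sums to `1 + 1/2 + 1/2`.
        intro a ha b hb hab
        simp only [coe_filter, mem_univ, true_and, Set.mem_ofPred_eq] at ha hb
        have h0 := hJ' _ (W.sub_mem ha hb) fun j hj => by
          have := congrFun hab ⟨j, hj⟩
          simp only at this
          simp [signVec, this]
        funext j
        have h1 := congrFun h0 j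
        simp only [signVec, Pi.sub_apply, Pi.zero_apply, sub_eq_zero] at h1
        revert h1
        cases a j <;> cases b j <;> norm_num
    _ ≤ ∑ y : J → SignType, ∏ j : J, (if y j = 0 then 1 else 1 / 2 : ℝ) :=
        sum_le_sum_of_subset_of_nonneg (subset_univ _) fun y _ _ => prod_nonneg fun j _ => hw0 _
    _ = 2 ^ J.card := by
        have h := prod_univ_sum (fun _ : J => (univ : Finset SignType))
          (fun (_ : J) (s : SignType) => (if s = 0 then 1 else 1 / 2 : ℝ))
        rw [Fintype.piFinset_univ] at h
        rw [← h, prod_const, card_univ, Fintype.card_coe, SignType.sum_univ]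
        norm_num
    _ ≤ _ := pow_le_pow_right₀ one_le_two hJ

end

end DeltaMoments

/-! ### Rank profiles of `θ` and volumes. -/

namespace DeltaMoments

noncomputable section

open Finset MeasureTheory

/-- The span of the sign vectors `ε` with `|ε · θ| ≤ s`. -/
def lowSpan {N : ℕ} (th : Fin N → ℝ) (s : ℝ) : Submodule ℝ (Fin N → ℝ) :=
  Submodule.span ℝ (signVec '' {e | |signDot e th| ≤ s})

/-- The dimension of `lowSpan θ s`. -/
def lowRank {N : ℕ} (th : Fin N → ℝ) (s : ℝ) : ℕ :=
  Module.finrank ℝ (lowSpan th s)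

lemma lowRank_mono {N : ℕ} (th : Fin N → ℝ) {s s' : ℝ} (h : s ≤ s') :
    lowRank th s ≤ lowRank th s' :=
  Submodule.finrank_mono (Submodule.span_mono (Set.image_mono fun _ he => le_trans he h))

lemma lowRank_le {N : ℕ} (th : Fin N → ℝ) (s : ℝ) : lowRank th s ≤ N := by
  have h := Submodule.finrank_le (lowSpan th s)
  rwa [Module.finrank_fin_fun] at h

lemma lowRank_of_one_le {N : ℕ} {th : Fin N → ℝ} (hth : th ∈ Set.Icc 0 1) {s : ℝ} (hs : 1 ≤ s) :
    lowRank th s = N := by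
  have htop : lowSpan th s = ⊤ := by
    rw [eq_top_iff, ← (Pi.basisFun ℝ (Fin N)).span_eq, lowSpan]
    refine Submodule.span_mono ?_
    rintro _ ⟨i, rfl⟩
    refine ⟨Pi.single i 1, ?_, ?_⟩
    · have : signDot (Pi.single i 1) th = th i := by
        rw [signDot, sum_eq_single i]
        · simp
        · intro j _ hj
          simp [Pi.single_eq_of_ne hj]
        · simp
      rw [Set.mem_ofPred_eq, this, abs_of_nonneg (hth.1 i)]
      exact (hth.2 i).trans hs
    · funext j
      rw [Pi.basisFun_apply, signVec]
      rcases eq_or_ne j i with rfl | hj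
      · simp
      · simp [Pi.single_eq_of_ne hj]
  rw [lowRank, htop, finrank_top, Module.finrank_fin_fun]

/-- Greedy choice: a space of dimension at least `j + 1` is not contained in the span of the `j`
vectors already chosen, so one of its generators is new. -/
lemma exists_linearIndependent_signDot_le {N : ℕ} (th : Fin N → ℝ) (b : ℕ → ℝ) (n : ℕ)
    (h : ∀ j < n, j + 1 ≤ lowRank th (b j)) :
    ∃ e : Fin n → Fin N → SignType, LinearIndependent ℝ (fun j => signVec (e j)) ∧
      ∀ j, |signDot (e j) th| ≤ b j := by
  induction n with
  | zero => exact ⟨Fin.elim0, linearIndependent_empty_type, fun j => j.elim0⟩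
  | succ n ih =>
    obtain ⟨e, he, hb⟩ := ih fun j hj => h j (by omega)
    have hnot : ∃ f : Fin N → SignType, |signDot f th| ≤ b n ∧
        signVec f ∉ Submodule.span ℝ (Set.range fun j => signVec (e j)) := by
      by_contra hcon
      push Not at hcon
      have hle : lowSpan th (b n) ≤ Submodule.span ℝ (Set.range fun j => signVec (e j)) := by
        refine Submodule.span_le.2 ?_
        rintro _ ⟨f, hf, rfl⟩
        exact hcon f hf
      have h1 := Submodule.finrank_mono hle
      have h2 := finrank_range_le_card (R := ℝ) (fun j => signVec (e j))
      have h3 := h n (by omega)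
      rw [Fintype.card_fin] at h2
      rw [Set.finrank] at h2
      rw [lowRank] at h3
      omega
    obtain ⟨f, hf, hfs⟩ := hnot
    refine ⟨Fin.snoc e f, ?_, ?_⟩
    · have : (fun j => signVec ((Fin.snoc e f : Fin (n + 1) → Fin N → SignType) j)) =
          Fin.snoc (fun j => signVec (e j)) (signVec f) := Fin.comp_snoc signVec e f
      rw [this]
      exact linearIndependent_finSnoc.2 ⟨he, hfs⟩
    · intro j
      refine Fin.lastCases ?_ (fun i => ?_) j
      · simpa using hf
      · simpa using hb i

/-- The set is the preimage of a box under an invertible matrix. The constant depends only on the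
matrix, and there are finitely many matrices of signs. -/
lemma volume_signDot_le {N : ℕ} (e : Fin N → Fin N → SignType)
    (he : LinearIndependent ℝ (fun j => signVec (e j))) :
    ∃ C : ℝ, 0 < C ∧ ∀ b : Fin N → ℝ, (∀ j, 0 ≤ b j) →
      volume {th : Fin N → ℝ | ∀ j, |signDot (e j) th| ≤ b j} = ENNReal.ofReal (C * ∏ j, b j) := by
  set A : Matrix (Fin N) (Fin N) ℝ := Matrix.of fun j => signVec (e j) with hA
  have hdet : LinearMap.det (Matrix.toLin' A) ≠ 0 := by
    rw [LinearMap.det_toLin']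
    have : IsUnit A := Matrix.linearIndependent_rows_iff_isUnit.1 he
    exact ((Matrix.isUnit_iff_isUnit_det A).1 this).ne_zero
  refine ⟨|(LinearMap.det (Matrix.toLin' A))⁻¹| * 2 ^ N,
    mul_pos (abs_pos.2 (inv_ne_zero hdet)) (by positivity), fun b hb => ?_⟩
  have hset : {th : Fin N → ℝ | ∀ j, |signDot (e j) th| ≤ b j} =
      (Matrix.toLin' A) ⁻¹' Set.Icc (-b) b := by
    ext th
    simp only [Set.mem_ofPred_eq, Set.mem_preimage, Set.mem_Icc, Pi.le_def, ← forall_and]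
    refine forall_congr' fun j => ?_
    rw [abs_le, Matrix.toLin'_apply]
    rfl
  rw [hset, Measure.addHaar_preimage_linearMap _ hdet, Real.volume_Icc_pi, mul_assoc,
    ENNReal.ofReal_mul (abs_nonneg _)]
  congr 1
  rw [← ENNReal.ofReal_prod_of_nonneg fun j _ => by
    have := hb j
    simp only [Pi.neg_apply]; linarith]
  congr 1
  have : ∀ j, b j - (-b) j = 2 * b j := fun j => by simp only [Pi.neg_apply]; ring
  simp only [this, prod_mul_distrib, prod_const, card_univ, Fintype.card_fin]

/-- For an antitone sequence the superlevel sets are initial segments, hence are described by their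
cardinality. -/
lemma lt_card_filter_iff {r : ℕ → ℕ} (hr : Antitone r) (M a i : ℕ) :
    i < #{i ∈ range M | a ≤ r i} ↔ i < M ∧ a ≤ r i := by
  constructor
  · intro h
    by_contra hcon
    have hsub : {i ∈ range M | a ≤ r i} ⊆ range i := fun k hk => by
      rw [mem_filter, mem_range] at hk
      rw [mem_range]
      by_contra hik
      exact hcon ⟨by omega, hk.2.trans (hr (by omega))⟩
    have := card_le_card hsub
    rw [card_range] at this
    omega
  · rintro ⟨h1, h2⟩
    have hsub : range (i + 1) ⊆ {i ∈ range M | a ≤ r i} := fun k hk => by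
      rw [mem_range] at hk
      rw [mem_filter, mem_range]
      exact ⟨by omega, h2.trans (hr (by omega))⟩
    have := card_le_card hsub
    rw [card_range] at this
    omega

/-- The number of scales `i < M` at which the rank of `θ` equals `j`. -/
def occ {N : ℕ} (B : ℝ) (M : ℕ) (th : Fin N → ℝ) (j : Fin (N + 1)) : ℕ :=
  #{i ∈ range M | lowRank th (B ^ i)⁻¹ = j}

lemma antitone_lowRank {N : ℕ} {B : ℝ} (hB : 1 ≤ B) (th : Fin N → ℝ) :
    Antitone fun i : ℕ => lowRank th (B ^ i)⁻¹ := fun i j hij =>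
  lowRank_mono th (inv_anti₀ (by positivity) (pow_le_pow_right₀ hB hij))

lemma sum_lowRank_eq_sum_occ {N : ℕ} (B : ℝ) (M : ℕ) (th : Fin N → ℝ) (f : ℕ → ℝ) :
    ∑ i ∈ range M, f (lowRank th (B ^ i)⁻¹) = ∑ j : Fin (N + 1), occ B M th j * f j := by
  have hmaps : ∀ i ∈ range M, (⟨lowRank th (B ^ i)⁻¹,
      Nat.lt_succ_of_le (lowRank_le _ _)⟩ : Fin (N + 1)) ∈
    (univ : Finset (Fin (N + 1))) := fun _ _ => mem_univ _
  rw [← sum_fiberwise_of_maps_to hmaps]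
  refine sum_congr rfl fun j _ => ?_
  rw [occ, ← nsmul_eq_mul, ← sum_const]
  refine sum_congr (filter_congr fun i _ => ?_) fun i hi => ?_
  · rw [Fin.ext_iff]
  · rw [mem_filter] at hi
    rw [hi.2]

lemma card_filter_le_lowRank {N : ℕ} (B : ℝ) (M : ℕ) (th : Fin N → ℝ) (a : ℕ) :
    #{i ∈ range M | a ≤ lowRank th (B ^ i)⁻¹} = ∑ l : Fin (N + 1) with a ≤ l.1, occ B M th l := by
  have h := sum_lowRank_eq_sum_occ B M th (fun r => if a ≤ r then 1 else 0)
  rw [sum_boole] at h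
  simp only [mul_ite, mul_one, mul_zero] at h
  rw [← sum_filter] at h
  exact_mod_cast h

lemma sum_occ {N : ℕ} (B : ℝ) (M : ℕ) (th : Fin N → ℝ) : ∑ l, occ B M th l = M := by
  have h := card_filter_le_lowRank B M th 0
  simpa using h.symm

end

end DeltaMoments

/-! ### Integration over the cube by occupation numbers. -/

namespace DeltaMoments

noncomputable section

open Finset MeasureTheory

/-- The number of scales with rank at least `j + 1`, in terms of the occupation numbers. -/
def occTail {N : ℕ} (g : Fin (N + 1) → ℕ) (j : ℕ) : ℕ :=
  ∑ l : Fin (N + 1) with j + 1 ≤ l.1, g l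

lemma sum_occTail {N : ℕ} (g : Fin (N + 1) → ℕ) :
    ∑ j : Fin N, occTail g j = ∑ l : Fin (N + 1), l * g l := by
  simp only [occTail, sum_filter]
  rw [sum_comm]
  refine sum_congr rfl fun l _ => ?_
  rw [← sum_filter, sum_const, smul_eq_mul]
  congr 1
  have h : (univ.filter fun j : Fin N => j.1 + 1 ≤ l.1).map Fin.valEmbedding = range l.1 := by
    ext i
    simp only [mem_map, mem_filter, mem_univ, true_and, Fin.valEmbedding_apply, mem_range]
    constructor
    · rintro ⟨j, hj, rfl⟩; omega
    · intro hi
      exact ⟨⟨i, by omega⟩, by simpa using hi, rfl⟩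
  rw [← card_map Fin.valEmbedding, h, card_range]

/-- The profile of `θ` confines it to a parallelepiped: the `j`-th independent sign vector can be
taken from the last scale of rank at least `j + 1`, and `occTail` counts the scales up to that one.
-/
lemma exists_linearIndependent_of_occ {N : ℕ} {B : ℝ} (hB : 1 ≤ B) (M : ℕ) {th : Fin N → ℝ}
    (hth : th ∈ Set.Icc 0 1) :
    ∃ e : Fin N → Fin N → SignType, LinearIndependent ℝ (fun j => signVec (e j)) ∧
      ∀ j : Fin N, |signDot (e j) th| ≤ B * (B ^ occTail (occ B M th) j)⁻¹ := by
  refine exists_linearIndependent_signDot_le th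
    (fun j => B * (B ^ occTail (occ B M th) j)⁻¹) N fun j hj => ?_
  rw [occTail, ← card_filter_le_lowRank]
  -- If no scale has rank `j + 1`, the required bound is `B ≥ 1`, and at that level the rank is
  -- already `N`.
  rcases Nat.eq_zero_or_pos (#{i ∈ range M | j + 1 ≤ lowRank th (B ^ i)⁻¹}) with h | h
  · rw [h, lowRank_of_one_le hth (by simpa using hB)]
    omega
  · obtain ⟨k, hk⟩ := Nat.exists_eq_succ_of_ne_zero h.ne'
    have h1 := (lt_card_filter_iff (antitone_lowRank hB th) M (j + 1) k).1 (by omega)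
    rw [hk]
    have hB0 : B ≠ 0 := by positivity
    have : B * (B ^ (k + 1))⁻¹ = (B ^ k)⁻¹ := by
      rw [pow_succ]; field_simp
    rw [Nat.succ_eq_add_one, this]
    exact h1.2

/-- An integral over the unit cube of a function bounded in terms of the occupation numbers is at
most a sum over the possible occupation numbers. -/
theorem exists_integral_cube_le (N : ℕ) : ∃ C : ℝ, 0 < C ∧ ∀ (B : ℝ) (M : ℕ)
    (Φ : (Fin (N + 1) → ℕ) → ℝ) (F : (Fin N → ℝ) → ℝ), 1 ≤ B → (∀ g, 0 ≤ Φ g) → Continuous F →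
    (∀ th ∈ Set.Icc (0 : Fin N → ℝ) 1, F th ≤ Φ (occ B M th)) →
    ∫ th in Set.Icc (0 : Fin N → ℝ) 1, F th ≤
      C * B ^ N * ∑ g ∈ piAntidiag univ M, Φ g * (B ^ ∑ l : Fin (N + 1), (l : ℕ) * g l)⁻¹ := by
  classical
  have hCe : ∀ e : Fin N → Fin N → SignType, ∃ C : ℝ, 0 < C ∧
      (LinearIndependent ℝ (fun j => signVec (e j)) → ∀ b : Fin N → ℝ, (∀ j, 0 ≤ b j) →
        volume {th : Fin N → ℝ | ∀ j, |signDot (e j) th| ≤ b j} =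
          ENNReal.ofReal (C * ∏ j, b j)) := by
    intro e
    by_cases he : LinearIndependent ℝ (fun j => signVec (e j))
    · obtain ⟨C, h0, hC⟩ := volume_signDot_le e he
      exact ⟨C, h0, fun _ => hC⟩
    · exact ⟨1, one_pos, fun h => absurd h he⟩
  choose Ce hCe0 hCe using hCe
  refine ⟨∑ e, Ce e, sum_pos (fun e _ => hCe0 e) univ_nonempty, fun B M Φ F hB hΦ hF hle => ?_⟩
  have hB0 : 0 < B := by positivity
  set E : Finset (Fin N → Fin N → SignType) :=
    univ.filter fun e => LinearIndependent ℝ (fun j => signVec (e j)) with hE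
  set U : (Fin (N + 1) → ℕ) → (Fin N → Fin N → SignType) → Set (Fin N → ℝ) := fun g e =>
    {th | ∀ j, |signDot (e j) th| ≤ B * (B ^ occTail g j)⁻¹} with hU
  have hcont : ∀ f : Fin N → SignType, Continuous (signDot f) := fun f => by
    unfold signDot; fun_prop
  have hUm : ∀ g e, MeasurableSet (U g e) := fun g e => by
    have : U g e = ⋂ j, {th | |signDot (e j) th| ≤ B * (B ^ occTail g j)⁻¹} := by
      ext th; simp [hU]
    rw [this]
    exact MeasurableSet.iInter fun j =>
      (isClosed_le (hcont _).abs continuous_const).measurableSet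
  have hvol : ∀ g, ∀ e ∈ E, volume (U g e) =
      ENNReal.ofReal (Ce e * (B ^ N * (B ^ ∑ l : Fin (N + 1), (l : ℕ) * g l)⁻¹)) := fun g e he => by
    rw [hE, mem_filter] at he
    rw [hU, hCe e he.2 _ fun j => by positivity, prod_mul_distrib, prod_const, card_univ,
      Fintype.card_fin, prod_inv_distrib, prod_pow_eq_pow_sum, sum_occTail]
  have hint : ∀ g, ∀ e ∈ E, Integrable ((U g e).indicator fun _ => Φ g)
      (volume.restrict (Set.Icc (0 : Fin N → ℝ) 1)) := fun g e he => by
    exact (integrableOn_const (isCompact_Icc.measure_lt_top.ne)).indicator (hUm g e)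
  calc ∫ th in Set.Icc (0 : Fin N → ℝ) 1, F th
      ≤ ∫ th in Set.Icc (0 : Fin N → ℝ) 1, ∑ g ∈ piAntidiag univ M, ∑ e ∈ E,
          (U g e).indicator (fun _ => Φ g) th := by
        refine setIntegral_mono_on (hF.continuousOn.integrableOn_compact isCompact_Icc)
          (integrable_finsetSum _ fun g _ => integrable_finsetSum _ fun e he => hint g e he)
          measurableSet_Icc fun th hth => ?_
        -- The single term given by the profile of `θ` itself and one adapted independent family
        -- already dominates `F θ`; the rest of the double sum is nonnegative.
        obtain ⟨e, he, hb⟩ := exists_linearIndependent_of_occ hB M hth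
        have hnn : ∀ g e, 0 ≤ (U g e).indicator (fun _ => Φ g) th := fun g e =>
          Set.indicator_nonneg (fun _ _ => hΦ g) _
        have hmem : occ B M th ∈ piAntidiag univ M := by
          rw [mem_piAntidiag]
          exact ⟨sum_occ B M th, by simp⟩
        refine (hle th hth).trans ?_
        refine le_trans ?_ (single_le_sum (f := fun g => ∑ e ∈ E, (U g e).indicator (fun _ =>
            Φ g) th)
          (fun g _ => sum_nonneg fun e _ => hnn g e) hmem)
        refine le_trans ?_ (single_le_sum (f := fun e =>
          (U (occ B M th) e).indicator (fun _ => Φ (occ B M th)) th)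
          (fun e _ => hnn _ e) (mem_filter.2 ⟨mem_univ e, he⟩))
        rw [Set.indicator_of_mem (show th ∈ U (occ B M th) e from hb)]
    _ = ∑ g ∈ piAntidiag univ M, ∑ e ∈ E, ∫ th in Set.Icc (0 : Fin N → ℝ) 1,
          (U g e).indicator (fun _ => Φ g) th := by
        rw [integral_finsetSum _ fun g _ => integrable_finsetSum _ fun e he => hint g e he]
        exact sum_congr rfl fun g _ => integral_finsetSum _ fun e he => hint g e he
    _ ≤ ∑ g ∈ piAntidiag univ M, ∑ e ∈ E,
          Φ g * (Ce e * (B ^ N * (B ^ ∑ l : Fin (N + 1), (l : ℕ) * g l)⁻¹)) := by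
        refine sum_le_sum fun g _ => sum_le_sum fun e he => ?_
        have h0 : 0 ≤ Ce e * (B ^ N * (B ^ ∑ l : Fin (N + 1), (l : ℕ) * g l)⁻¹) :=
          mul_nonneg (hCe0 e).le (by positivity)
        rw [integral_indicator (hUm g e), setIntegral_const, smul_eq_mul, mul_comm]
        refine mul_le_mul_of_nonneg_left ?_ (hΦ g)
        rw [measureReal_restrict_apply (hUm g e)]
        refine (measureReal_mono Set.inter_subset_left (by rw [hvol g e he]; exact ENNReal.ofReal_ne_top)).trans ?_
        rw [measureReal_def, hvol g e he, ENNReal.toReal_ofReal h0]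
    _ = (∑ e ∈ E, Ce e) * B ^ N *
          ∑ g ∈ piAntidiag univ M, Φ g * (B ^ ∑ l : Fin (N + 1), (l : ℕ) * g l)⁻¹ := by
        rw [mul_sum]
        refine sum_congr rfl fun g _ => ?_
        rw [sum_mul, sum_mul]
        exact sum_congr rfl fun e _ => by ring
    _ ≤ _ := by
        have h1 : ∑ e ∈ E, Ce e ≤ ∑ e, Ce e :=
          sum_le_sum_of_subset_of_nonneg (subset_univ _) fun e _ _ => (hCe0 e).le
        have h2 : 0 ≤ ∑ g ∈ piAntidiag univ M, Φ g * (B ^ ∑ l : Fin (N + 1), (l : ℕ) * g l)⁻¹ :=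
          sum_nonneg fun g _ => mul_nonneg (hΦ g) (by positivity)
        gcongr

end

end DeltaMoments

/-! ### `M_2` and Fejér-type kernels. -/

namespace DeltaMoments

noncomputable section

open Finset MeasureTheory

/-- The triangle function `max 0 (1 - |v|)`. -/
def tri (v : ℝ) : ℝ := max 0 (1 - |v|)

lemma tri_nonneg (v : ℝ) : 0 ≤ tri v := le_max_left _ _

lemma Delta_eq_sum {n : ℕ} (u : ℝ) :
    (Delta n u : ℝ) = ∑ d ∈ n.divisors,
      (Set.Ico (Real.log d - 1) (Real.log d)).indicator (fun _ => (1 : ℝ)) u := by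
  rw [Delta, card_eq_sum_ones, sum_filter]
  push_cast
  refine sum_congr rfl fun d hd => ?_
  have hd0 : (0 : ℝ) < d := by exact_mod_cast Nat.pos_of_mem_divisors hd
  rw [Set.indicator_apply]
  refine if_congr ?_ rfl rfl
  rw [Set.mem_Ico, ← Real.lt_log_iff_exp_lt hd0, ← Real.log_le_iff_le_exp hd0]
  constructor <;> rintro ⟨h1, h2⟩ <;> constructor <;> linarith

/-- Two unit intervals ending at `log d` and `log d'` overlap in length `max(0, 1 - |log d - log
d'|)`. -/
lemma M_two_eq (n : ℕ) :
    M 2 n = ∑ d ∈ n.divisors, ∑ d' ∈ n.divisors, tri (Real.log d - Real.log d') := by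
  unfold M
  have h : ∀ u, (Delta n u : ℝ) ^ 2 = ∑ d ∈ n.divisors, ∑ d' ∈ n.divisors,
      (Set.Ico (Real.log d - 1) (Real.log d) ∩ Set.Ico (Real.log d' - 1) (Real.log d')).indicator
        (fun _ => (1 : ℝ)) u := by
    intro u
    rw [Delta_eq_sum, sq, sum_mul_sum]
    refine sum_congr rfl fun d _ => sum_congr rfl fun d' _ => ?_
    rw [← Set.inter_indicator_mul]
    simp
  have hint : ∀ d d' : ℕ, Integrable ((Set.Ico (Real.log d - 1) (Real.log d) ∩
      Set.Ico (Real.log d' - 1) (Real.log d')).indicator (fun _ => (1 : ℝ))) volume := by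
    intro d d'
    rw [integrable_indicator_iff (measurableSet_Ico.inter measurableSet_Ico)]
    exact integrableOn_const ((measure_mono Set.inter_subset_left).trans_lt measure_Ico_lt_top).ne
  simp only [h]
  rw [integral_finsetSum _ fun d _ => integrable_finsetSum _ fun d' _ => hint d d']
  refine sum_congr rfl fun d _ => ?_
  rw [integral_finsetSum _ fun d' _ => hint d d']
  refine sum_congr rfl fun d' _ => ?_
  rw [integral_indicator_const _ (measurableSet_Ico.inter measurableSet_Ico), smul_eq_mul, mul_one,
    Set.Ico_inter_Ico, Real.volume_real_Ico, tri, max_comm]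
  congr 1
  rcases le_total (Real.log d) (Real.log d') with h | h
  · rw [abs_of_nonpos (by linarith), min_eq_left h, max_eq_right (by linarith)]; ring
  · rw [abs_of_nonneg (by linarith), min_eq_right h, max_eq_left (by linarith)]; ring

/-- The Fejér-type kernel `∫_0^1 (1 - θ) cos (θ v) dθ`. -/
def fejer (v : ℝ) : ℝ := ∫ th in (0 : ℝ)..1, (1 - th) * Real.cos (th * v)

lemma fejer_eq {v : ℝ} (hv : v ≠ 0) : fejer v = (1 - Real.cos v) / v ^ 2 := by
  unfold fejer
  rw [intervalIntegral.integral_eq_sub_of_hasDerivAt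
    (f := fun th => (1 - th) * (Real.sin (th * v) / v) - Real.cos (th * v) / v ^ 2)]
  · simp; ring
  · intro th _
    have h1 : HasDerivAt (fun th : ℝ => th * v) v th :=
        by simpa using (hasDerivAt_id th).mul_const v
    have h2 := (((hasDerivAt_id th).const_sub 1).mul (h1.sin.div_const v)).sub (h1.cos.div_const (v ^ 2))
    refine h2.congr_deriv ?_
    simp only [id]
    field_simp
    ring
  · apply Continuous.intervalIntegrable; fun_prop

lemma fejer_zero : fejer 0 = 1 / 2 := by
  unfold fejer
  simp only [mul_zero, Real.cos_zero, mul_one]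
  rw [intervalIntegral.integral_sub (by simp) (by simp)]
  simp; norm_num

lemma fejer_nonneg (v : ℝ) : 0 ≤ fejer v := by
  rcases eq_or_ne v 0 with rfl | hv
  · rw [fejer_zero]; norm_num
  · rw [fejer_eq hv]
    have := Real.cos_le_one v
    exact div_nonneg (by linarith) (by positivity)

lemma tri_le_fejer (v : ℝ) : tri v ≤ 5 / 2 * fejer v := by
  have h0 := fejer_nonneg v
  unfold tri
  refine max_le (by linarith) ?_
  by_cases h1 : |v| ≤ 1
  · have hn := abs_nonneg v
    suffices 2 / 5 ≤ fejer v by linarith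
    rcases eq_or_ne v 0 with rfl | hv
    · rw [fejer_zero]; norm_num
    · have hv2 : 0 < v ^ 2 := by positivity
      rw [fejer_eq hv, le_div_iff₀ hv2]
      have hb := abs_le.1 (Real.cos_bound h1)
      have h4 : |v| ^ 4 = v ^ 2 * v ^ 2 := by rw [← sq_abs]; ring
      have hv1 : v ^ 2 ≤ 1 := by rw [← sq_abs]; nlinarith
      rw [h4] at hb
      nlinarith [hb.2]
  · linarith

lemma fejer_le (v : ℝ) : fejer v ≤ 4 / (1 + v ^ 2) := by
  rcases eq_or_ne v 0 with rfl | hv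
  · rw [fejer_zero]; norm_num
  · have hv2 : 0 < v ^ 2 := by positivity
    rw [fejer_eq hv, div_le_div_iff₀ hv2 (by positivity)]
    have h1 := Real.one_sub_sq_div_two_le_cos (x := v)
    have h2 := Real.neg_one_le_cos v
    by_cases h : v ^ 2 ≤ 1
    · nlinarith
    · nlinarith

lemma summable_one_div_one_add_sq : Summable fun k : ℤ => 1 / (1 + (k : ℝ) ^ 2) := by
  have h1 : Summable fun k : ℤ => 1 / (k : ℝ) ^ 2 + if k = 0 then 1 else 0 :=
    (Real.summable_one_div_int_pow.2 one_lt_two).add (hasSum_ite_eq 0 1).summable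
  refine h1.of_nonneg_of_le (fun k => by positivity) fun k => ?_
  split_ifs with hk
  · simp [hk]
  · have : (k : ℝ) ≠ 0 := by exact_mod_cast hk
    have : 0 < (k : ℝ) ^ 2 := by positivity
    rw [add_zero]
    gcongr
    linarith

/-- Schur's test: grouping by the value of `c` gives a convolution form in the multiplicities `n_j`,
bounded by the `ℓ^1` norm of the kernel times `∑ n_j^2`. -/
lemma sum_sum_int_le (D : Finset ℕ) (c : ℕ → ℤ) :
    ∑ d ∈ D, ∑ d' ∈ D, 1 / (1 + ((c d - c d' : ℤ) : ℝ) ^ 2) ≤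
      (∑' k : ℤ, 1 / (1 + (k : ℝ) ^ 2)) * ∑ d ∈ D, ∑ d' ∈ D, if c d = c d' then 1 else 0 := by
  set J := D.image c
  set ψ : ℤ → ℝ := fun k => 1 / (1 + (k : ℝ) ^ 2) with hψ
  set n : ℤ → ℝ := fun j => ∑ d ∈ D, if c d = j then 1 else 0 with hn
  have hself : ∀ (f : ℤ → ℝ), ∑ d ∈ D, f (c d) = ∑ j ∈ J, n j * f j := by
    intro f
    rw [← sum_fiberwise_of_maps_to (g := c) (t := J) fun d hd => mem_image_of_mem c hd]
    refine sum_congr rfl fun j _ => ?_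
    simp only [hn]
    rw [sum_mul, sum_filter]
    refine sum_congr rfl fun d _ => ?_
    split_ifs with h
    · rw [h, one_mul]
    · rw [zero_mul]
  have h1 : ∑ d ∈ D, ∑ d' ∈ D, 1 / (1 + ((c d - c d' : ℤ) : ℝ) ^ 2) =
      ∑ j ∈ J, ∑ j' ∈ J, n j * n j' * ψ (j - j') := by
    have e1 : ∀ d, ∑ d' ∈ D, 1 / (1 + ((c d - c d' : ℤ) : ℝ) ^ 2) =
        ∑ j' ∈ J, n j' * ψ (c d - j') := fun d => hself (fun j' => ψ (c d - j'))
    rw [sum_congr rfl fun d _ => e1 d, hself (fun j => ∑ j' ∈ J, n j' * ψ (j - j'))]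
    refine sum_congr rfl fun j _ => ?_
    rw [mul_sum]
    exact sum_congr rfl fun j' _ => by ring
  have h2 : ∑ d ∈ D, ∑ d' ∈ D, (if c d = c d' then (1 : ℝ) else 0) = ∑ j ∈ J, n j * n j := by
    rw [← hself n]
    refine sum_congr rfl fun d _ => ?_
    simp only [hn, eq_comm]
  have hψ0 : ∀ k, 0 ≤ ψ k := fun k => by simp only [hψ]; positivity
  have hψs : ∀ j j', ψ (j - j') = ψ (j' - j) := fun j j' => by
    simp only [hψ]; push_cast; rw [← neg_sub, neg_sq]
  have hrow : ∀ j, ∑ j' ∈ J, ψ (j - j') ≤ ∑' k, ψ k := by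
    intro j
    have hs : Summable fun j' => ψ (j - j') :=
      ((Equiv.subLeft j).summable_iff (f := ψ)).2 summable_one_div_one_add_sq
    refine (hs.sum_le_tsum J fun j' _ => hψ0 _).trans (le_of_eq ?_)
    exact (Equiv.subLeft j).tsum_eq ψ
  rw [h1, h2]
  calc ∑ j ∈ J, ∑ j' ∈ J, n j * n j' * ψ (j - j')
      ≤ ∑ j ∈ J, ∑ j' ∈ J, (n j * n j * ψ (j - j') / 2 + n j' * n j' * ψ (j - j') / 2) := by
        refine sum_le_sum fun j _ => sum_le_sum fun j' _ => ?_
        have := mul_nonneg (hψ0 (j - j')) (sq_nonneg (n j - n j'))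
        nlinarith
    _ = ∑ j ∈ J, n j * n j * ∑ j' ∈ J, ψ (j - j') := by
        have e : ∑ j ∈ J, ∑ j' ∈ J, n j' * n j' * ψ (j - j') / 2 =
            ∑ j ∈ J, ∑ j' ∈ J, n j * n j * ψ (j - j') / 2 := by
          rw [sum_comm]
          exact sum_congr rfl fun j _ => sum_congr rfl fun j' _ => by rw [hψs]
        simp only [sum_add_distrib, e, mul_sum]
        rw [← sum_add_distrib]
        refine sum_congr rfl fun j _ => ?_
        rw [← sum_add_distrib]
        exact sum_congr rfl fun j' _ => by ring
    _ ≤ ∑ j ∈ J, n j * n j * ∑' k, ψ k :=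
        sum_le_sum fun j _ => mul_le_mul_of_nonneg_left (hrow j) (mul_self_nonneg _)
    _ = _ := by rw [← sum_mul, mul_comm]

/-- No such bound holds pointwise, since `tri` has compact support. After rounding, the tail of the
kernel is controlled by the pairs in a common cell, and those are seen by `tri`. -/
lemma exists_sum_fejer_le_sum_tri : ∃ C : ℝ, 0 < C ∧ ∀ (D : Finset ℕ) (f : ℕ → ℝ),
    ∑ d ∈ D, ∑ d' ∈ D, fejer (f d - f d') ≤ C * ∑ d ∈ D, ∑ d' ∈ D, tri (f d - f d') := by
  have hΨ : 0 < ∑' k : ℤ, 1 / (1 + (k : ℝ) ^ 2) :=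
    summable_one_div_one_add_sq.tsum_pos (fun k => by positivity) 0 (by norm_num)
  set Ψ := ∑' k : ℤ, 1 / (1 + (k : ℝ) ^ 2)
  refine ⟨64 * (Ψ * 2), by positivity, fun D f => ?_⟩
  -- Cells of length `1/2`: two points of one cell are closer than `1/2`, so `tri` is at least `1/2`
  -- there.
  set c : ℕ → ℤ := fun d => ⌊2 * f d⌋ with hc
  have hdiff : ∀ d d', |((c d - c d' : ℤ) : ℝ) - 2 * (f d - f d')| < 1 := by
    intro d d'
    have h1 := Int.floor_le (2 * f d)
    have h2 := Int.lt_floor_add_one (2 * f d)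
    have h3 := Int.floor_le (2 * f d')
    have h4 := Int.lt_floor_add_one (2 * f d')
    push_cast
    rw [abs_lt]
    constructor <;> simp only [hc] <;> linarith
  have h1 : ∀ d d', fejer (f d - f d') ≤ 64 * (1 / (1 + ((c d - c d' : ℤ) : ℝ) ^ 2)) := by
    intro d d'
    refine (fejer_le _).trans ?_
    have h := abs_lt.1 (hdiff d d')
    generalize ((c d - c d' : ℤ) : ℝ) = k at h
    generalize f d - f d' = v at h
    rw [mul_one_div, div_le_div_iff₀ (by positivity) (by positivity)]
    have : k ^ 2 ≤ 8 * v ^ 2 + 2 := by nlinarith [sq_nonneg (k - 4 * v), h.1, h.2]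
    linarith [sq_nonneg v]
  have h2 : ∀ d d', (if c d = c d' then (1 : ℝ) else 0) ≤ 2 * tri (f d - f d') := by
    intro d d'
    have hb := hdiff d d'
    split_ifs with h
    · rw [h, sub_self, Int.cast_zero, zero_sub, abs_neg, abs_mul, abs_two] at hb
      have : 1 - |f d - f d'| ≤ tri (f d - f d') := le_max_right _ _
      linarith
    · have := tri_nonneg (f d - f d'); linarith
  calc ∑ d ∈ D, ∑ d' ∈ D, fejer (f d - f d')
      ≤ ∑ d ∈ D, ∑ d' ∈ D, 64 * (1 / (1 + ((c d - c d' : ℤ) : ℝ) ^ 2)) :=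
        sum_le_sum fun d _ => sum_le_sum fun d' _ => h1 d d'
    _ = 64 * ∑ d ∈ D, ∑ d' ∈ D, 1 / (1 + ((c d - c d' : ℤ) : ℝ) ^ 2) := by simp only [mul_sum]
    _ ≤ 64 * (Ψ * ∑ d ∈ D, ∑ d' ∈ D, if c d = c d' then 1 else 0) := by
        gcongr; exact sum_sum_int_le D c
    _ ≤ 64 * (Ψ * ∑ d ∈ D, ∑ d' ∈ D, 2 * tri (f d - f d')) := by
        gcongr with d _ d' _; exact h2 d d'
    _ = _ := by simp only [← mul_sum]; ring

end

end DeltaMoments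

/-! ### `M_2/τ` as an integral of a product of cosines. -/

namespace DeltaMoments

noncomputable section

open Finset MeasureTheory

/-- The product `∏_{p ∈ S} (1 + cos (θ log p))`. -/
def cosProd (S : Finset ℕ) (th : ℝ) : ℝ :=
  ∏ p ∈ S, (1 + Real.cos (th * Real.log p))

lemma one_add_cos_nonneg (x : ℝ) : 0 ≤ 1 + Real.cos x := by
  linarith [Real.neg_one_le_cos x]

lemma cosProd_nonneg (S : Finset ℕ) (th : ℝ) : 0 ≤ cosProd S th :=
  prod_nonneg fun _ _ => one_add_cos_nonneg _

lemma continuous_cosProd (S : Finset ℕ) : Continuous (cosProd S) := by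
  unfold cosProd; fun_prop

lemma tau_prod_primes {S : Finset ℕ} (hS : ∀ p ∈ S, p.Prime) : tau (∏ p ∈ S, p) = 2 ^ #S := by
  rw [tau, card_eq_sum_ones, sum_divisors_prod_primes hS, ← card_eq_sum_ones, card_powerset]

/-- The double sum is `|∑_{d ∣ n} d^{iθ}|^2 = ∏ |1 + p^{iθ}|^2`, and `|1 + e^{iφ}|^2 = 2(1 + cos
φ)`. -/
lemma sum_sum_cos {S : Finset ℕ} (hS : ∀ p ∈ S, p.Prime) (th : ℝ) :
    ∑ d ∈ (∏ p ∈ S, p).divisors, ∑ d' ∈ (∏ p ∈ S, p).divisors,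
      Real.cos (th * (Real.log d - Real.log d')) = 2 ^ #S * cosProd S th := by
  set D := (∏ p ∈ S, p).divisors with hD
  set E : ℕ → ℂ := fun d => Complex.exp ((th * Real.log d : ℝ) * Complex.I) with hE
  have h1 : ∑ d ∈ D, E d = ∏ p ∈ S, (1 + E p) := by
    rw [hD, sum_divisors_prod_primes hS, prod_one_add]
    refine sum_congr rfl fun T hT => ?_
    rw [mem_powerset] at hT
    simp only [hE]
    rw [← Complex.exp_sum, ← sum_mul]
    rw [Nat.cast_prod, Real.log_prod fun p hp => Nat.cast_ne_zero.2 (hS p (hT hp)).ne_zero,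
      mul_sum, Complex.ofReal_sum]
  have h2 : ∑ d ∈ D, ∑ d' ∈ D, Real.cos (th * (Real.log d - Real.log d')) =
      Complex.normSq (∑ d ∈ D, E d) := by
    have hre : ∀ d, (E d).re = Real.cos (th * Real.log d) := fun d =>
      Complex.exp_ofReal_mul_I_re _
    have him : ∀ d, (E d).im = Real.sin (th * Real.log d) := fun d =>
      Complex.exp_ofReal_mul_I_im _
    rw [Complex.normSq_apply, Complex.re_sum, Complex.im_sum, sum_mul_sum, sum_mul_sum,
      ← sum_add_distrib]
    refine sum_congr rfl fun d _ => ?_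
    rw [← sum_add_distrib]
    refine sum_congr rfl fun d' _ => ?_
    rw [hre, hre, him, him, mul_sub, Real.cos_sub]
  rw [h2, h1, map_prod, cosProd, ← prod_const, ← prod_mul_distrib]
  refine prod_congr rfl fun p _ => ?_
  simp only [hE]
  rw [Complex.normSq_apply, Complex.add_re, Complex.add_im, Complex.exp_ofReal_mul_I_re,
    Complex.exp_ofReal_mul_I_im, Complex.one_re, Complex.one_im]
  linear_combination Real.sin_sq_add_cos_sq (th * Real.log p)

lemma sum_sum_fejer {S : Finset ℕ} (hS : ∀ p ∈ S, p.Prime) :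
    ∑ d ∈ (∏ p ∈ S, p).divisors, ∑ d' ∈ (∏ p ∈ S, p).divisors,
      fejer (Real.log d - Real.log d') =
      2 ^ #S * ∫ th in (0 : ℝ)..1, (1 - th) * cosProd S th := by
  unfold fejer
  rw [← intervalIntegral.integral_const_mul]
  have hi : ∀ v : ℝ, IntervalIntegrable (fun th => (1 - th) * Real.cos (th * v)) volume 0 1 :=
    fun v => by apply Continuous.intervalIntegrable; fun_prop
  have h1 : ∀ d : ℕ, ∑ d' ∈ (∏ p ∈ S, p).divisors, ∫ th in (0 : ℝ)..1,
      (1 - th) * Real.cos (th * (Real.log d - Real.log d')) = ∫ th in (0 : ℝ)..1,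
      ∑ d' ∈ (∏ p ∈ S, p).divisors, (1 - th) * Real.cos (th * (Real.log d - Real.log d')) :=
    fun d => (intervalIntegral.integral_finsetSum fun d' _ => hi _).symm
  rw [sum_congr rfl fun d _ => h1 d, ← intervalIntegral.integral_finsetSum]
  · refine intervalIntegral.integral_congr fun th _ => ?_
    simp only [← mul_sum]
    rw [sum_sum_cos hS]
    ring
  · intro d _
    apply Continuous.intervalIntegrable; fun_prop

lemma M_two_div_tau_le {S : Finset ℕ} (hS : ∀ p ∈ S, p.Prime) :
    M 2 (∏ p ∈ S, p) / tau (∏ p ∈ S, p) ≤ 5 / 2 * ∫ th in (0 : ℝ)..1, cosProd S th := by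
  have h2 : (0 : ℝ) < 2 ^ #S := by positivity
  rw [tau_prod_primes hS, Nat.cast_pow, Nat.cast_ofNat, div_le_iff₀ h2, M_two_eq]
  have h1 : ∫ th in (0 : ℝ)..1, (1 - th) * cosProd S th ≤ ∫ th in (0 : ℝ)..1, cosProd S th := by
    refine intervalIntegral.integral_mono_on zero_le_one ?_ ?_ fun th hth => ?_
    · exact ((continuous_const.sub continuous_id).mul (continuous_cosProd S)).intervalIntegrable _ _
    · exact (continuous_cosProd S).intervalIntegrable _ _
    · exact mul_le_of_le_one_left (cosProd_nonneg S th) (by linarith [hth.1])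
  calc _ ≤ ∑ d ∈ (∏ p ∈ S, p).divisors, ∑ d' ∈ (∏ p ∈ S, p).divisors,
        5 / 2 * fejer (Real.log d - Real.log d') :=
        sum_le_sum fun d _ => sum_le_sum fun d' _ => tri_le_fejer _
    _ = 5 / 2 * (2 ^ #S * ∫ th in (0 : ℝ)..1, (1 - th) * cosProd S th) := by
        rw [← sum_sum_fejer hS]; simp only [mul_sum]
    _ ≤ 5 / 2 * (2 ^ #S * ∫ th in (0 : ℝ)..1, cosProd S th) := by gcongr
    _ = _ := by ring

lemma exists_le_M_two_div_tau : ∃ c : ℝ, 0 < c ∧ ∀ S : Finset ℕ, (∀ p ∈ S, p.Prime) →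
    c * (∫ th in (0 : ℝ)..1, (1 - th) * cosProd S th) ≤
      M 2 (∏ p ∈ S, p) / tau (∏ p ∈ S, p) := by
  obtain ⟨C, hC, h⟩ := exists_sum_fejer_le_sum_tri
  refine ⟨C⁻¹, inv_pos.2 hC, fun S hS => ?_⟩
  have h2 : (0 : ℝ) < 2 ^ #S := by positivity
  have h1 := h (∏ p ∈ S, p).divisors (fun d => Real.log d)
  rw [sum_sum_fejer hS, ← M_two_eq] at h1
  rw [tau_prod_primes hS, Nat.cast_pow, Nat.cast_ofNat, le_div_iff₀ h2, inv_mul_eq_div,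
    div_mul_eq_mul_div, div_le_iff₀ hC]
  linarith

/-- On `[0, 1/2]` the weight `1 - θ` is at least `1/2`, so it can be dropped. -/
lemma exists_setIntegral_le_M_two_div_tau : ∃ c : ℝ, 0 < c ∧ ∀ S : Finset ℕ,
    (∀ p ∈ S, p.Prime) → ∀ A : Set ℝ, MeasurableSet A → A ⊆ Set.Icc 0 (1 / 2) →
    c * (∫ th in A, cosProd S th) ≤ M 2 (∏ p ∈ S, p) / tau (∏ p ∈ S, p) := by
  obtain ⟨c, hc, h⟩ := exists_le_M_two_div_tau
  refine ⟨c / 2, by positivity, fun S hS A hA hA2 => le_trans ?_ (h S hS)⟩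
  have hcont : Continuous fun th => (1 - th) * cosProd S th :=
    (continuous_const.sub continuous_id).mul (continuous_cosProd S)
  rw [div_mul_eq_mul_div, mul_div_assoc]
  gcongr
  rw [div_eq_inv_mul, ← integral_const_mul, intervalIntegral.integral_of_le zero_le_one,
    ← integral_Icc_eq_integral_Ioc]
  have hA1 : A ⊆ Set.Icc 0 1 := hA2.trans (Set.Icc_subset_Icc_right (by norm_num))
  have hi1 := (hcont.integrableOn_Icc (μ := volume) (a := 0) (b := 1))
  calc ∫ th in A, 2⁻¹ * cosProd S th ≤ ∫ th in A, (1 - th) * cosProd S th := by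
        refine setIntegral_mono_on ?_ (hi1.mono_set hA1) hA fun th hth => ?_
        · exact ((continuous_const.mul (continuous_cosProd S)).integrableOn_Icc
            (a := 0) (b := 1)).mono_set hA1
        · have := (hA2 hth).2
          exact mul_le_mul_of_nonneg_right (by linarith) (cosProd_nonneg S th)
    _ ≤ _ := by
        refine setIntegral_mono_set hi1 ?_ (Filter.Eventually.of_forall hA1)
        filter_upwards [ae_restrict_mem measurableSet_Icc] with th hth
        exact mul_nonneg (by linarith [hth.2]) (cosProd_nonneg S th)

/-- For such `θ` all phases `θ log d` lie in `[0, 1]`, so each of the `4^{#S}` cosines in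
`sum_sum_cos` is at least `1/2`. -/
lemma half_two_pow_le_cosProd {S : Finset ℕ} (hS : ∀ p ∈ S, p.Prime) {th : ℝ} (h0 : 0 ≤ th)
    (h1 : th * Real.log (∏ p ∈ S, p : ℕ) ≤ 1) : 2 ^ #S / 2 ≤ cosProd S th := by
  have h2 : (0 : ℝ) < 2 ^ #S := by positivity
  have hcard : (((∏ p ∈ S, p).divisors.card : ℕ) : ℝ) = 2 ^ #S := by
    have := tau_prod_primes hS
    rw [tau] at this
    rw [this]; push_cast; rfl
  have hlog : ∀ d ∈ (∏ p ∈ S, p).divisors, 0 ≤ th * Real.log d ∧ th * Real.log d ≤ 1 := by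
    intro d hd
    have hd0 : (1 : ℝ) ≤ d := by exact_mod_cast Nat.pos_of_mem_divisors hd
    have hle : (d : ℝ) ≤ (∏ p ∈ S, p : ℕ) := by exact_mod_cast Nat.divisor_le hd
    exact ⟨mul_nonneg h0 (Real.log_nonneg hd0),
      (mul_le_mul_of_nonneg_left (Real.log_le_log (by linarith) hle) h0).trans h1⟩
  have h3 : (2 : ℝ) ^ #S * (2 ^ #S * (1 / 2)) ≤ 2 ^ #S * cosProd S th := by
    rw [← sum_sum_cos hS, ← hcard, ← nsmul_eq_mul, ← nsmul_eq_mul, ← sum_const, ← sum_const]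
    refine sum_le_sum fun d hd => sum_le_sum fun d' hd' => ?_
    obtain ⟨a1, a2⟩ := hlog d hd
    obtain ⟨b1, b2⟩ := hlog d' hd'
    have := Real.one_sub_sq_div_two_le_cos (x := th * (Real.log d - Real.log d'))
    rw [mul_sub] at this ⊢
    nlinarith
  have := le_of_mul_le_mul_left h3 h2
  linarith

/-- Only `θ ≤ 1/(2(1 + log n))` is kept, where `cosProd` is of maximal order `2^{#S}`. -/
lemma exists_two_pow_div_log_le_M_two_div_tau : ∃ c : ℝ, 0 < c ∧ ∀ S : Finset ℕ,
    (∀ p ∈ S, p.Prime) → c * (2 ^ #S / (1 + Real.log (∏ p ∈ S, p : ℕ))) ≤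
      M 2 (∏ p ∈ S, p) / tau (∏ p ∈ S, p) := by
  obtain ⟨c, hc, h⟩ := exists_setIntegral_le_M_two_div_tau
  refine ⟨c / 4, by positivity, fun S hS => ?_⟩
  set L := Real.log (∏ p ∈ S, p : ℕ) with hL
  have hL0 : 0 ≤ L := Real.log_natCast_nonneg _
  have hw : (2 * (1 + L))⁻¹ ≤ 1 / 2 := by
    rw [one_div]; exact inv_anti₀ two_pos (by linarith)
  refine le_trans ?_ (h S hS (Set.Icc 0 (2 * (1 + L))⁻¹) measurableSet_Icc
    (Set.Icc_subset_Icc_right hw))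
  rw [div_mul_eq_mul_div, mul_div_assoc]
  gcongr
  have hw0 : 0 ≤ (2 * (1 + L))⁻¹ := by positivity
  calc 2 ^ #S / (1 + L) / 4 = ∫ _ in Set.Icc 0 (2 * (1 + L))⁻¹, (2 : ℝ) ^ #S / 2 := by
        rw [setIntegral_const, Real.volume_real_Icc_of_le hw0, smul_eq_mul]
        field_simp
        ring
    _ ≤ _ := by
        refine setIntegral_mono_on (integrableOn_const measure_Icc_lt_top.ne)
          (continuous_cosProd S).integrableOn_Icc measurableSet_Icc fun th hth => ?_
        refine half_two_pow_le_cosProd hS hth.1 ?_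
        calc th * L ≤ (2 * (1 + L))⁻¹ * L := mul_le_mul_of_nonneg_right hth.2 hL0
          _ ≤ 1 := by rw [inv_mul_le_one₀ (by positivity)]; linarith

end

end DeltaMoments

/-! ### Euler products and doubly exponential scales. -/

namespace DeltaMoments

noncomputable section

open Finset

lemma exp_sub_sq_le_one_add {v : ℝ} (hv : 0 ≤ v) : Real.exp (v - v ^ 2) ≤ 1 + v := by
  have h1 : 0 < 1 + v := by linarith
  have h2 : v - v ^ 2 ≤ v / (1 + v) := by
    rw [le_div_iff₀ h1]; nlinarith [pow_nonneg hv 3]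
  have h3 := Real.add_one_le_exp (-(v / (1 + v)))
  have h4 : -(v / (1 + v)) + 1 = (1 + v)⁻¹ := by field_simp; ring
  rw [h4, Real.exp_neg] at h3
  exact (Real.exp_le_exp.2 h2).trans ((inv_le_inv₀ h1 (Real.exp_pos _)).1 h3)

/-- The Euler factor is compared with `exp(v(h - 1))`; the quadratic loss is harmless because `∑
v_p^2` converges. -/
lemma prod_one_add_le_exp {ι : Type*} {P : Finset ι} {v h : ι → ℝ} (hv : ∀ p ∈ P, 0 ≤ v p)
    (hh : ∀ p ∈ P, 0 ≤ h p) :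
    (∏ p ∈ P, (1 + v p * h p)) / ∏ p ∈ P, (1 + v p) ≤
      Real.exp (∑ p ∈ P, v p * h p - ∑ p ∈ P, v p + ∑ p ∈ P, v p ^ 2) := by
  rw [← prod_div_distrib, ← sum_sub_distrib, ← sum_add_distrib, Real.exp_sum]
  refine prod_le_prod (fun p hp => ?_) fun p hp => ?_
  · have := hv p hp; have := hh p hp; positivity
  · have h1 := hv p hp
    have h2 := hh p hp
    have h3 := exp_sub_sq_le_one_add h1
    rw [div_le_iff₀ (by linarith)]
    calc 1 + v p * h p ≤ Real.exp (v p * h p) := by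
          rw [add_comm]; exact Real.add_one_le_exp _
      _ = Real.exp (v p * h p - v p + v p ^ 2) * Real.exp (v p - v p ^ 2) := by
          rw [← Real.exp_add]; congr 1; ring
      _ ≤ _ := by gcongr

lemma exp_le_prod_one_add {ι : Type*} {P : Finset ι} {v h : ι → ℝ} {G : ℝ}
    (hv : ∀ p ∈ P, 0 ≤ v p) (hh : ∀ p ∈ P, 0 ≤ h p) (hG : ∀ p ∈ P, h p ≤ G) :
    Real.exp (∑ p ∈ P, v p * h p - ∑ p ∈ P, v p - G ^ 2 * ∑ p ∈ P, v p ^ 2) ≤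
      (∏ p ∈ P, (1 + v p * h p)) / ∏ p ∈ P, (1 + v p) := by
  rw [← prod_div_distrib, ← sum_sub_distrib, mul_sum, ← sum_sub_distrib, Real.exp_sum]
  refine prod_le_prod (fun p hp => (Real.exp_pos _).le) fun p hp => ?_
  have h1 := hv p hp
  have h2 := hh p hp
  have h3 := exp_sub_sq_le_one_add (mul_nonneg h1 h2)
  rw [le_div_iff₀ (by linarith)]
  have h4 : (v p * h p) ^ 2 ≤ G ^ 2 * v p ^ 2 := by
    rw [mul_pow, mul_comm]
    have := hG p hp
    gcongr
  calc Real.exp (v p * h p - v p - G ^ 2 * v p ^ 2) * (1 + v p)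
      ≤ Real.exp (v p * h p - v p - G ^ 2 * v p ^ 2) * Real.exp (v p) := by
        gcongr; rw [add_comm]; exact Real.add_one_le_exp _
    _ = Real.exp (v p * h p - G ^ 2 * v p ^ 2) := by
        rw [← Real.exp_add]; congr 1; ring
    _ ≤ Real.exp (v p * h p - (v p * h p) ^ 2) := by gcongr
    _ ≤ _ := h3

/-- The weight `ρ(p) / p`. -/
def primeWeight (ρ : ArithmeticFunction ℝ) (p : ℕ) : ℝ := ρ p / p

lemma IsClassM.primeWeight_nonneg {z : ℝ} {ρ : ArithmeticFunction ℝ} (hρ : IsClassM z ρ) (p : ℕ) :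
    0 ≤ primeWeight ρ p := div_nonneg (hρ.nonneg p) (Nat.cast_nonneg p)

lemma IsClassM.exists_sum_sq_le {z : ℝ} {ρ : ArithmeticFunction ℝ} (hρ : IsClassM z ρ) :
    ∃ C : ℝ, 0 < C ∧ ∀ P : Finset ℕ, (∀ p ∈ P, p.Prime) → ∑ p ∈ P, primeWeight ρ p ^ 2 ≤ C := by
  obtain ⟨B, hB0, hB⟩ := hρ.exists_prime_bound
  have hs : Summable fun n : ℕ => 1 / (n : ℝ) ^ 2 := Real.summable_one_div_nat_pow.2 one_lt_two
  have hpos : 0 < ∑' n : ℕ, 1 / (n : ℝ) ^ 2 :=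
    hs.tsum_pos (fun n => by positivity) 1 (by norm_num)
  refine ⟨B ^ 2 * ∑' n : ℕ, 1 / (n : ℝ) ^ 2, by positivity, fun P hP => ?_⟩
  refine le_trans ?_ (mul_le_mul_of_nonneg_left
    (hs.sum_le_tsum P fun n _ => by positivity) (sq_nonneg B))
  rw [mul_sum]
  refine sum_le_sum fun p hp => ?_
  have h0 := hρ.nonneg p
  have h1 := hB p (hP p hp)
  rw [primeWeight, div_pow, mul_one_div]
  gcongr

lemma prime_of_mem_sdiff {a b : ℝ} {p : ℕ} (hp : p ∈ primesLT b \ primesLT a) : p.Prime :=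
  (mem_primesLT.1 (mem_sdiff.1 hp).1).2

lemma sum_primesLT_sdiff {a b : ℝ} (hab : a ≤ b) (f : ℕ → ℝ) :
    ∑ p ∈ primesLT b \ primesLT a, f p = ∑ p ∈ primesLT b, f p - ∑ p ∈ primesLT a, f p := by
  rw [← sum_sdiff (primesLT_mono hab)]; ring

lemma IsClassM.exists_abs_sum_sub_le {z : ℝ} {ρ : ArithmeticFunction ℝ} (hρ : IsClassM z ρ) :
    ∃ C : ℝ, 0 < C ∧ ∀ a b : ℝ, 2 ≤ a → a ≤ b →
      |∑ p ∈ primesLT b \ primesLT a, primeWeight ρ p -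
        z * (Real.log (Real.log b) - Real.log (Real.log a))| ≤ C := by
  obtain ⟨C, hC⟩ := exists_abs_sum_cos_le hρ 0
  have hC' : ∀ y : ℝ, 2 ≤ y → |∑ p ∈ primesLT y, primeWeight ρ p - z * Real.log (Real.log y)| ≤
      C := by
    intro y hy
    have h := hC 0 y (by simp) hy
    have hl : 0 < Real.log y := Real.log_pos (by linarith)
    simp only [zero_mul, Real.cos_zero, mul_one, abs_zero] at h
    rw [max_eq_left (inv_pos.2 hl).le, Real.log_inv] at h
    simpa [primeWeight, mul_neg, ← sub_eq_add_neg] using h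
  refine ⟨2 * C + 1, ?_, fun a b ha hab => ?_⟩
  · have := (abs_nonneg _).trans (hC' 2 le_rfl); linarith
  · have h1 := abs_le.1 (hC' a ha)
    have h2 := abs_le.1 (hC' b (ha.trans hab))
    rw [sum_primesLT_sdiff hab, abs_le]
    constructor <;> linarith [h1.1, h1.2, h2.1, h2.2]

/-- The doubly exponential scale `exp (B ^ k)`. -/
def scale (B : ℝ) (k : ℕ) : ℝ := Real.exp (B ^ k)

lemma log_scale (B : ℝ) (k : ℕ) : Real.log (scale B k) = B ^ k := Real.log_exp _

lemma two_le_scale {B : ℝ} (hB : 1 ≤ B) (k : ℕ) : 2 ≤ scale B k := by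
  have h1 : (1 : ℝ) ≤ B ^ k := one_le_pow₀ hB
  have := Real.add_one_le_exp (B ^ k)
  unfold scale
  linarith

lemma scale_mono {B : ℝ} (hB : 1 ≤ B) {a b : ℕ} (hab : a ≤ b) : scale B a ≤ scale B b :=
  Real.exp_le_exp.2 (pow_le_pow_right₀ hB hab)

/-- The primes in `[exp (B ^ a), exp (B ^ b))`. -/
def primeBlock (B : ℝ) (a b : ℕ) : Finset ℕ := primesLT (scale B b) \ primesLT (scale B a)

lemma IsClassM.exists_abs_sum_block_le {z : ℝ} {ρ : ArithmeticFunction ℝ} (hρ : IsClassM z ρ) :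
    ∃ C : ℝ, 0 < C ∧ ∀ (B : ℝ) (a b : ℕ), 1 < B → a ≤ b →
      |∑ p ∈ primeBlock B a b, primeWeight ρ p - z * (Real.log B * (b - a))| ≤ C := by
  obtain ⟨C, hC0, hC⟩ := hρ.exists_abs_sum_sub_le
  refine ⟨C, hC0, fun B a b hB hab => ?_⟩
  have h := hC _ _ (two_le_scale hB.le a) (scale_mono hB.le hab)
  rw [log_scale, log_scale, Real.log_pow, Real.log_pow] at h
  rw [show Real.log B * ((b : ℝ) - a) = b * Real.log B - a * Real.log B by ring]
  exact h

/-- The asymptotics for the two endpoints are subtracted. Scale by scale, `log max(B^{-i}, |λ|)`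
drops by at most `log B` when `|λ| ≤ B^{-i}`, and is constant afterwards. -/
lemma exists_sum_block_cos_le {z : ℝ} (hz : 0 < z) {ρ : ArithmeticFunction ℝ} (hρ : IsClassM z ρ)
    (Lam : ℝ) : ∃ C : ℝ, 0 ≤ C ∧ ∀ (B : ℝ) (a b : ℕ) (lam : ℝ), 1 < B → a ≤ b → |lam| ≤ Lam →
      ∑ p ∈ primeBlock B a b, primeWeight ρ p * Real.cos (lam * Real.log p) ≤
        z * Real.log B * (∑ i ∈ Ico a b, if |lam| ≤ (B ^ i)⁻¹ then 1 else 0) + C := by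
  obtain ⟨C, hC⟩ := exists_abs_sum_cos_le hρ Lam
  refine ⟨2 * |C|, by positivity, fun B a b lam hB hab hlam => ?_⟩
  have hB0 : 0 < B := by linarith
  have hlogB := Real.log_pos hB
  have htel : Real.log (max (B ^ a)⁻¹ |lam|) - Real.log (max (B ^ b)⁻¹ |lam|) ≤
      Real.log B * ∑ i ∈ Ico a b, if |lam| ≤ (B ^ i)⁻¹ then (1 : ℝ) else 0 := by
    induction b, hab using Nat.le_induction with
    | base => simp
    | succ b hab ih =>
      have hstep : Real.log (max (B ^ b)⁻¹ |lam|) - Real.log (max (B ^ (b + 1))⁻¹ |lam|) ≤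
          Real.log B * if |lam| ≤ (B ^ b)⁻¹ then (1 : ℝ) else 0 := by
        have hlt : (B ^ (b + 1))⁻¹ ≤ (B ^ b)⁻¹ :=
          inv_anti₀ (by positivity) (pow_le_pow_right₀ hB.le (Nat.le_succ b))
        split_ifs with h
        · rw [max_eq_left h]
          have : Real.log (B ^ (b + 1))⁻¹ ≤ Real.log (max (B ^ (b + 1))⁻¹ |lam|) :=
            Real.log_le_log (by positivity) (le_max_left _ _)
          rw [Real.log_inv, Real.log_pow] at *
          push_cast at this
          linarith
        · push Not at h
          rw [max_eq_right h.le, max_eq_right (hlt.trans h.le)]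
          simp
      rw [sum_Ico_succ_top hab, mul_add]
      linarith
  have h1 := abs_le.1 (hC lam _ hlam (two_le_scale hB.le a))
  have h2 := abs_le.1 (hC lam _ hlam (two_le_scale hB.le b))
  rw [log_scale] at h1 h2
  have hCabs := le_abs_self C
  unfold primeBlock
  rw [sum_primesLT_sdiff (scale_mono hB.le hab)]
  simp only [primeWeight]
  have := mul_le_mul_of_nonneg_left htel hz.le
  rw [← mul_assoc] at this
  nlinarith [h1.1, h1.2, h2.1, h2.2]

/-- The function `∏_j (1 + cos (θ_j log p))` of a prime `p`. -/
def cosFactor {N : ℕ} (th : Fin N → ℝ) (p : ℕ) : ℝ := ∏ j, (1 + Real.cos (th j * Real.log p))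

lemma cosFactor_nonneg {N : ℕ} (th : Fin N → ℝ) (p : ℕ) : 0 ≤ cosFactor th p :=
  prod_nonneg fun _ _ => one_add_cos_nonneg _

lemma cosFactor_le {N : ℕ} (th : Fin N → ℝ) (p : ℕ) : cosFactor th p ≤ 2 ^ N := by
  refine (prod_le_prod (fun _ _ => one_add_cos_nonneg _) (g := fun _ => 2) fun j _ => ?_).trans ?_
  · linarith [Real.cos_le_one (th j * Real.log p)]
  · simp

lemma prod_cosProd {N : ℕ} (th : Fin N → ℝ) (S : Finset ℕ) :
    ∏ j, cosProd S (th j) = ∏ p ∈ S, cosFactor th p := by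
  unfold cosProd cosFactor
  exact prod_comm

lemma abs_signDot_le {N : ℕ} (e : Fin N → SignType) {th : Fin N → ℝ} (hth : th ∈ Set.Icc 0 1) :
    |signDot e th| ≤ N := by
  unfold signDot
  refine (abs_sum_le_sum_abs _ _).trans ?_
  refine (sum_le_card_nsmul univ _ 1 fun j _ => ?_).trans (by simp)
  have h1 : 0 ≤ th j := hth.1 j
  have h2 : th j ≤ 1 := hth.2 j
  rw [abs_mul, abs_of_nonneg h1]
  cases e j <;> simp [h2]

/-- The weighted sum of `cosFactor θ` over a block of primes is governed by the ranks of `θ`. -/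
theorem exists_sum_block_cosFactor_le {z : ℝ} (hz : 0 < z) {ρ : ArithmeticFunction ℝ}
    (hρ : IsClassM z ρ) (N : ℕ) : ∃ C : ℝ, 0 ≤ C ∧ ∀ (B : ℝ) (a b : ℕ) (th : Fin N → ℝ),
      1 < B → a ≤ b → th ∈ Set.Icc 0 1 →
      ∑ p ∈ primeBlock B a b, primeWeight ρ p * cosFactor th p ≤
        z * Real.log B * (∑ i ∈ Ico a b, (2 : ℝ) ^ lowRank th (B ^ i)⁻¹) + C := by
  classical
  obtain ⟨C, hC0, hC⟩ := exists_sum_block_cos_le hz hρ N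
  refine ⟨2 ^ N * C, by positivity, fun B a b th hB hab hth => ?_⟩
  have hzB : 0 ≤ z * Real.log B := mul_nonneg hz.le (Real.log_pos hB).le
  calc ∑ p ∈ primeBlock B a b, primeWeight ρ p * cosFactor th p
      = ∑ e : Fin N → SignType, signWeight e *
          ∑ p ∈ primeBlock B a b, primeWeight ρ p * Real.cos (signDot e th * Real.log p) := by
        simp only [cosFactor, prod_one_add_cos, mul_sum]
        rw [sum_comm]
        exact sum_congr rfl fun e _ => sum_congr rfl fun p _ => by ring
    _ ≤ ∑ e : Fin N → SignType, signWeight e *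
          (z * Real.log B * (∑ i ∈ Ico a b, if |signDot e th| ≤ (B ^ i)⁻¹ then 1 else 0) + C) := by
        gcongr with e _
        · exact signWeight_nonneg e
        · exact hC B a b _ hB hab (abs_signDot_le e hth)
    _ = z * Real.log B * (∑ i ∈ Ico a b, ∑ e : Fin N → SignType with |signDot e th| ≤ (B ^ i)⁻¹,
          signWeight e) + 2 ^ N * C := by
        simp only [mul_add, sum_add_distrib]
        rw [← sum_mul, sum_signWeight]
        congr 1
        simp only [sum_filter, mul_sum]
        rw [sum_comm]
        refine sum_congr rfl fun i _ => sum_congr rfl fun e _ => ?_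
        split_ifs <;> ring
    _ ≤ _ := by
        gcongr with i _
        -- The sign vectors that still count at scale `i` lie in their own span, whose total weight
        -- is at most `2` to the rank.
        refine le_trans (sum_le_sum_of_subset_of_nonneg (fun e he => ?_)
          fun e _ _ => signWeight_nonneg e) (sum_signWeight_le (lowSpan th (B ^ i)⁻¹))
        rw [mem_filter] at he ⊢
        exact ⟨he.1, Submodule.subset_span ⟨e, he.2, rfl⟩⟩

end

end DeltaMoments

/-! ### Moments as integrals of Euler products. -/

namespace DeltaMoments

noncomputable section

open Finset MeasureTheory

lemma integral_pi_prod (N : ℕ) (f : ℝ → ℝ) (A : Set ℝ) :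
    ∫ th in Set.univ.pi (fun _ : Fin N => A), ∏ j, f (th j) = (∫ u in A, f u) ^ N := by
  have h : (volume : Measure (Fin N → ℝ)).restrict (Set.univ.pi fun _ => A) =
      Measure.pi fun _ => (volume : Measure ℝ).restrict A := Measure.restrict_pi_pi _ _
  rw [h, integral_fintype_prod_eq_prod (fun _ => f)]
  simp

/-- The expectation of a function of the set of prime factors, all in `P`. -/
def meanOn (ρ : ArithmeticFunction ℝ) (P : Finset ℕ) (F : Finset ℕ → ℝ) : ℝ :=
  subsetSum (primeWeight ρ) P F / ∏ p ∈ P, (1 + primeWeight ρ p)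

lemma expect_eq_meanOn {ρ : ArithmeticFunction ℝ} (hρ : ρ.IsMultiplicative) (x : ℝ) (g : ℕ → ℝ) :
    expect ρ x g = meanOn ρ (primesLT x) fun S => g (∏ p ∈ S, p) :=
  expect_eq ρ hρ x g

lemma prime_of_subset_primesLT {x : ℝ} {S : Finset ℕ} (hS : S ⊆ primesLT x) :
    ∀ p ∈ S, p.Prime := fun _ hp => (mem_primesLT.1 (hS hp)).2

lemma meanOn_mono {z : ℝ} {ρ : ArithmeticFunction ℝ} (hρ : IsClassM z ρ) {P : Finset ℕ}
    {F H : Finset ℕ → ℝ} (h : ∀ S ⊆ P, F S ≤ H S) : meanOn ρ P F ≤ meanOn ρ P H := by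
  have hv := hρ.primeWeight_nonneg
  unfold meanOn
  have : 0 ≤ ∏ p ∈ P, (1 + primeWeight ρ p) := prod_nonneg fun p _ => by linarith [hv p]
  gcongr
  exact subsetSum_mono (fun p _ => hv p) h

lemma meanOn_const_mul (ρ : ArithmeticFunction ℝ) (P : Finset ℕ) (c : ℝ) (F : Finset ℕ → ℝ) :
    meanOn ρ P (fun S => c * F S) = c * meanOn ρ P F := by
  rw [meanOn, subsetSum_const_mul, mul_div_assoc, meanOn]

lemma meanOn_integral (ρ : ArithmeticFunction ℝ) (P : Finset ℕ) {α : Type*} [MeasurableSpace α]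
    (μ : Measure α) (F : Finset ℕ → α → ℝ) (hF : ∀ S, Integrable (F S) μ) :
    meanOn ρ P (fun S => ∫ a, F S a ∂μ) = ∫ a, meanOn ρ P (fun S => F S a) ∂μ := by
  unfold meanOn subsetSum
  rw [integral_div, integral_finsetSum _ fun S _ => (hF S).const_mul _]
  simp only [integral_const_mul]

lemma continuous_meanOn (ρ : ArithmeticFunction ℝ) (P : Finset ℕ) {α : Type*} [TopologicalSpace α]
    (F : Finset ℕ → α → ℝ) (hF : ∀ S, Continuous (F S)) :
    Continuous fun a => meanOn ρ P fun S => F S a := by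
  unfold meanOn subsetSum
  exact (continuous_finsetSum _ fun S _ => continuous_const.mul (hF S)).div_const _

lemma continuous_prod_cosFactor {N : ℕ} (S : Finset ℕ) :
    Continuous fun th : Fin N → ℝ => ∏ p ∈ S, cosFactor th p := by
  unfold cosFactor; fun_prop

/-- Moments of `M_2 / τ`, restricted to a set of integers, are bounded by integrals of
expectations of products of cosines. -/
lemma expect_indicator_le {z : ℝ} {ρ : ArithmeticFunction ℝ} (hρ : IsClassM z ρ) (N : ℕ) (x : ℝ)
    (A : Set ℕ) :
    expect ρ x (A.indicator fun n => M 2 n ^ N / (tau n : ℝ) ^ N) ≤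
      (5 / 2) ^ N * ∫ th in Set.Icc (0 : Fin N → ℝ) 1, meanOn ρ (primesLT x) fun S =>
        A.indicator (fun _ => 1) (∏ p ∈ S, p) * ∏ p ∈ S, cosFactor th p := by
  rw [expect_eq_meanOn hρ.multiplicative, ← meanOn_integral, ← meanOn_const_mul]
  · refine meanOn_mono hρ fun S hS => ?_
    have hP := prime_of_subset_primesLT hS
    rw [integral_const_mul]
    by_cases hA : (∏ p ∈ S, p) ∈ A
    · rw [Set.indicator_of_mem hA, Set.indicator_of_mem hA, one_mul, ← div_pow]
      have h1 : ∫ th in Set.Icc (0 : Fin N → ℝ) 1, ∏ p ∈ S, cosFactor th p =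
          (∫ u in Set.Icc (0 : ℝ) 1, cosProd S u) ^ N := by
        rw [← integral_pi_prod, Set.pi_univ_Icc]
        refine integral_congr_ae (Filter.Eventually.of_forall fun th => ?_)
        exact (prod_cosProd th S).symm
      rw [h1, ← mul_pow, integral_Icc_eq_integral_Ioc,
          ← intervalIntegral.integral_of_le zero_le_one]
      refine pow_le_pow_left₀ ?_ (M_two_div_tau_le hP) N
      refine div_nonneg ?_ (Nat.cast_nonneg _)
      rw [M_two_eq]
      exact sum_nonneg fun d _ => sum_nonneg fun d' _ => tri_nonneg _
    · rw [Set.indicator_of_notMem hA, Set.indicator_of_notMem hA]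
      simp
  · intro S
    exact ((continuous_prod_cosFactor S).const_mul _).continuousOn.integrableOn_compact isCompact_Icc

lemma disjoint_sdiff_primesLT (a b : ℝ) : Disjoint (primesLT a) (primesLT b \ primesLT a) :=
  disjoint_sdiff

/-- The product over the primes in `[exp (B ^ k), x)`. -/
lemma exists_prod_tail_le {z : ℝ} (hz : 0 < z) {ρ : ArithmeticFunction ℝ} (hρ : IsClassM z ρ)
    (N : ℕ) {B : ℝ} (hB : 1 < B) : ∃ C : ℝ, 0 < C ∧ ∀ (k M : ℕ) (x : ℝ) (th : Fin N → ℝ),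
      k ≤ M → scale B M ≤ x → x ≤ scale B (M + 1) → th ∈ Set.Icc 0 1 →
      (∏ p ∈ primesLT x \ primesLT (scale B k), (1 + primeWeight ρ p * cosFactor th p)) /
        ∏ p ∈ primesLT x \ primesLT (scale B k), (1 + primeWeight ρ p) ≤
      C * Real.exp (z * Real.log B * ∑ i ∈ Ico k M, ((2 : ℝ) ^ lowRank th (B ^ i)⁻¹ - 1)) := by
  obtain ⟨C1, hC1, h1⟩ := exists_sum_block_cosFactor_le hz hρ N
  obtain ⟨C2, hC2, h2⟩ := hρ.exists_abs_sum_sub_le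
  obtain ⟨C3, hC3, h3⟩ := hρ.exists_sum_sq_le
  have hv := hρ.primeWeight_nonneg
  have hK := Real.log_pos hB
  refine ⟨Real.exp (C1 + 2 ^ N * (z * Real.log B + C2) + C2 + C3), Real.exp_pos _,
    fun k M x th hkM hMx hxM hth => ?_⟩
  have hMk := scale_mono hB.le hkM
  have h2M := two_le_scale hB.le M
  refine (prod_one_add_le_exp (fun p _ => hv p) fun p _ => cosFactor_nonneg th p).trans ?_
  rw [← Real.exp_add]
  refine Real.exp_le_exp.2 ?_
  have e1 := h1 B k M th hB hkM hth
  have e2 := (abs_le.1 (h2 _ x (two_le_scale hB.le k) (hMk.trans hMx))).1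
  have e3 := h3 (primesLT x \ primesLT (scale B k)) fun p hp => prime_of_mem_sdiff hp
  have e4 := (abs_le.1 (h2 _ x h2M hMx)).2
  have hloglog : Real.log B * M ≤ Real.log (Real.log x) ∧
      Real.log (Real.log x) ≤ Real.log B * (M + 1) := by
    have hx0 : 0 < x := by linarith
    have i1 := Real.log_le_log (by linarith) hMx
    have i2 := Real.log_le_log hx0 hxM
    rw [log_scale] at i1 i2
    have j1 := Real.log_le_log (by positivity) i1
    have j2 := Real.log_le_log (lt_of_lt_of_le (by positivity) i1) i2
    rw [Real.log_pow] at j1 j2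
    push_cast at j2
    constructor <;> linarith
  rw [log_scale, Real.log_pow] at e2 e4
  -- The incomplete last block, from `exp(B^M)` to `x`, has bounded prime mass and goes into the
  -- constant.
  have e5 : ∑ p ∈ primesLT x \ primesLT (scale B M), primeWeight ρ p * cosFactor th p ≤
      2 ^ N * (z * Real.log B + C2) := by
    calc _ ≤ ∑ p ∈ primesLT x \ primesLT (scale B M), primeWeight ρ p * 2 ^ N :=
          sum_le_sum fun p _ => mul_le_mul_of_nonneg_left (cosFactor_le th p) (hv p)
      _ = 2 ^ N * ∑ p ∈ primesLT x \ primesLT (scale B M), primeWeight ρ p := by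
          rw [← sum_mul, mul_comm]
      _ ≤ _ := by
          gcongr
          nlinarith [hloglog.2]
  have e6 : ∑ p ∈ primesLT x \ primesLT (scale B k), primeWeight ρ p * cosFactor th p =
      ∑ p ∈ primeBlock B k M, primeWeight ρ p * cosFactor th p +
        ∑ p ∈ primesLT x \ primesLT (scale B M), primeWeight ρ p * cosFactor th p := by
    unfold primeBlock
    rw [sum_primesLT_sdiff (hMk.trans hMx), sum_primesLT_sdiff hMk, sum_primesLT_sdiff hMx]
    ring
  rw [e6, sum_sub_distrib, sum_const, Nat.card_Ico, nsmul_eq_mul, mul_one, Nat.cast_sub hkM]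
  have e7 : z * (Real.log B * (M - k)) ≤
      z * (Real.log (Real.log x) - k * Real.log B) := by
    gcongr; nlinarith [hloglog.1]
  linarith

lemma exists_prod_all_le {z : ℝ} (hz : 0 < z) {ρ : ArithmeticFunction ℝ} (hρ : IsClassM z ρ)
    (N : ℕ) {B : ℝ} (hB : 1 < B) : ∃ C : ℝ, 0 < C ∧ ∀ (M : ℕ) (x : ℝ) (th : Fin N → ℝ),
      scale B M ≤ x → x ≤ scale B (M + 1) → th ∈ Set.Icc 0 1 →
      meanOn ρ (primesLT x) (fun S => ∏ p ∈ S, cosFactor th p) ≤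
      C * Real.exp (z * Real.log B * ∑ i ∈ range M, ((2 : ℝ) ^ lowRank th (B ^ i)⁻¹ - 1)) := by
  obtain ⟨C, hC, h⟩ := exists_prod_tail_le hz hρ N hB
  have hv := hρ.primeWeight_nonneg
  -- The scales start at `exp 1`, so the finitely many smaller primes are bounded trivially by `2^N`
  -- each.
  refine ⟨(2 ^ N) ^ #(primesLT (scale B 0)) * C, by positivity, fun M x th hMx hxM hth => ?_⟩
  have h0x : scale B 0 ≤ x := (scale_mono hB.le (Nat.zero_le M)).trans hMx
  have h1 := h 0 M x th (Nat.zero_le M) hMx hxM hth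
  rw [← range_eq_Ico] at h1
  rw [meanOn, subsetSum_prod, ← union_sdiff_of_subset (primesLT_mono h0x),
    prod_union disjoint_sdiff, prod_union disjoint_sdiff, mul_div_mul_comm, mul_assoc]
  refine mul_le_mul ?_ h1 (div_nonneg (prod_nonneg fun p _ => ?_) (prod_nonneg fun p _ => ?_))
    (by positivity)
  · rw [← prod_div_distrib, ← prod_const]
    refine prod_le_prod (fun p _ => ?_) fun p _ => ?_
    · have := hv p
      have := cosFactor_nonneg th p
      positivity
    · have h1 := hv p
      have h2 := cosFactor_le th p
      have h3 : (1 : ℝ) ≤ 2 ^ N := one_le_pow₀ one_le_two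
      rw [div_le_iff₀ (by linarith)]
      nlinarith
  · have := mul_nonneg (hv p) (cosFactor_nonneg th p)
    linarith
  · linarith [hv p]

end

end DeltaMoments

/-! ### The upper bound for integer moments. -/

namespace DeltaMoments

noncomputable section

open Finset MeasureTheory

/-- The total being fixed, the coordinate `j0` is determined by the others, which are then allowed
to vary freely. -/
lemma sum_piAntidiag_prod_le {n : ℕ} (j0 : Fin n) (f : Fin n → ℕ → ℝ) (hf : ∀ j i, 0 ≤ f j i)
    (M : ℕ) :
    ∑ g ∈ piAntidiag (univ : Finset (Fin n)) M, ∏ j ∈ univ.erase j0, f j (g j) ≤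
      ∏ j ∈ univ.erase j0, ∑ i ∈ range (M + 1), f j i := by
  classical
  rw [prod_sum]
  set φ : (Fin n → ℕ) → (∀ j ∈ univ.erase j0, ℕ) := fun g j _ => g j with hφ
  have hinj : Set.InjOn φ (piAntidiag (univ : Finset (Fin n)) M) := by
    intro g hg g' hg' h
    rw [mem_coe, mem_piAntidiag] at hg hg'
    have hoff : ∀ j, j ≠ j0 → g j = g' j := fun j hj =>
      congrFun (congrFun h j) (mem_erase.2 ⟨hj, mem_univ j⟩)
    have h1 := hg.1.trans hg'.1.symm
    rw [← add_sum_erase _ _ (mem_univ j0), ← add_sum_erase _ g' (mem_univ j0),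
      sum_congr rfl fun j hj => hoff j (mem_erase.1 hj).1] at h1
    funext j
    rcases eq_or_ne j j0 with rfl | hj
    · exact Nat.add_right_cancel h1
    · exact hoff j hj
  have hle : ∀ g ∈ piAntidiag (univ : Finset (Fin n)) M, ∏ j ∈ univ.erase j0, f j (g j) =
      ∏ j ∈ (univ.erase j0).attach, f j.1 (φ g j.1 j.2) := fun g _ =>
    (prod_attach (univ.erase j0) fun j => f j (g j)).symm
  rw [sum_congr rfl hle, ← sum_image (f := fun p => ∏ j ∈ (univ.erase j0).attach,
      f j.1 (p j.1 j.2)) hinj]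
  refine sum_le_sum_of_subset_of_nonneg (fun p hp => ?_) fun p _ _ => prod_nonneg fun j _ => hf _ _
  obtain ⟨g, hg, rfl⟩ := mem_image.1 hp
  rw [mem_piAntidiag] at hg
  rw [mem_pi]
  intro j _
  rw [mem_range, Nat.lt_succ_iff, ← hg.1]
  exact single_le_sum (fun i _ => Nat.zero_le (g i)) (mem_univ j)

lemma sum_exp_neg_le {c : ℝ} (hc : 0 < c) (n : ℕ) :
    ∑ i ∈ range n, Real.exp (-(c * i)) ≤ (1 - Real.exp (-c))⁻¹ := by
  have h1 : Real.exp (-c) < 1 := Real.exp_lt_one_iff.2 (by linarith)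
  rw [← tsum_geometric_of_lt_one (Real.exp_pos _).le h1]
  have h2 : ∀ i : ℕ, Real.exp (-(c * i)) = Real.exp (-c) ^ i := fun i => by
    rw [← Real.exp_nat_mul]; congr 1; ring
  rw [sum_congr rfl fun i _ => h2 i]
  exact (summable_geometric_of_lt_one (Real.exp_pos _).le h1).sum_le_tsum _
    fun i _ => by positivity

/-- The exponent `z (2 ^ j - 1) - j`. -/
def momentExp (z : ℝ) (j : ℕ) : ℝ := z * (2 ^ j - 1) - j

lemma momentExp_zero (z : ℝ) : momentExp z 0 = 0 := by simp [momentExp]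

lemma beta_sub_eq (t : ℕ) (z : ℝ) : beta t z - z = momentExp z t := by
  rw [beta, momentExp, Real.rpow_natCast]; ring

lemma two_pow_sub_one_pos {t : ℕ} (ht : 1 ≤ t) : (0 : ℝ) < 2 ^ t - 1 := by
  have : (1 : ℝ) < 2 ^ t := one_lt_pow₀ one_lt_two (by omega)
  linarith

lemma zt_le_iff {t : ℕ} (ht : 1 ≤ t) {z : ℝ} : zt t ≤ z ↔ 0 ≤ momentExp z t := by
  rw [zt, Real.rpow_natCast, div_le_iff₀ (two_pow_sub_one_pos ht), momentExp, sub_nonneg]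

/-- The ratio `(2^j - 1)/j` is strictly increasing; this is the convexity behind the dominance of
rank `t`. -/
lemma mul_two_pow_sub_one_lt {j t : ℕ} (hj : 0 < j) (hjt : j < t) :
    (t : ℝ) * (2 ^ j - 1) < j * (2 ^ t - 1) := by
  induction t, hjt using Nat.le_induction with
  | base =>
    push_cast
    have h : (j : ℝ) + 1 ≤ 2 ^ j := by exact_mod_cast Nat.lt_two_pow_self
    have hj1 : (1 : ℝ) ≤ j := by exact_mod_cast hj
    rw [pow_succ]
    have key : (j : ℝ) * (2 ^ j * 2 - 1) - (j + 1) * (2 ^ j - 1) = (j - 1) * 2 ^ j + 1 := by ring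
    have : 0 ≤ ((j : ℝ) - 1) * 2 ^ j := mul_nonneg (by linarith) (by positivity)
    linarith
  | succ t hjt ih =>
    have h1 : (2 : ℝ) ^ j ≤ 2 ^ t := pow_le_pow_right₀ one_le_two (by omega)
    have hj1 : (1 : ℝ) ≤ j := by exact_mod_cast hj
    push_cast
    rw [pow_succ]
    have h2 : (2 : ℝ) ^ t ≤ j * 2 ^ t := le_mul_of_one_le_left (by positivity) hj1
    linarith

lemma momentExp_lt {t j : ℕ} (hj : 0 < j) (hjt : j < t) {z : ℝ} (h : 0 ≤ momentExp z t) :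
    momentExp z j < momentExp z t := by
  have h1 := mul_two_pow_sub_one_lt hj hjt
  have ht := two_pow_sub_one_pos (t := t) (by omega)
  have htj : (0 : ℝ) < t - j := by
    rw [sub_pos]; exact_mod_cast hjt
  unfold momentExp at *
  have hz : t / (2 ^ t - 1) ≤ z := by rw [div_le_iff₀ ht]; linarith
  have h3 : (2 : ℝ) ^ j < 2 ^ t := pow_lt_pow_right₀ one_lt_two hjt
  have h4 : (t / (2 ^ t - 1) : ℝ) * (2 ^ t - 2 ^ j) ≤ z * (2 ^ t - 2 ^ j) :=
    mul_le_mul_of_nonneg_right hz (by linarith)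
  have h5 : (t - j : ℝ) < t / (2 ^ t - 1) * (2 ^ t - 2 ^ j) := by
    rw [div_mul_eq_mul_div, lt_div_iff₀ ht]; nlinarith
  linarith

lemma exists_scale_le {B x : ℝ} (hB : 1 < B) (hx : 3 ≤ x) :
    ∃ M : ℕ, scale B M ≤ x ∧ x ≤ scale B (M + 1) ∧ B ^ M ≤ Real.log x ∧
      Real.log x ≤ B ^ (M + 1) := by
  have hx0 : 0 < x := by linarith
  have h1 : 1 ≤ Real.log x := by
    rw [Real.le_log_iff_exp_le hx0]; linarith [Real.exp_one_lt_d9]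
  obtain ⟨M, h2, h3⟩ := exists_nat_pow_near h1 hB
  refine ⟨M, ?_, ?_, h2, h3.le⟩
  · exact (Real.le_log_iff_exp_le hx0).1 h2
  · exact (Real.log_le_iff_le_exp hx0).1 h3.le

lemma exp_log_mul_le {B L h : ℝ} (hB : 1 < B) {M : ℕ} (hL : B ^ M ≤ L) (hh : 0 ≤ h) :
    Real.exp (Real.log B * h * M) ≤ L ^ h := by
  have hB0 : 0 < B := by linarith
  refine le_trans (le_of_eq ?_) (Real.rpow_le_rpow (by positivity) hL hh)
  rw [Real.rpow_def_of_pos (by positivity), Real.log_pow]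
  congr 1; ring

lemma log_log_pos {x : ℝ} (hx : 3 ≤ x) : 0 < Real.log (Real.log x) := by
  refine Real.log_pos ?_
  rw [Real.lt_log_iff_exp_lt (by linarith)]
  linarith [Real.exp_one_lt_d9]

lemma exists_succ_le_log_log {B : ℝ} (hB : 1 < B) : ∃ C : ℝ, 0 < C ∧ ∀ (x : ℝ) (M : ℕ), 3 ≤ x →
    B ^ M ≤ Real.log x → (M : ℝ) + 1 ≤ C * Real.log (Real.log x) := by
  have hK := Real.log_pos hB
  have h3 := log_log_pos le_rfl
  refine ⟨(Real.log B)⁻¹ + (Real.log (Real.log 3))⁻¹, by positivity, fun x M hx hM => ?_⟩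
  have h1 := Real.log_le_log (by positivity) hM
  rw [Real.log_pow] at h1
  have h2 : Real.log (Real.log 3) ≤ Real.log (Real.log x) :=
    Real.log_le_log (Real.log_pos (by norm_num)) (Real.log_le_log (by norm_num) hx)
  rw [add_mul]
  gcongr
  · rw [inv_mul_eq_div, le_div_iff₀ hK]; exact h1
  · rw [inv_mul_eq_div, le_div_iff₀ h3]; linarith

lemma exp_sum_mul_inv_pow {N : ℕ} {B : ℝ} (hB : 1 < B) (z : ℝ) (g : Fin (N + 1) → ℕ) :
    Real.exp (z * Real.log B * ∑ j : Fin (N + 1), g j * ((2 : ℝ) ^ (j : ℕ) - 1)) *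
      (B ^ ∑ l : Fin (N + 1), (l : ℕ) * g l)⁻¹ =
      Real.exp (Real.log B * ∑ j : Fin (N + 1), momentExp z j * g j) := by
  have hB0 : 0 < B := by linarith
  have h : (B ^ ∑ l : Fin (N + 1), (l : ℕ) * g l)⁻¹ =
      Real.exp (-(Real.log B * ∑ l : Fin (N + 1), (l : ℝ) * g l)) := by
    rw [Real.exp_neg, ← Real.exp_log (pow_pos hB0 _), Real.log_pow]
    push_cast
    rw [mul_comm]
  rw [h, ← Real.exp_add]
  congr 1
  rw [mul_sum, mul_sum, mul_sum, ← sum_neg_distrib, ← sum_add_distrib]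
  refine sum_congr rfl fun j _ => ?_
  rw [momentExp]; ring

/-- Factor the main term out of an exponential sum over occupation numbers. -/
lemma exp_sum_momentExp {n : ℕ} {K h : ℝ} (a : Fin n → ℝ) {M : ℕ} {g : Fin n → ℕ}
    (hg : g ∈ piAntidiag univ M) :
    Real.exp (K * ∑ j, a j * g j) =
      Real.exp (K * h * M) * ∏ j, Real.exp (-(K * (h - a j) * g j)) := by
  rw [← Real.exp_sum, ← Real.exp_add]
  congr 1
  rw [mem_piAntidiag] at hg
  rw [← hg.1]
  push_cast
  rw [mul_sum, mul_sum, ← sum_add_distrib]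
  exact sum_congr rfl fun j _ => by ring

/-- With `h` the exponent of rank `t`, the factor `exp(K h M) ≤ (log x)^h` is extracted and the
coordinate of rank `t` eliminated. Ranks strictly between `0` and `t` leave convergent geometric
sums. Rank `0` leaves a sum with ratio `exp(-K h)`: bounded if `h > 0`, and `M + 1 ≪ log log x` if
`h = 0`. -/
theorem exists_moment_le {z : ℝ} (hz : 0 < z) {ρ : ArithmeticFunction ℝ} (hρ : IsClassM z ρ)
    {t : ℕ} (ht : 1 ≤ t) (hzt : zt t ≤ z) : ∃ C : ℝ, 0 < C ∧ ∀ x : ℝ, 3 ≤ x →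
      expect ρ x (fun n => M 2 n ^ t / (tau n : ℝ) ^ t) ≤
        C * (Real.log x ^ (beta t z - z) * Real.log (Real.log x) ^ delta t z) := by
  rw [zt_le_iff ht] at hzt
  -- Any fixed base larger than `1` would serve here.
  set B : ℝ := 2
  have hB : (1 : ℝ) < B := one_lt_two
  have hK := Real.log_pos hB
  set K := Real.log B
  obtain ⟨C1, hC1, h1⟩ := exists_prod_all_le hz hρ t hB
  obtain ⟨C2, hC2, h2⟩ := exists_integral_cube_le t
  obtain ⟨C3, hC3, h3⟩ := exists_succ_le_log_log hB
  set h := momentExp z t with hh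
  -- the sums over the occupation numbers of ranks below `t`
  have hS : ∀ j : Fin (t + 1), ∃ C : ℝ, 0 < C ∧ (j ≠ Fin.last t → j ≠ 0 → ∀ M : ℕ,
      ∑ i ∈ range (M + 1), Real.exp (-(K * (h - momentExp z j) * i)) ≤ C) := by
    intro j
    by_cases hj : j ≠ Fin.last t ∧ j ≠ 0
    · have hlt : (j : ℕ) < t := Fin.val_lt_last hj.1
      have hpos : 0 < (j : ℕ) := Nat.pos_of_ne_zero fun h0 => hj.2 (Fin.ext h0)
      have hd : 0 < K * (h - momentExp z j) := mul_pos hK (sub_pos.2 (momentExp_lt hpos hlt hzt))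
      have hexp : Real.exp (-(K * (h - momentExp z j))) < 1 := Real.exp_lt_one_iff.2 (by linarith)
      exact ⟨_, inv_pos.2 (sub_pos.2 hexp), fun _ _ M => sum_exp_neg_le hd _⟩
    · exact ⟨1, one_pos, fun h1 h2 => absurd ⟨h1, h2⟩ hj⟩
  choose Cj hCj hCj' using hS
  have h0S : ∃ C : ℝ, 0 < C ∧ ∀ (x : ℝ) (M : ℕ), 3 ≤ x → B ^ M ≤ Real.log x →
      ∑ i ∈ range (M + 1), Real.exp (-(K * (h - momentExp z 0) * i)) ≤
        C * Real.log (Real.log x) ^ delta t z := by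
    rw [momentExp_zero, sub_zero]
    by_cases hδ : beta t z = z
    · have hh0 : h = 0 := by rw [hh, ← beta_sub_eq, hδ, sub_self]
      refine ⟨C3, hC3, fun x M hx hM => ?_⟩
      rw [delta, if_pos hδ, hh0, Real.rpow_one]
      simpa using h3 x M hx hM
    · have hh0 : 0 < h := by
        refine lt_of_le_of_ne hzt fun h0 => hδ ?_
        have := beta_sub_eq t z
        linarith
      have hd : 0 < K * h := mul_pos hK hh0
      have hexp : Real.exp (-(K * h)) < 1 := Real.exp_lt_one_iff.2 (by linarith)
      refine ⟨_, inv_pos.2 (sub_pos.2 hexp), fun x M hx hM => ?_⟩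
      rw [delta, if_neg hδ, Real.rpow_zero, mul_one]
      exact sum_exp_neg_le hd _
  obtain ⟨C0, hC0, h0S⟩ := h0S
  have hPpos : 0 < ∏ j ∈ (univ.erase (Fin.last t)).erase 0, Cj j := prod_pos fun j _ => hCj j
  refine ⟨(5 / 2) ^ t * (C2 * B ^ t * (C1 * (C0 * ∏ j ∈ (univ.erase (Fin.last t)).erase 0, Cj j))),
    by positivity, fun x hx => ?_⟩
  obtain ⟨M, hMx, hxM, hML, hLM⟩ := exists_scale_le hB hx
  have hind := expect_indicator_le hρ t x Set.univ
  simp only [Set.indicator_univ, one_mul] at hind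
  refine hind.trans ?_
  rw [mul_assoc]
  gcongr
  have hcube := h2 B M
    (fun g => C1 * Real.exp (z * K * ∑ j : Fin (t + 1), g j * ((2 : ℝ) ^ (j : ℕ) - 1)))
    (fun th => meanOn ρ (primesLT x) (fun S => ∏ p ∈ S, cosFactor th p)) hB.le
    (fun g => by positivity)
    (continuous_meanOn ρ _ (fun S (th : Fin t → ℝ) => ∏ p ∈ S, cosFactor th p)
      fun S => continuous_prod_cosFactor S)
    (fun th hth => by
      have := h1 M x th hMx hxM hth
      rwa [sum_lowRank_eq_sum_occ B M th (fun r => (2 : ℝ) ^ r - 1)] at this)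
  refine hcube.trans ?_
  rw [mul_assoc (C2 * B ^ t)]
  have hnn : 0 ≤ C2 * B ^ t := by positivity
  refine mul_le_mul_of_nonneg_left ?_ hnn
  have hne : (0 : Fin (t + 1)) ∈ univ.erase (Fin.last t) := by
    rw [mem_erase]
    exact ⟨fun h0 => by have := congrArg Fin.val h0; simp at this; omega, mem_univ _⟩
  have hLpos : 0 ≤ Real.log x ^ (beta t z - z) :=
    Real.rpow_nonneg (Real.log_nonneg (by linarith)) _
  have hllpos : 0 ≤ Real.log (Real.log x) ^ delta t z := Real.rpow_nonneg (log_log_pos hx).le _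
  calc ∑ g ∈ piAntidiag univ M, C1 * Real.exp (z * K *
        ∑ j : Fin (t + 1), g j * ((2 : ℝ) ^ (j : ℕ) - 1)) *
          (B ^ ∑ l : Fin (t + 1), (l : ℕ) * g l)⁻¹
      = C1 * (Real.exp (K * h * M) * ∑ g ∈ piAntidiag (univ : Finset (Fin (t + 1))) M,
          ∏ j ∈ univ.erase (Fin.last t), Real.exp (-(K * (h - momentExp z j) * g j))) := by
        rw [mul_sum, mul_sum]
        refine sum_congr rfl fun g hg => ?_
        rw [mul_assoc, exp_sum_mul_inv_pow hB, exp_sum_momentExp (h := h) _ hg,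
          ← mul_prod_erase univ _ (mem_univ (Fin.last t))]
        simp [← hh, K]
    _ ≤ C1 * (Real.log x ^ (beta t z - z) * ∏ j ∈ univ.erase (Fin.last t),
          ∑ i ∈ range (M + 1), Real.exp (-(K * (h - momentExp z j) * i))) := by
        rw [beta_sub_eq, ← hh] at *
        have := exp_log_mul_le hB hML hzt
        have := sum_piAntidiag_prod_le (Fin.last t)
          (fun j i => Real.exp (-(K * (h - momentExp z j) * i))) (fun j i => (Real.exp_pos _).le) M
        gcongr
    _ ≤ C1 * (Real.log x ^ (beta t z - z) * (C0 * Real.log (Real.log x) ^ delta t z *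
          ∏ j ∈ (univ.erase (Fin.last t)).erase 0, Cj j)) := by
        gcongr
        rw [← mul_prod_erase _ _ hne]
        refine mul_le_mul (by simpa using h0S x M hx hML) (prod_le_prod (fun j _ => ?_) fun j hj =>
            ?_)
          (prod_nonneg fun j _ => ?_) (by positivity)
        · exact sum_nonneg fun i _ => (Real.exp_pos _).le
        · rw [mem_erase, mem_erase] at hj
          exact hCj' j hj.2.1 hj.1 M
        · exact sum_nonneg fun i _ => (Real.exp_pos _).le
    _ = _ := by ring

end

end DeltaMoments

/-! ### Positive drift and time spent near the barrier. -/

namespace DeltaMoments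

noncomputable section

open Finset

/-- As `κ → 0` the right side is `~ κ a log 2`, which exceeds `κ` by assumption. The bound `κ ≤ 1/2`
is needed in `lowMajorant_le`. -/
lemma exists_kappa {a : ℝ} (ha : 1 < a * Real.log 2) :
    ∃ κ : ℝ, 0 < κ ∧ κ ≤ 1 / 2 ∧ κ < a * (1 - (2 : ℝ) ^ (-κ)) := by
  have hl := Real.log_pos one_lt_two
  have hapos : 0 < a := by
    by_contra h
    push Not at h
    nlinarith
  set κ := min (1 / 2) ((a * Real.log 2 - 1) / (2 * Real.log 2)) with hκ
  have hκ0 : 0 < κ := lt_min (by norm_num) (div_pos (by linarith) (by linarith))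
  refine ⟨κ, hκ0, min_le_left _ _, ?_⟩
  have h1 : κ * Real.log 2 ≤ (a * Real.log 2 - 1) / 2 := by
    calc κ * Real.log 2 ≤ (a * Real.log 2 - 1) / (2 * Real.log 2) * Real.log 2 := by
          gcongr; exact min_le_right _ _
      _ = _ := by field_simp
  have hu : 0 < κ * Real.log 2 := by positivity
  have h2 : (2 : ℝ) ^ (-κ) ≤ (1 + κ * Real.log 2)⁻¹ := by
    rw [Real.rpow_def_of_pos two_pos, mul_neg, Real.exp_neg, mul_comm]
    refine inv_anti₀ (by linarith) ?_
    rw [add_comm]; exact Real.add_one_le_exp _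
  have h3 : κ < a * (1 - (1 + κ * Real.log 2)⁻¹) := by
    have : 1 - (1 + κ * Real.log 2)⁻¹ = κ * Real.log 2 / (1 + κ * Real.log 2) := by
      field_simp; ring
    rw [this, mul_div_assoc', lt_div_iff₀ (by linarith)]
    nlinarith
  nlinarith

/-- As a function of `F = 1/E`, the left side is `F/(F + w)`, which is concave; the right side is
its tangent at `F = 1`. -/
lemma inv_one_add_mul_sub_le {w E : ℝ} (hw : 0 ≤ w) (hE : 0 < E) :
    (1 + w * E)⁻¹ ≤ (1 + w)⁻¹ + (E⁻¹ - 1) * (w / (1 + w) ^ 2) := by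
  have h1 : 0 < 1 + w := by linarith
  have h2 : 0 < 1 + w * E := by positivity
  have key : (1 + w)⁻¹ + (E⁻¹ - 1) * (w / (1 + w) ^ 2) - (1 + w * E)⁻¹ =
      w * (1 - E) ^ 2 / ((1 + w) ^ 2 * E * (1 + w * E)) := by
    field_simp; ring
  have : 0 ≤ w * (1 - E) ^ 2 / ((1 + w) ^ 2 * E * (1 + w * E)) := by positivity
  linarith

lemma IsClassM.exists_abs_sum_le {z : ℝ} {ρ : ArithmeticFunction ℝ} (hρ : IsClassM z ρ) :
    ∃ C : ℝ, 0 < C ∧ ∀ y : ℝ, 2 ≤ y →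
      |∑ p ∈ primesLT y, primeWeight ρ p - z * Real.log (Real.log y)| ≤ C := by
  obtain ⟨C, hC⟩ := exists_abs_sum_cos_le hρ 0
  refine ⟨|C| + 1, by positivity, fun y hy => ?_⟩
  have h := hC 0 y (by simp) hy
  have hl : 0 < Real.log y := Real.log_pos (by linarith)
  simp only [zero_mul, Real.cos_zero, mul_one, abs_zero] at h
  rw [max_eq_left (inv_pos.2 hl).le, Real.log_inv] at h
  refine le_trans ?_ (h.trans ((le_abs_self C).trans (by linarith)))
  simp [primeWeight, mul_neg, ← sub_eq_add_neg]

/-- The power `(2 ^ #S / (T B ^ k)) ^ κ`. -/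
def excess (κ B T : ℝ) (k : ℕ) (S : Finset ℕ) : ℝ := ((2 : ℝ) ^ #S / (T * B ^ k)) ^ κ

/-- The mean of `w / (1 + w) ^ 2` with `w = excess κ B T k S`, when the primes are weighted
by `v`. -/
def greenTerm (v : ℕ → ℝ) (κ B T : ℝ) (k : ℕ) : ℝ :=
  subsetSum v (primesLT (scale B k))
    (fun S => excess κ B T k S / (1 + excess κ B T k S) ^ 2) /
      ∏ p ∈ primesLT (scale B k), (1 + v p)

lemma excess_nonneg {κ B T : ℝ} (hB : 0 < B) (hT : 0 < T) (k : ℕ) (S : Finset ℕ) :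
    0 ≤ excess κ B T k S := Real.rpow_nonneg (by positivity) _

lemma greenTerm_nonneg {v : ℕ → ℝ} (hv : ∀ p, 0 ≤ v p) {κ B T : ℝ} (hB : 0 < B) (hT : 0 < T)
    (k : ℕ) : 0 ≤ greenTerm v κ B T k := by
  refine div_nonneg (subsetSum_nonneg (fun p _ => hv p) fun S _ => ?_)
    (prod_nonneg fun p _ => by linarith [hv p])
  have := excess_nonneg (κ := κ) hB hT k S
  positivity

/-- If the process `excess` has sufficient drift, the total of the `greenTerm`s is bounded. -/
lemma sum_greenTerm_le {v : ℕ → ℝ} (hv : ∀ p, 0 ≤ v p) {κ B T : ℝ} (hB : 1 < B)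
    (hT : 0 < T)
    (hdrift : ∀ k, B ^ κ * ((∏ p ∈ primeBlock B k (k + 1), (1 + v p * (2 : ℝ) ^ (-κ))) /
      ∏ p ∈ primeBlock B k (k + 1), (1 + v p)) ≤ 1 / 2) (m : ℕ) :
    ∑ k ∈ range m, greenTerm v κ B T k ≤ 2 := by
  have hB0 : 0 < B := by linarith
  -- A bounded potential: by independence of the next block and the tangent inequality, it decreases
  -- at each step by at least half of `greenTerm`, and the sum telescopes.
  set Ψ : ℕ → ℝ := fun k => subsetSum v (primesLT (scale B k))
    (fun S => (1 + excess κ B T k S)⁻¹) / ∏ p ∈ primesLT (scale B k), (1 + v p) with hΨ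
  have hZ : ∀ P : Finset ℕ, 0 < ∏ p ∈ P, (1 + v p) := fun P => prod_pos fun p _ =>
      by linarith [hv p]
  have hΨ0 : ∀ k, 0 ≤ Ψ k := fun k => by
    refine div_nonneg (subsetSum_nonneg (fun p _ => hv p) fun S _ => ?_) (hZ _).le
    have := excess_nonneg (κ := κ) hB0 hT k S
    positivity
  have hΨ1 : Ψ 0 ≤ 1 := by
    rw [hΨ]
    simp only
    rw [div_le_one (hZ _), ← subsetSum_one]
    refine subsetSum_mono (fun p _ => hv p) fun S _ => ?_
    exact inv_le_one_of_one_le₀ (by linarith [excess_nonneg (κ := κ) hB0 hT 0 S])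
  have hstep : ∀ k, greenTerm v κ B T k ≤ 2 * (Ψ k - Ψ (k + 1)) := by
    intro k
    set P := primesLT (scale B k)
    set Q := primeBlock B k (k + 1) with hQ
    have hPQ : primesLT (scale B (k + 1)) = P ∪ Q :=
      (union_sdiff_of_subset (primesLT_mono (scale_mono hB.le (Nat.le_succ k)))).symm
    have hdis : Disjoint P Q := disjoint_sdiff
    set E : Finset ℕ → ℝ := fun S => ((2 : ℝ) ^ κ) ^ #S * (B ^ κ)⁻¹ with hE
    have hE0 : ∀ S, 0 < E S := fun S => by
      have := Real.rpow_pos_of_pos two_pos κ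
      have := Real.rpow_pos_of_pos hB0 κ
      positivity
    have hmul : ∀ S ⊆ P ∪ Q, excess κ B T (k + 1) S = excess κ B T k (S ∩ P) * E (S ∩ Q) := by
      intro S hS
      have hc : #S = #(S ∩ P) + #(S ∩ Q) := by
        rw [← card_union_of_disjoint (hdis.mono inter_subset_right inter_subset_right),
          ← inter_union_distrib_left, inter_eq_left.2 hS]
      have : (2 : ℝ) ^ #S / (T * B ^ (k + 1)) =
          (2 ^ #(S ∩ P) / (T * B ^ k)) * (2 ^ #(S ∩ Q) * B⁻¹) := by
        rw [hc, pow_add, pow_succ]; field_simp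
      rw [excess, this, Real.mul_rpow (by positivity) (by positivity),
        Real.mul_rpow (by positivity) (by positivity), Real.inv_rpow hB0.le,
        ← Real.rpow_pow_comm two_pos.le κ #(S ∩ Q), hE, excess]
    set φ : Finset ℕ → ℝ := fun S => excess κ B T k S / (1 + excess κ B T k S) ^ 2 with hφ
    set ψ : Finset ℕ → ℝ := fun S => (1 + excess κ B T k S)⁻¹ with hψ
    have hZPQ : ∏ p ∈ P ∪ Q, (1 + v p) = (∏ p ∈ P, (1 + v p)) * ∏ p ∈ Q, (1 + v p) :=
      prod_union hdis
    -- The mean of `1/E` over one block is the quantity assumed to be at most `1/2`, so the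
    -- coefficient `1/E - 1` of the tangent has mean at most `-1/2`.
    have hEsum : subsetSum v Q (fun S => (E S)⁻¹) =
        B ^ κ * ∏ p ∈ Q, (1 + v p * (2 : ℝ) ^ (-κ)) := by
      rw [← subsetSum_prod v (fun _ => (2 : ℝ) ^ (-κ)), ← subsetSum_const_mul]
      congr 1
      funext S
      rw [hE, prod_const, Real.rpow_neg two_pos.le, mul_inv, inv_inv, inv_pow, mul_comm]
    have hle : subsetSum v (P ∪ Q) (fun S => (1 + excess κ B T (k + 1) S)⁻¹) ≤
        subsetSum v P ψ * subsetSum v Q (fun _ => 1) +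
          (subsetSum v P φ * subsetSum v Q (fun S => (E S)⁻¹) -
            subsetSum v P φ * subsetSum v Q (fun _ => 1)) := by
      rw [← subsetSum_union_mul v hdis, ← subsetSum_union_mul v hdis, ← subsetSum_union_mul v hdis,
        sub_eq_add_neg, ← neg_one_mul, ← subsetSum_const_mul, ← subsetSum_add, ← subsetSum_add]
      refine subsetSum_mono (fun p _ => hv p) fun S hS => ?_
      rw [hmul S hS]
      refine (inv_one_add_mul_sub_le (excess_nonneg hB0 hT k _) (hE0 _)).trans (le_of_eq ?_)
      simp only [hφ, hψ]
      ring
    have hφ0 : 0 ≤ subsetSum v P φ := subsetSum_nonneg (fun p _ => hv p) fun S _ => by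
      have := excess_nonneg (κ := κ) hB0 hT k S
      simp only [hφ]
      positivity
    rw [hEsum, subsetSum_one] at hle
    have hd := hdrift k
    rw [← hQ, ← mul_div_assoc, div_le_iff₀ (hZ Q)] at hd
    have e1 : Ψ (k + 1) = subsetSum v (P ∪ Q) (fun S => (1 + excess κ B T (k + 1) S)⁻¹) /
        ((∏ p ∈ P, (1 + v p)) * ∏ p ∈ Q, (1 + v p)) := by
      rw [← hZPQ, ← hPQ]
    have e2 : Ψ k = subsetSum v P ψ / ∏ p ∈ P, (1 + v p) := rfl
    have e3 : greenTerm v κ B T k = subsetSum v P φ / ∏ p ∈ P, (1 + v p) := rfl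
    have hZP := hZ P
    have hZQ := hZ Q
    have hfin : Ψ (k + 1) ≤ Ψ k - 1 / 2 * greenTerm v κ B T k := by
      rw [e1, e2, e3, div_le_iff₀ (mul_pos hZP hZQ)]
      refine hle.trans ?_
      have : (subsetSum v P ψ / ∏ p ∈ P, (1 + v p) -
          1 / 2 * (subsetSum v P φ / ∏ p ∈ P, (1 + v p))) *
          ((∏ p ∈ P, (1 + v p)) * ∏ p ∈ Q, (1 + v p)) =
          (subsetSum v P ψ - 1 / 2 * subsetSum v P φ) * ∏ p ∈ Q, (1 + v p) := by
        field_simp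
      rw [this]
      nlinarith [mul_le_mul_of_nonneg_left hd hφ0]
    linarith
  calc ∑ k ∈ range m, greenTerm v κ B T k ≤ ∑ k ∈ range m, 2 * (Ψ k - Ψ (k + 1)) :=
        sum_le_sum fun k _ => hstep k
    _ = 2 * (Ψ 0 - Ψ m) := by rw [← mul_sum, sum_range_sub']
    _ ≤ 2 := by linarith [hΨ0 m]

/-- A suitable base `B` for the scales, for the weights `2 ^ t ρ(p) / p`. -/
lemma exists_base {z : ℝ} {ρ : ArithmeticFunction ℝ} (hρ : IsClassM z ρ) {a κ : ℝ} (ha : 0 < a)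
    (hκ0 : 0 < κ) (hκ : κ < a * z * (1 - (2 : ℝ) ^ (-κ))) : ∃ B : ℝ, 1 < B ∧ ∀ k : ℕ,
      B ^ κ * ((∏ p ∈ primeBlock B k (k + 1), (1 + a * primeWeight ρ p * (2 : ℝ) ^ (-κ))) /
        ∏ p ∈ primeBlock B k (k + 1), (1 + a * primeWeight ρ p)) ≤ 1 / 2 := by
  obtain ⟨C1, hC1, h1⟩ := hρ.exists_abs_sum_block_le
  obtain ⟨C2, hC2, h2⟩ := hρ.exists_sum_sq_le
  have hv := hρ.primeWeight_nonneg
  set s := (2 : ℝ) ^ (-κ) with hs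
  have hs0 : 0 < s := Real.rpow_pos_of_pos two_pos _
  have hs1 : s < 1 := Real.rpow_lt_one_of_one_lt_of_neg one_lt_two (by linarith)
  set c0 := a * z * (1 - s) - κ with hc0
  have hc0pos : 0 < c0 := by linarith
  -- The drift over a block of logarithmic length `K` is `c0 * K`; this choice makes it absorb the
  -- bounded errors and leave the factor `1/2`.
  set K := ((1 - s) * a * C1 + a ^ 2 * C2 + Real.log 2) / c0 with hK
  have h1s : 0 < 1 - s := by linarith
  have hKpos : 0 < K := div_pos (by have := Real.log_pos one_lt_two; positivity) hc0pos
  refine ⟨Real.exp K, Real.one_lt_exp_iff.2 hKpos, fun k => ?_⟩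
  have e1 := (abs_le.1 (h1 (Real.exp K) k (k + 1) (Real.one_lt_exp_iff.2 hKpos) (Nat.le_succ k))).1
  have e2 := h2 (primeBlock (Real.exp K) k (k + 1)) fun p hp => prime_of_mem_sdiff hp
  set Q := primeBlock (Real.exp K) k (k + 1)
  rw [Real.log_exp] at e1
  push_cast at e1
  have hb := prod_one_add_le_exp (P := Q) (v := fun p => a * primeWeight ρ p) (h := fun _ => s)
    (fun p _ => mul_nonneg ha.le (hv p)) fun _ _ => hs0.le
  have hpow : Real.exp K ^ κ = Real.exp (K * κ) := by rw [Real.exp_mul]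
  calc _ ≤ Real.exp (K * κ) * Real.exp (∑ p ∈ Q, a * primeWeight ρ p * s -
          ∑ p ∈ Q, a * primeWeight ρ p + ∑ p ∈ Q, (a * primeWeight ρ p) ^ 2) := by
        rw [hpow]; gcongr
    _ = Real.exp (K * κ - (1 - s) * a * ∑ p ∈ Q, primeWeight ρ p +
          a ^ 2 * ∑ p ∈ Q, primeWeight ρ p ^ 2) := by
        rw [← Real.exp_add]
        congr 1
        simp only [mul_pow, ← mul_sum, ← sum_mul]
        ring
    _ ≤ Real.exp (-Real.log 2) := by
        refine Real.exp_le_exp.2 ?_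
        have e3 : (1 - s) * a * (z * K - C1) ≤ (1 - s) * a * ∑ p ∈ Q, primeWeight ρ p := by
          gcongr; linarith
        have e4 : a ^ 2 * ∑ p ∈ Q, primeWeight ρ p ^ 2 ≤ a ^ 2 * C2 := by gcongr
        have e5 : K * c0 = (1 - s) * a * C1 + a ^ 2 * C2 + Real.log 2 := by
          rw [hK]; field_simp
        have e6 : K * c0 = (1 - s) * a * (z * K) - K * κ := by rw [hc0]; ring
        linarith
    _ = 1 / 2 := by rw [Real.exp_neg, Real.exp_log two_pos]; norm_num

end

end DeltaMoments

/-! ### Majorising the indicator of `E_T`. -/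

namespace DeltaMoments

noncomputable section

open Finset

lemma tau_lowPart_prod {S : Finset ℕ} (hS : ∀ p ∈ S, p.Prime) (y : ℝ) :
    tau (lowPart (∏ p ∈ S, p) y) = 2 ^ #(S ∩ primesLT y) := by
  rw [lowPart, Nat.primeFactors_prod hS]
  have h : (S.filter fun p : ℕ => (p : ℝ) < y) = S ∩ primesLT y := by
    ext p
    simp only [mem_filter, mem_inter, mem_primesLT]
    exact and_congr_right fun hp => ⟨fun h => ⟨h, hS p hp⟩, fun h => h.1⟩
  rw [h]
  exact tau_prod_primes fun p hp => hS p (mem_inter.1 hp).1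

lemma log_three_mul_scale_le {B : ℝ} (hB : 1 ≤ B) (k : ℕ) :
    Real.log (3 * scale B k) ≤ 3 * B ^ k := by
  have h1 : (1 : ℝ) ≤ B ^ k := one_le_pow₀ hB
  have h2 : Real.log 3 ≤ 2 := by
    have := Real.log_le_sub_one_of_pos (show (0 : ℝ) < 3 by norm_num); linarith
  have h3 : scale B k ≠ 0 := (Real.exp_pos _).ne'
  rw [Real.log_mul (by norm_num) h3, log_scale]
  linarith

lemma two_pow_card_le_of_mem_ET {T B : ℝ} (hT : 0 ≤ T) (hB : 1 ≤ B) {S : Finset ℕ}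
    (hS : ∀ p ∈ S, p.Prime) (h : (∏ p ∈ S, p) ∈ ET T) (k : ℕ) :
    (2 : ℝ) ^ #(S ∩ primesLT (scale B k)) ≤ 3 * T * B ^ k := by
  have h1 := h.2 (scale B k) (by linarith [two_le_scale hB k])
  rw [tau_lowPart_prod hS] at h1
  push_cast at h1
  refine h1.trans ?_
  have := mul_le_mul_of_nonneg_left (log_three_mul_scale_le hB k) hT
  linarith

/-- The majorant, on the primes below `exp (B ^ k)`, of the indicator of `E_T`. -/
def lowMajorant (N : ℕ) (κ X Y : ℝ) (S : Finset ℕ) : ℝ :=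
  if (2 : ℝ) ^ #S ≤ X then Y ^ κ * (((2 : ℝ) ^ (-κ)) ^ #S * (2 ^ N) ^ #S) else 0

lemma lowMajorant_nonneg (N : ℕ) (κ X : ℝ) {Y : ℝ} (hY : 0 ≤ Y) (S : Finset ℕ) :
    0 ≤ lowMajorant N κ X Y S := by
  unfold lowMajorant
  have := Real.rpow_nonneg hY κ
  have := Real.rpow_nonneg two_pos.le (-κ)
  split_ifs
  · positivity
  · exact le_rfl

/-- Membership in `E_T` is used at two scales: at `k` as a sharp cut-off, kept in `lowMajorant`, and
at `k'` through Rankin's trick, which damps each prime below `exp(B^{k'})` by `2^{-κ}`. The result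
splits over the primes below and above `exp(B^k)`. -/
lemma indicator_ET_mul_le {N : ℕ} (th : Fin N → ℝ) {κ T B x : ℝ} (hκ : 0 < κ) (hT : 0 ≤ T)
    (hB : 1 ≤ B) {k k' : ℕ} (hkk : k ≤ k') {S : Finset ℕ} (hS : S ⊆ primesLT x) :
    (ET T).indicator (fun _ => 1) (∏ p ∈ S, p) * ∏ p ∈ S, cosFactor th p ≤
      lowMajorant N κ (3 * T * B ^ k) (3 * T * B ^ k') (S ∩ primesLT (scale B k)) *
        ∏ p ∈ S ∩ (primesLT x \ primesLT (scale B k)),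
          (if p ∈ primesLT (scale B k') then (2 : ℝ) ^ (-κ) else 1) * cosFactor th p := by
  have hP := prime_of_subset_primesLT hS
  set s := (2 : ℝ) ^ (-κ) with hs
  have hs0 : 0 < s := Real.rpow_pos_of_pos two_pos _
  have hY : 0 ≤ 3 * T * B ^ k' := by positivity
  by_cases hE : (∏ p ∈ S, p) ∈ ET T
  · rw [Set.indicator_of_mem hE, one_mul]
    set S1 := S ∩ primesLT (scale B k)
    set R := S ∩ (primesLT x \ primesLT (scale B k))
    have hdis : Disjoint S1 R :=
        (disjoint_sdiff_primesLT _ _).mono inter_subset_right inter_subset_right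
    have hSun : S = S1 ∪ R := by
      ext p
      simp only [S1, R, mem_union, mem_inter, mem_sdiff]
      constructor
      · intro hp
        by_cases h : p ∈ primesLT (scale B k)
        · exact Or.inl ⟨hp, h⟩
        · exact Or.inr ⟨hp, hS hp, h⟩
      · rintro (h | h) <;> exact h.1
    have hk := two_pow_card_le_of_mem_ET hT hB hP hE k
    have hk' := two_pow_card_le_of_mem_ET hT hB hP hE k'
    set R2 := R.filter fun p => p ∈ primesLT (scale B k') with hR2
    have hcard : #(S ∩ primesLT (scale B k')) = #S1 + #R2 := by
      rw [← card_union_of_disjoint (hdis.mono_right (filter_subset _ _))]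
      congr 1
      ext p
      simp only [S1, R, mem_union, mem_inter, mem_sdiff, mem_filter]
      constructor
      · rintro ⟨h1, h2⟩
        by_cases h : p ∈ primesLT (scale B k)
        · exact Or.inl ⟨h1, h⟩
        · exact Or.inr ⟨⟨h1, hS h1, h⟩, h2⟩
      · rintro (⟨h1, h2⟩ | ⟨⟨h1, _⟩, h2⟩)
        · exact ⟨h1, primesLT_mono (scale_mono hB hkk) h2⟩
        · exact ⟨h1, h2⟩
    have hone : 1 ≤ (3 * T * B ^ k') ^ κ * (s ^ #S1 * s ^ #R2) := by
      rw [hcard] at hk'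
      have h1 := Real.rpow_le_rpow (by positivity) hk' hκ.le
      have h2 : ((2 : ℝ) ^ (#S1 + #R2)) ^ κ * s ^ (#S1 + #R2) = 1 := by
        rw [← Real.rpow_pow_comm two_pos.le, ← mul_pow, hs, ← Real.rpow_add two_pos]
        simp
      rw [← pow_add, ← h2]
      gcongr
    rw [prod_mul_distrib, ← prod_filter, ← hR2, prod_const, lowMajorant, if_pos hk, hSun,
      prod_union hdis, ← hs]
    have h1 : ∏ p ∈ S1, cosFactor th p ≤ (2 ^ N) ^ #S1 := by
      rw [← prod_const]
      exact prod_le_prod (fun p _ => cosFactor_nonneg th p) fun p _ => cosFactor_le th p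
    have h2 : 0 ≤ ∏ p ∈ R, cosFactor th p := prod_nonneg fun p _ => cosFactor_nonneg th p
    calc (∏ p ∈ S1, cosFactor th p) * ∏ p ∈ R, cosFactor th p
        ≤ (2 ^ N) ^ #S1 * ∏ p ∈ R, cosFactor th p := by gcongr
      _ ≤ ((3 * T * B ^ k') ^ κ * (s ^ #S1 * s ^ #R2)) *
          ((2 ^ N) ^ #S1 * ∏ p ∈ R, cosFactor th p) :=
          le_mul_of_one_le_left (by positivity) hone
      _ = _ := by ring
  · rw [Set.indicator_of_notMem hE, zero_mul]
    refine mul_nonneg (lowMajorant_nonneg _ _ _ hY _) (prod_nonneg fun p _ => ?_)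
    refine mul_nonneg ?_ (cosFactor_nonneg th p)
    split_ifs <;> linarith

/-- With `q = 2^{#S}` at most `X = TB^k`, one writes `2^{(t+1)#S} 2^{-κ#S} = 2^{t#S} q^{1-κ}`, so
one factor `2` per prime is traded for `X^{1-κ}` times a power of `q/X`. -/
lemma lowMajorant_le (t : ℕ) {κ T B : ℝ} (hκ2 : κ ≤ 1 / 2) (hκ0 : 0 < κ) (hT : 0 < T)
    (hB : 0 < B) (k : ℕ) {Y : ℝ} (hY : 0 ≤ Y) (S : Finset ℕ) :
    lowMajorant (t + 1) κ (T * B ^ k) Y S ≤ 4 * (Y ^ κ * (T * B ^ k) ^ (1 - κ)) *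
      ((∏ _p ∈ S, (2 : ℝ) ^ t) * (excess κ B T k S / (1 + excess κ B T k S) ^ 2)) := by
  have hw0 := excess_nonneg (κ := κ) hB hT k S
  have hX : 0 < T * B ^ k := by positivity
  have hYκ := Real.rpow_nonneg hY κ
  have hXκ := Real.rpow_pos_of_pos hX (1 - κ)
  rw [prod_const]
  unfold lowMajorant
  split_ifs with h
  · set q := (2 : ℝ) ^ #S with hq
    have hq0 : 0 < q := by positivity
    have hqX : q / (T * B ^ k) ≤ 1 := by rw [div_le_one hX]; exact h
    have hqX0 : 0 < q / (T * B ^ k) := by positivity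
    have hw1 : excess κ B T k S ≤ 1 := Real.rpow_le_one hqX0.le hqX hκ0.le
    have h1 : ((2 : ℝ) ^ (-κ)) ^ #S * (2 ^ (t + 1)) ^ #S = (2 ^ t) ^ #S * q ^ (1 - κ) := by
      rw [hq, ← Real.rpow_pow_comm two_pos.le, ← mul_pow, ← mul_pow]
      congr 1
      rw [sub_eq_add_neg, Real.rpow_add two_pos, Real.rpow_one, pow_succ]
      ring
    have h2 : q ^ (1 - κ) = (T * B ^ k) ^ (1 - κ) * (q / (T * B ^ k)) ^ (1 - κ) := by
      rw [← Real.mul_rpow hX.le hqX0.le]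
      congr 1
      field_simp
    -- This is where `κ ≤ 1/2` enters: `1 - κ ≥ κ` and the base is at most `1`.
    have h3 : (q / (T * B ^ k)) ^ (1 - κ) ≤ excess κ B T k S :=
      Real.rpow_le_rpow_of_exponent_ge hqX0 hqX (by linarith)
    have h4 : excess κ B T k S ≤ 4 * (excess κ B T k S / (1 + excess κ B T k S) ^ 2) := by
      generalize excess κ B T k S = w at *
      rw [mul_div_assoc', le_div_iff₀ (by positivity)]
      nlinarith [mul_nonneg hw0 (by nlinarith : 0 ≤ 4 - (1 + w) ^ 2)]
    rw [h1, h2]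
    calc Y ^ κ * ((2 ^ t) ^ #S * ((T * B ^ k) ^ (1 - κ) * (q / (T * B ^ k)) ^ (1 - κ)))
        ≤ Y ^ κ * ((2 ^ t) ^ #S * ((T * B ^ k) ^ (1 - κ) *
          (4 * (excess κ B T k S / (1 + excess κ B T k S) ^ 2)))) := by
          gcongr; exact h3.trans h4
      _ = _ := by ring
  · positivity

lemma rpow_mul_rpow_eq {κ T B : ℝ} (hT : 0 < T) (hB : 0 < B) (k k' : ℕ) :
    (T * B ^ k') ^ κ * (T * B ^ k) ^ (1 - κ) =
      T * Real.exp (Real.log B * (κ * k' + (1 - κ) * k)) := by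
  have h : ∀ j : ℕ, T * B ^ j = Real.exp (Real.log T + j * Real.log B) := fun j => by
    rw [Real.exp_add, Real.exp_log hT, ← Real.log_pow, Real.exp_log (by positivity)]
  rw [h, h, ← Real.exp_mul, ← Real.exp_mul, ← Real.exp_add]
  nth_rewrite 3 [← Real.exp_log hT]
  rw [← Real.exp_add]
  congr 1; ring

/-- Passing from the weights `ρ(p)/p` to `2^t ρ(p)/p` below `exp(B^k)` costs a ratio of Euler
products, of size at most a constant times `B^{zk(2^t-1)}`. -/
lemma exists_meanOn_lowMajorant_le {z : ℝ} {ρ : ArithmeticFunction ℝ} (hρ : IsClassM z ρ) (t : ℕ) :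
    ∃ C : ℝ, 0 < C ∧ ∀ (κ T B : ℝ) (k k' : ℕ), 0 < κ → κ ≤ 1 / 2 → 0 < T → 1 < B →
      meanOn ρ (primesLT (scale B k)) (lowMajorant (t + 1) κ (T * B ^ k) (T * B ^ k')) ≤
        C * T * greenTerm (fun p => 2 ^ t * primeWeight ρ p) κ B T k *
          Real.exp (Real.log B * (κ * k' + (1 - κ) * k + z * k * (2 ^ t - 1))) := by
  obtain ⟨C1, hC1, h1⟩ := hρ.exists_abs_sum_le
  obtain ⟨C2, hC2, h2⟩ := hρ.exists_sum_sq_le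
  have hv := hρ.primeWeight_nonneg
  refine ⟨4 * Real.exp ((2 ^ t - 1) * C1 + C2), by positivity,
    fun κ T B k k' hκ0 hκ2 hT hB => ?_⟩
  have hB0 : 0 < B := by linarith
  set P := primesLT (scale B k)
  set v' : ℕ → ℝ := fun p => 2 ^ t * primeWeight ρ p with hv'
  have hv'0 : ∀ p, 0 ≤ v' p := fun p => mul_nonneg (by positivity) (hv p)
  have hq0 := greenTerm_nonneg hv'0 (κ := κ) hB0 hT k
  have hZ : 0 < ∏ p ∈ P, (1 + primeWeight ρ p) := prod_pos fun p _ => by linarith [hv p]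
  have hZ' : 0 < ∏ p ∈ P, (1 + v' p) := prod_pos fun p _ => by linarith [hv'0 p]
  have hY : 0 ≤ T * B ^ k' := by positivity
  have e1 : meanOn ρ P (lowMajorant (t + 1) κ (T * B ^ k) (T * B ^ k')) ≤
      4 * ((T * B ^ k') ^ κ * (T * B ^ k) ^ (1 - κ)) *
        (greenTerm v' κ B T k *
          ((∏ p ∈ P, (1 + v' p)) / ∏ p ∈ P, (1 + primeWeight ρ p))) := by
    refine (meanOn_mono hρ fun S _ => lowMajorant_le t hκ2 hκ0 hT hB0 k hY S).trans (le_of_eq ?_)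
    rw [meanOn_const_mul, meanOn, subsetSum_prod_mul (primeWeight ρ) (fun _ => (2 : ℝ) ^ t)]
    congr 1
    have hg : greenTerm v' κ B T k = subsetSum v' P
        (fun S => excess κ B T k S / (1 + excess κ B T k S) ^ 2) / ∏ p ∈ P, (1 + v' p) := rfl
    rw [hg, div_mul_div_cancel₀ hZ'.ne']
  have e2 : (∏ p ∈ P, (1 + v' p)) / ∏ p ∈ P, (1 + primeWeight ρ p) ≤
      Real.exp ((2 ^ t - 1) * C1 + C2) * Real.exp (Real.log B * (z * k * (2 ^ t - 1))) := by
    have hb := prod_one_add_le_exp (P := P) (v := primeWeight ρ) (h := fun _ => 2 ^ t)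
      (fun p _ => hv p) fun _ _ => by positivity
    simp only [mul_comm (primeWeight ρ _)] at hb
    refine hb.trans ?_
    rw [← Real.exp_add]
    refine Real.exp_le_exp.2 ?_
    have i1 := (abs_le.1 (h1 _ (two_le_scale hB.le k))).2
    have i2 := h2 P fun p hp => (mem_primesLT.1 hp).2
    rw [log_scale, Real.log_pow] at i1
    have i3 : (0 : ℝ) ≤ 2 ^ t - 1 := sub_nonneg.2 (one_le_pow₀ one_le_two)
    have i4 := mul_le_mul_of_nonneg_left i1 i3
    rw [← mul_sum]
    have : ∑ p ∈ primesLT (scale B k), primeWeight ρ p = ∑ p ∈ P, primeWeight ρ p := rfl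
    rw [this] at i4
    linarith
  rw [rpow_mul_rpow_eq hT hB0] at e1
  calc _ ≤ _ := e1
    _ ≤ 4 * (T * Real.exp (Real.log B * (κ * k' + (1 - κ) * k))) * (greenTerm v' κ B T k *
        (Real.exp ((2 ^ t - 1) * C1 + C2) * Real.exp (Real.log B * (z * k * (2 ^ t - 1))))) := by
        gcongr
    _ = _ := by
        rw [mul_add (Real.log B) (κ * k' + (1 - κ) * k), Real.exp_add (Real.log B * (κ * k' +
            (1 - κ) * k))]
        ring

/-- Expectations of products of cosines over `E_T`. -/
theorem exists_meanOn_ET_le {z : ℝ} (hz : 0 < z) {ρ : ArithmeticFunction ℝ} (hρ : IsClassM z ρ)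
    (t : ℕ) {κ B : ℝ} (hκ0 : 0 < κ) (hκ2 : κ ≤ 1 / 2) (hB : 1 < B) :
    ∃ C : ℝ, 0 < C ∧ ∀ (T x : ℝ) (M k k' : ℕ) (th : Fin (t + 1) → ℝ), 0 < T → k ≤ k' → k' ≤ M →
      scale B M ≤ x → x ≤ scale B (M + 1) → th ∈ Set.Icc 0 1 →
      (∀ i ∈ Ico k k', lowRank th (B ^ i)⁻¹ ≤ t) →
      meanOn ρ (primesLT x) (fun S =>
        (ET T).indicator (fun _ => 1) (∏ p ∈ S, p) * ∏ p ∈ S, cosFactor th p) ≤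
      C * T * greenTerm (fun p => 2 ^ t * primeWeight ρ p) κ B (3 * T) k *
        Real.exp (Real.log B * (κ * k' + (1 - κ) * k + z * k * (2 ^ t - 1) +
          z * (k' - k) * (2 ^ t * (2 : ℝ) ^ (-κ) - 1) +
          z * ∑ i ∈ Ico k' M, ((2 : ℝ) ^ lowRank th (B ^ i)⁻¹ - 1))) := by
  obtain ⟨C1, hC1, h1⟩ := exists_meanOn_lowMajorant_le hρ t
  obtain ⟨C2, hC2, h2⟩ := exists_prod_tail_le hz hρ (t + 1) hB
  obtain ⟨C3, hC3, h3⟩ := exists_sum_block_cosFactor_le hz hρ (t + 1)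
  obtain ⟨C4, hC4, h4⟩ := hρ.exists_abs_sum_block_le
  obtain ⟨C5, hC5, h5⟩ := hρ.exists_sum_sq_le
  have hv := hρ.primeWeight_nonneg
  have hK := Real.log_pos hB
  have hB0 : 0 < B := by linarith
  refine ⟨C1 * 3 * (Real.exp (C3 + C4 + C5) * C2), by positivity,
    fun T x M k k' th hT hkk hkM hMx hxM hth hr => ?_⟩
  set s := (2 : ℝ) ^ (-κ) with hs
  have hs0 : 0 < s := Real.rpow_pos_of_pos two_pos _
  have hs1 : s < 1 := Real.rpow_lt_one_of_one_lt_of_neg one_lt_two (by linarith)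
  set P1 := primesLT (scale B k) with hP1
  set R := primesLT x \ P1 with hR
  set P2 := primeBlock B k k' with hP2
  set P3 := primesLT x \ primesLT (scale B k') with hP3
  have hk'x : scale B k' ≤ x := (scale_mono hB.le hkM).trans hMx
  have hkx : scale B k ≤ x := (scale_mono hB.le hkk).trans hk'x
  have hR23 : R = P2 ∪ P3 := by
    ext p
    have m1 := @primesLT_mono _ _ (scale_mono hB.le hkk) p
    have m2 := @primesLT_mono _ _ hk'x p
    simp only [hR, hP1, hP2, hP3, primeBlock, mem_sdiff, mem_union]
    tauto
  have hdis : Disjoint P2 P3 := by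
    rw [disjoint_left]
    intro p h2 h3
    exact (mem_sdiff.1 h3).2 (mem_sdiff.1 h2).1
  set gt : ℕ → ℝ := fun p =>
    (if p ∈ primesLT (scale B k') then s else 1) * cosFactor th p with hgt
  have hgt0 : ∀ p, 0 ≤ gt p := fun p =>
    mul_nonneg (by split_ifs <;> linarith) (cosFactor_nonneg th p)
  have hPun : primesLT x = P1 ∪ R := (union_sdiff_of_subset (primesLT_mono hkx)).symm
  have hZ : ∀ P : Finset ℕ, 0 < ∏ p ∈ P, (1 + primeWeight ρ p) := fun P =>
    prod_pos fun p _ => by linarith [hv p]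
  have hstep : meanOn ρ (primesLT x) (fun S =>
        (ET T).indicator (fun _ => 1) (∏ p ∈ S, p) * ∏ p ∈ S, cosFactor th p) ≤
      meanOn ρ P1 (lowMajorant (t + 1) κ (3 * T * B ^ k) (3 * T * B ^ k')) *
        ((∏ p ∈ R, (1 + primeWeight ρ p * gt p)) / ∏ p ∈ R, (1 + primeWeight ρ p)) := by
    refine (meanOn_mono hρ fun S hS => indicator_ET_mul_le th hκ0 hT.le hB.le hkk hS).trans
      (le_of_eq ?_)
    rw [meanOn, hPun, prod_union (disjoint_sdiff_primesLT _ _), meanOn, ← subsetSum_prod,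
      div_mul_div_comm, ← subsetSum_union_mul _ (disjoint_sdiff_primesLT _ _), ← hPun]
  -- Between the scales `k` and `k'` the rank is at most `t` and the Rankin factor `s` is active;
  -- beyond `k'` the plain bound of `exists_prod_tail_le` applies.
  have hmid : (∏ p ∈ P2, (1 + primeWeight ρ p * gt p)) / ∏ p ∈ P2, (1 + primeWeight ρ p) ≤
      Real.exp (C3 + C4 + C5) * Real.exp (Real.log B * (z * (k' - k) * (2 ^ t * s - 1))) := by
    refine (prod_one_add_le_exp (fun p _ => hv p) fun p _ => hgt0 p).trans ?_
    rw [← Real.exp_add]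
    refine Real.exp_le_exp.2 ?_
    have i3 := h3 B k k' th hB hkk hth
    have i4 := (abs_le.1 (h4 B k k' hB hkk)).1
    have i5 := h5 P2 fun p hp => prime_of_mem_sdiff hp
    have i6 : ∑ p ∈ P2, primeWeight ρ p * gt p =
        s * ∑ p ∈ P2, primeWeight ρ p * cosFactor th p := by
      rw [mul_sum]
      refine sum_congr rfl fun p hp => ?_
      simp only [hgt, if_pos (mem_sdiff.1 hp).1]
      ring
    have i7 : ∑ i ∈ Ico k k', (2 : ℝ) ^ lowRank th (B ^ i)⁻¹ ≤ (k' - k) * 2 ^ t := by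
      calc _ ≤ ∑ i ∈ Ico k k', (2 : ℝ) ^ t :=
            sum_le_sum fun i hi => pow_le_pow_right₀ one_le_two (hr i hi)
        _ = _ := by rw [sum_const, Nat.card_Ico, nsmul_eq_mul, Nat.cast_sub hkk]
    have hzK : 0 ≤ z * Real.log B := by positivity
    have i8 : s * ∑ p ∈ P2, primeWeight ρ p * cosFactor th p ≤
        s * (z * Real.log B * ((k' - k) * 2 ^ t)) + C3 := by
      calc _ ≤ s * (z * Real.log B * ((k' - k) * 2 ^ t) + C3) := by
            gcongr
            refine i3.trans ?_
            gcongr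
        _ ≤ _ := by nlinarith
    rw [i6]
    linarith
  have htail : (∏ p ∈ P3, (1 + primeWeight ρ p * gt p)) / ∏ p ∈ P3, (1 + primeWeight ρ p) ≤
      C2 * Real.exp (z * Real.log B * ∑ i ∈ Ico k' M, ((2 : ℝ) ^ lowRank th (B ^ i)⁻¹ - 1)) := by
    have : ∏ p ∈ P3, (1 + primeWeight ρ p * gt p) =
        ∏ p ∈ P3, (1 + primeWeight ρ p * cosFactor th p) :=
      prod_congr rfl fun p hp => by simp only [hgt, if_neg (mem_sdiff.1 hp).2, one_mul]
    rw [this]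
    exact h2 k' M x th hkM hMx hxM hth
  have hlow := h1 κ (3 * T) B k k' hκ0 hκ2 (by positivity) hB
  have hnn : ∀ P : Finset ℕ, 0 ≤ (∏ p ∈ P, (1 + primeWeight ρ p * gt p)) /
      ∏ p ∈ P, (1 + primeWeight ρ p) := fun P =>
    div_nonneg (prod_nonneg fun p _ => by have := mul_nonneg (hv p) (hgt0 p); linarith) (hZ P).le
  have hq0 := greenTerm_nonneg (v := fun p => 2 ^ t * primeWeight ρ p)
    (fun p => mul_nonneg (by positivity) (hv p)) (κ := κ) hB0 (by positivity : 0 < 3 * T) k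
  refine hstep.trans ?_
  rw [hR23, prod_union hdis, prod_union hdis, mul_div_mul_comm]
  refine (mul_le_mul hlow (mul_le_mul hmid htail (hnn P3) (by positivity))
        (mul_nonneg (hnn P2) (hnn P3)) (by positivity)).trans (le_of_eq ?_)
  set q1 := κ * k' + (1 - κ) * k + z * k * (2 ^ t - 1)
  set q2 := z * (k' - k) * (2 ^ t * s - 1)
  set q3 := ∑ i ∈ Ico k' M, ((2 : ℝ) ^ lowRank th (B ^ i)⁻¹ - 1)
  have e : Real.exp (Real.log B * (q1 + q2 + z * q3)) =
      Real.exp (Real.log B * q1) * Real.exp (Real.log B * q2) *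
        Real.exp (z * Real.log B * q3) := by
    rw [← Real.exp_add, ← Real.exp_add]
    congr 1
    ring
  rw [e]
  ring

end

end DeltaMoments

/-! ### The moment of order `t + 1` over `E_T`. -/

namespace DeltaMoments

noncomputable section

open Finset MeasureTheory

/-- The coordinate `jl` has no exponential decay; the bounded partial sums of `q` take its place.
The coordinate `j0` is eliminated by the fixed total. -/
lemma sum_piAntidiag_mul_prod_exp_le {n : ℕ} {jl j0 : Fin n} (hne : jl ≠ j0) {q : ℕ → ℝ}
    (hq : ∀ i, 0 ≤ q i) {Q : ℝ} (hQ : ∀ m, ∑ i ∈ range m, q i ≤ Q) {d : Fin n → ℝ}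
    (hdl : d jl = 0) (hd0 : 0 ≤ d j0) (hd : ∀ j, j ≠ j0 → j ≠ jl → 0 < d j) (M : ℕ) :
    ∑ g ∈ piAntidiag (univ : Finset (Fin n)) M, q (g jl) * ∏ j, Real.exp (-(d j * g j)) ≤
      Q * ∏ j ∈ (univ.erase j0).erase jl, (1 - Real.exp (-d j))⁻¹ := by
  set f : Fin n → ℕ → ℝ := fun j i => (if j = jl then q i else 1) * Real.exp (-(d j * i)) with hf
  have hf0 : ∀ j i, 0 ≤ f j i := fun j i =>
    mul_nonneg (by split_ifs; exacts [hq i, zero_le_one]) (Real.exp_pos _).le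
  have hmem : jl ∈ univ.erase j0 := mem_erase.2 ⟨hne, mem_univ _⟩
  have hprod : ∀ g : Fin n → ℕ, q (g jl) * ∏ j, Real.exp (-(d j * g j)) = ∏ j, f j (g j) := by
    intro g
    simp only [hf, prod_mul_distrib]
    rw [prod_ite_eq' univ jl fun j => q (g j), if_pos (mem_univ _)]
  calc _ ≤ ∑ g ∈ piAntidiag (univ : Finset (Fin n)) M, ∏ j ∈ univ.erase j0, f j (g j) := by
        refine sum_le_sum fun g _ => ?_
        rw [hprod, ← mul_prod_erase univ _ (mem_univ j0)]
        refine mul_le_of_le_one_left (prod_nonneg fun j _ => hf0 _ _) ?_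
        simp only [hf, if_neg hne.symm, one_mul]
        exact Real.exp_le_one_iff.2 (neg_nonpos.2 (by positivity))
    _ ≤ ∏ j ∈ univ.erase j0, ∑ i ∈ range (M + 1), f j i := sum_piAntidiag_prod_le j0 f hf0 M
    _ ≤ _ := by
        rw [← mul_prod_erase _ _ hmem]
        refine mul_le_mul ?_ (prod_le_prod (fun j _ => sum_nonneg fun i _ => hf0 _ _)
          fun j hj => ?_) (prod_nonneg fun j _ => sum_nonneg fun i _ => hf0 _ _)
          (by simpa using hQ 0)
        · refine le_trans (le_of_eq ?_) (hQ (M + 1))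
          refine sum_congr rfl fun i _ => ?_
          simp [hf, hdl]
        · rw [mem_erase, mem_erase] at hj
          refine le_trans (le_of_eq ?_) (sum_exp_neg_le (hd j hj.2.1 hj.1) (M + 1))
          refine sum_congr rfl fun i _ => ?_
          simp [hf, hj.1]

lemma occ_last_eq_card {t : ℕ} (B : ℝ) (M : ℕ) (th : Fin (t + 1) → ℝ) :
    occ B M th (Fin.last (t + 1)) = #{i ∈ range M | t + 1 ≤ lowRank th (B ^ i)⁻¹} := by
  rw [card_filter_le_lowRank, sum_filter, Fin.sum_univ_castSucc]
  simp [Nat.not_le.2 (Fin.is_lt _)]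

lemma occ_last_add_eq_card {t : ℕ} (B : ℝ) (M : ℕ) (th : Fin (t + 1) → ℝ) :
    occ B M th (Fin.last (t + 1)) + occ B M th (Fin.last t).castSucc =
      #{i ∈ range M | t ≤ lowRank th (B ^ i)⁻¹} := by
  rw [card_filter_le_lowRank, sum_filter, Fin.sum_univ_castSucc, Fin.sum_univ_castSucc]
  simp [Nat.not_le.2 (Fin.is_lt _), add_comm]

/-- Ranks decrease along the scales: those of rank `t + 1` come first, and the next `occ` many have
rank `t`. -/
lemma lowRank_le_of_mem_Ico {t : ℕ} {B : ℝ} (hB : 1 ≤ B) {M : ℕ} (th : Fin (t + 1) → ℝ) {i : ℕ}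
    (hi : i ∈ Ico (occ B M th (Fin.last (t + 1)))
      (occ B M th (Fin.last (t + 1)) + occ B M th (Fin.last t).castSucc)) :
    lowRank th (B ^ i)⁻¹ ≤ t := by
  rw [mem_Ico, occ_last_add_eq_card, occ_last_eq_card,
    lt_card_filter_iff (antitone_lowRank hB th), ← not_lt,
    lt_card_filter_iff (antitone_lowRank hB th)] at hi
  have := hi.1
  have := hi.2.1
  omega

lemma sum_Ico_lowRank_eq {t : ℕ} {B : ℝ} (hB : 1 ≤ B) {M : ℕ} (th : Fin (t + 1) → ℝ)
    (f : ℕ → ℝ) :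
    ∑ i ∈ Ico (occ B M th (Fin.last (t + 1)) + occ B M th (Fin.last t).castSucc) M,
      f (lowRank th (B ^ i)⁻¹) = ∑ j : Fin t, occ B M th j.castSucc.castSucc * f j := by
  have h := sum_lowRank_eq_sum_occ B M th (fun r => if r < t then f r else 0)
  rw [Fin.sum_univ_castSucc, Fin.sum_univ_castSucc] at h
  simp only [Fin.val_castSucc, Fin.is_lt, if_true, Fin.val_last, lt_irrefl, if_false, mul_zero,
    add_zero, Nat.not_lt.2 (Nat.le_succ t)] at h
  rw [← h, ← sum_filter]
  refine sum_congr ?_ fun _ _ => rfl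
  ext i
  have := lt_card_filter_iff (antitone_lowRank hB th) M t i
  rw [mem_Ico, occ_last_add_eq_card, mem_filter, mem_range, ← not_lt, this]
  grind

/-- Positivity of the drift. From `z(2^t - 1) ≥ t` it follows that `2^t z > t`, enough for `t ≥ 2`;
for `t = 1` one has `z ≥ 1` and `2 log 2 > 1`. -/
lemma one_lt_two_pow_mul_log_two {z : ℝ} {t : ℕ} (ht : 1 ≤ t) (h : 0 ≤ momentExp z t) :
    1 < 2 ^ t * z * Real.log 2 := by
  have hp := two_pow_sub_one_pos ht
  have hl := Real.log_two_gt_d9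
  have ht1 : (1 : ℝ) ≤ t := by exact_mod_cast ht
  unfold momentExp at h
  have hz : 0 < z := by
    by_contra hz
    push Not at hz
    nlinarith
  rcases eq_or_lt_of_le ht with rfl | h2
  · norm_num at h ⊢
    nlinarith
  · have ht2 : (2 : ℝ) ≤ t := by exact_mod_cast h2
    nlinarith

/-- The cut is made at `k = g_{t+1}` and `k' = g_{t+1} + g_t`. After `E_T` has been used, rank `t +
1` has the same net exponent as the main term, so its sum over `k` rests on the summability of
`greenTerm`; no loss in `log log x` occurs. -/
theorem exists_moment_ET_le {z : ℝ} (hz : 0 < z) {ρ : ArithmeticFunction ℝ} (hρ : IsClassM z ρ)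
    {t : ℕ} (ht : 1 ≤ t) (hzt : zt t ≤ z) : ∃ C : ℝ, 0 < C ∧ ∀ T x : ℝ, 0 < T → 3 ≤ x →
      expect ρ x ((ET T).indicator fun n => M 2 n ^ (t + 1) / (tau n : ℝ) ^ (t + 1)) ≤
        C * (T * Real.log x ^ (beta t z - z)) := by
  rw [zt_le_iff ht] at hzt
  obtain ⟨κ, hκ0, hκ2, hκ⟩ := exists_kappa (one_lt_two_pow_mul_log_two ht hzt)
  obtain ⟨B, hB, hdrift⟩ := exists_base hρ (a := 2 ^ t) (by positivity) hκ0 hκ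
  have hK := Real.log_pos hB
  have hB0 : 0 < B := by linarith
  set K := Real.log B with hKdef
  obtain ⟨C1, hC1, h1⟩ := exists_meanOn_ET_le hz hρ t hκ0 hκ2 hB
  obtain ⟨C2, hC2, h2⟩ := exists_integral_cube_le (t + 1)
  have hv := hρ.primeWeight_nonneg
  have hv' : ∀ p, 0 ≤ 2 ^ t * primeWeight ρ p := fun p => mul_nonneg (by positivity) (hv p)
  set h := momentExp z t with hh
  set s := (2 : ℝ) ^ (-κ) with hs
  set c0 := 2 ^ t * z * (1 - s) - κ with hc0
  have hc0pos : 0 < c0 := sub_pos.2 hκ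
  -- Net exponents per scale, volume included. For rank `t + 1`: `κ + (1 - κ) + z(2^t - 1) - (t + 1)
  -- = h`. For rank `t`: `κ + z(2^t s - 1) - t = h - c0`. Lower ranks keep `momentExp`.
  set a : Fin (t + 2) → ℝ := fun j =>
    if j.1 = t + 1 then h else if j.1 = t then h - c0 else momentExp z j with ha
  set d : Fin (t + 2) → ℝ := fun j => K * (h - a j) with hd
  set jl := Fin.last (t + 1) with hjl
  have hdl : d jl = 0 := by simp [hd, ha, hjl]
  have hne : jl ≠ 0 := fun e => by simpa [hjl] using congrArg Fin.val e
  have hd0 : 0 ≤ d 0 := by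
    have : ¬ 0 = t := by omega
    simp only [hd, ha, Fin.val_zero, if_neg this, momentExp_zero]
    rw [if_neg (by omega)]
    positivity
  have hdpos : ∀ j : Fin (t + 2), j ≠ 0 → j ≠ jl → 0 < d j := by
    intro j hj0 hj
    have hj1 : j.1 ≠ t + 1 := fun e => hj (Fin.ext e)
    simp only [hd, ha, if_neg hj1]
    refine mul_pos hK ?_
    split_ifs with hjt
    · linarith
    · have hpos : 0 < j.1 := Nat.pos_of_ne_zero fun e => hj0 (Fin.ext e)
      exact sub_pos.2 (momentExp_lt hpos (by have := j.2; omega) hzt)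
  set Cd := ∏ j ∈ (univ.erase 0).erase jl, (1 - Real.exp (-d j))⁻¹ with hCd
  have hCd0 : 0 < Cd := by
    refine prod_pos fun j hj => ?_
    rw [mem_erase, mem_erase] at hj
    have := Real.exp_lt_one_iff.2 (neg_neg_of_pos (hdpos j hj.2.1 hj.1))
    exact inv_pos.2 (sub_pos.2 this)
  refine ⟨(5 / 2) ^ (t + 1) * (C2 * B ^ (t + 1) * (C1 * (2 * Cd))), by positivity,
    fun T x hT hx => ?_⟩
  obtain ⟨M, hMx, hxM, hML, -⟩ := exists_scale_le hB hx
  set q : ℕ → ℝ := greenTerm (fun p => 2 ^ t * primeWeight ρ p) κ B (3 * T) with hq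
  have hT3 : 0 < 3 * T := by positivity
  have hq0 : ∀ i, 0 ≤ q i := fun i => greenTerm_nonneg hv' hB0 hT3 i
  -- The bound is independent of `T`; only the explicit factor `T` remains.
  have hqsum : ∀ m, ∑ i ∈ range m, q i ≤ 2 := sum_greenTerm_le hv' hB hT3 hdrift
  set jt : Fin (t + 2) := (Fin.last t).castSucc with hjt
  refine (expect_indicator_le hρ (t + 1) x (ET T)).trans ?_
  have hcube := h2 B M
    (fun g => C1 * T * q (g jl) * Real.exp (K * (κ * (g jl + g jt : ℕ) + (1 - κ) * g jl +
      z * g jl * (2 ^ t - 1) + z * ((g jl + g jt : ℕ) - g jl) * (2 ^ t * s - 1) +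
      z * ∑ j : Fin t, g j.castSucc.castSucc * ((2 : ℝ) ^ (j : ℕ) - 1))))
    (fun th => meanOn ρ (primesLT x) (fun S =>
      (ET T).indicator (fun _ => 1) (∏ p ∈ S, p) * ∏ p ∈ S, cosFactor th p)) hB.le
    (fun g => by have := hq0 (g jl); positivity)
    (continuous_meanOn ρ _ (fun S (th : Fin (t + 1) → ℝ) =>
      (ET T).indicator (fun _ => 1) (∏ p ∈ S, p) * ∏ p ∈ S, cosFactor th p)
      fun S => continuous_const.mul (continuous_prod_cosFactor S))
    (fun th hth => by
      have hkM : occ B M th jl + occ B M th jt ≤ M := by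
        rw [occ_last_add_eq_card]
        exact (card_filter_le _ _).trans_eq (card_range M)
      have := h1 T x M _ _ th hT (Nat.le_add_right (occ B M th jl) (occ B M th jt)) hkM hMx hxM hth
        fun i hi => lowRank_le_of_mem_Ico hB.le th hi
      rwa [sum_Ico_lowRank_eq hB.le th fun r => (2 : ℝ) ^ r - 1] at this)
  have hsum : ∑ g ∈ piAntidiag univ M, C1 * T * q (g jl) *
      Real.exp (K * (κ * (g jl + g jt : ℕ) + (1 - κ) * g jl +
        z * g jl * (2 ^ t - 1) + z * ((g jl + g jt : ℕ) - g jl) * (2 ^ t * s - 1) +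
        z * ∑ j : Fin t, g j.castSucc.castSucc * ((2 : ℝ) ^ (j : ℕ) - 1))) *
          (B ^ ∑ l : Fin (t + 1 + 1), (l : ℕ) * g l)⁻¹ =
      C1 * T * (Real.exp (K * h * M) *
        ∑ g ∈ piAntidiag univ M, q (g jl) * ∏ j, Real.exp (-(d j * g j))) := by
    rw [mul_sum, mul_sum]
    refine sum_congr rfl fun g hg => ?_
    have e1 : (B ^ ∑ l : Fin (t + 1 + 1), (l : ℕ) * g l)⁻¹ =
        Real.exp (-(K * ∑ l : Fin (t + 1 + 1), (l : ℝ) * g l)) := by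
      rw [Real.exp_neg, ← Real.exp_log (pow_pos hB0 _), Real.log_pow]
      push_cast
      rw [mul_comm]
    have e2 := exp_sum_momentExp (K := K) (h := h) a hg
    have e3 : ∑ j, a j * g j = h * g jl + (h - c0) * g jt +
        ∑ j : Fin t, momentExp z j * g j.castSucc.castSucc := by
      have ej : ∀ j : Fin t, a j.castSucc.castSucc = momentExp z j := fun j => by
        have := j.2
        simp only [ha, Fin.val_castSucc]
        rw [if_neg (by omega), if_neg (by omega)]
      rw [Fin.sum_univ_castSucc, Fin.sum_univ_castSucc]
      simp only [ej]
      simp only [ha, hjl, hjt, Fin.val_castSucc, Fin.val_last, if_true]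
      rw [if_neg (by omega)]
      ring
    rw [e1, mul_assoc, ← Real.exp_add, mul_assoc, mul_left_comm (Real.exp _), ← e2, e3]
    congr 3
    rw [Fin.sum_univ_castSucc, Fin.sum_univ_castSucc]
    have e4 : ∑ j : Fin t, momentExp z j * g j.castSucc.castSucc =
        z * ∑ j : Fin t, g j.castSucc.castSucc * ((2 : ℝ) ^ (j : ℕ) - 1) -
          ∑ j : Fin t, (j : ℝ) * g j.castSucc.castSucc := by
      rw [mul_sum, ← sum_sub_distrib]
      exact sum_congr rfl fun j _ => by rw [momentExp]; ring
    rw [e4, hc0, hh, momentExp]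
    simp only [Fin.val_castSucc, Fin.val_last]
    push_cast
    ring
  rw [hsum] at hcube
  have hmain := sum_piAntidiag_mul_prod_exp_le hne hq0 hqsum hdl hd0 hdpos M
  have hexp := exp_log_mul_le hB hML hzt
  rw [beta_sub_eq, ← hh]
  have hL : 0 ≤ Real.log x ^ h := Real.rpow_nonneg (Real.log_nonneg (by linarith)) _
  rw [mul_assoc]
  refine mul_le_mul_of_nonneg_left ?_ (by positivity)
  refine hcube.trans ?_
  calc _ ≤ C2 * B ^ (t + 1) * (C1 * T * (Real.log x ^ h * (2 * Cd))) := by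
        gcongr
        exact sum_nonneg fun g _ => mul_nonneg (hq0 _) (prod_nonneg fun j _ => (Real.exp_pos _).le)
    _ = _ := by ring

lemma expect_mono {z : ℝ} {ρ : ArithmeticFunction ℝ} (hρ : IsClassM z ρ) {x : ℝ} {f g : ℕ → ℝ}
    (h : ∀ n, f n ≤ g n) : expect ρ x f ≤ expect ρ x g := by
  rw [expect_eq_meanOn hρ.multiplicative, expect_eq_meanOn hρ.multiplicative]
  exact meanOn_mono hρ fun S _ => h _

/-- For `T ≥ 3` and `y ≥ 1` both terms of the minimum in `f_T` are nonnegative, so `e^{-f_T} ≤ 1`.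
-/
lemma ETtz_subset_ET {c t z T : ℝ} (hc : 0 ≤ c) (hT : 3 ≤ T) : ETtz c t z T ⊆ ET T := by
  rintro n ⟨hn, h⟩
  refine ⟨hn, fun y hy => (h y hy).trans ?_⟩
  have h3 : 1 ≤ Real.log (3 * y) := by
    rw [Real.le_log_iff_exp_le (by linarith)]; linarith [Real.exp_one_lt_d9]
  have hlT : 0 ≤ Real.log T := Real.log_nonneg (by linarith)
  have hf : 0 ≤ fT c t z T y :=
    mul_nonneg hc (le_min (Real.log_nonneg (by nlinarith)) (by positivity))
  rw [mul_assoc]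
  exact mul_le_of_le_one_left (by positivity) (Real.exp_le_one_iff.2 (by linarith))

end

end DeltaMoments

/-! ### The lower bound for real exponents. -/

namespace DeltaMoments

noncomputable section

open Finset MeasureTheory

/-- In normalised form, a prime occurs with probability `v_p/(1 + v_p) ≤ v_p`; this bounds the mean
of `log n` under the modified weights. -/
lemma subsetSum_sum_le {v f : ℕ → ℝ} (hv : ∀ p, 0 ≤ v p) (hf : ∀ p, 0 ≤ f p) (P : Finset ℕ) :
    subsetSum v P (fun S => ∑ p ∈ S, f p) ≤ (∑ p ∈ P, v p * f p) * ∏ p ∈ P, (1 + v p) := by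
  induction P using Finset.induction_on with
  | empty => simp [subsetSum]
  | insert a P ha ih =>
    have h : subsetSum v (insert a P) (fun S => ∑ p ∈ S, f p) =
        subsetSum v P (fun S => ∑ p ∈ S, f p) +
          v a * (f a * (∏ p ∈ P, (1 + v p)) + subsetSum v P (fun S => ∑ p ∈ S, f p)) := by
      rw [← subsetSum_one, ← subsetSum_const_mul, ← subsetSum_add, ← subsetSum_const_mul]
      unfold subsetSum
      rw [sum_powerset_insert ha]
      congr 1
      refine sum_congr rfl fun S hS => ?_
      have haS : a ∉ S := fun h => ha (mem_powerset.1 hS h)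
      beta_reduce
      rw [prod_insert haS, sum_insert haS]
      ring
    rw [h, sum_insert ha, prod_insert ha]
    have hZ : 0 ≤ ∏ p ∈ P, (1 + v p) := prod_nonneg fun p _ => by linarith [hv p]
    have h1 := mul_le_mul_of_nonneg_left ih (by linarith [hv a] : 0 ≤ 1 + v a)
    have h2 : 0 ≤ v a * (v a * f a * ∏ p ∈ P, (1 + v p)) :=
      mul_nonneg (hv a) (mul_nonneg (mul_nonneg (hv a) (hf a)) hZ)
    linarith

/-- The Mertens-type bound for sums over primes of `ρ(p) log p / p`. -/
lemma exists_sum_log_le {z : ℝ} {ρ : ArithmeticFunction ℝ} (hρ : IsClassM z ρ) :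
    ∃ C : ℝ, 0 < C ∧ ∀ x : ℝ, 3 ≤ x →
      ∑ p ∈ primesLT x, primeWeight ρ p * Real.log p ≤ C * Real.log x := by
  obtain ⟨C1, hC1, h1⟩ := hρ.exists_abs_sum_block_le
  have hv := hρ.primeWeight_nonneg
  have hnn : ∀ p : ℕ, 0 ≤ primeWeight ρ p * Real.log p := fun p =>
    mul_nonneg (hv p) (Real.log_natCast_nonneg p)
  set A := |z * Real.log 2| + C1 with hA
  set S0 := ∑ p ∈ primesLT (scale 2 0), primeWeight ρ p * Real.log p with hS0
  have hS00 : 0 ≤ S0 := sum_nonneg fun p _ => hnn p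
  have hA0 : 0 < A := by positivity
  have hind : ∀ m : ℕ, ∑ p ∈ primesLT (scale 2 m), primeWeight ρ p * Real.log p ≤
      (2 * A + S0) * 2 ^ m := by
    intro m
    induction m with
    | zero => rw [pow_zero, ← hS0]; linarith
    | succ m ih =>
      have e1 := (abs_le.1 (h1 2 m (m + 1) one_lt_two (Nat.le_succ m))).2
      have e2 : ∑ p ∈ primeBlock 2 m (m + 1), primeWeight ρ p * Real.log p ≤
          (∑ p ∈ primeBlock 2 m (m + 1), primeWeight ρ p) * 2 ^ (m + 1) := by
        rw [sum_mul]
        refine sum_le_sum fun p hp => mul_le_mul_of_nonneg_left ?_ (hv p)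
        have hp0 : (0 : ℝ) < p := by exact_mod_cast (prime_of_mem_sdiff hp).pos
        rw [← log_scale]
        exact Real.log_le_log hp0 (mem_primesLT.1 (mem_sdiff.1 hp).1).1.le
      have e3 : ∑ p ∈ primeBlock 2 m (m + 1), primeWeight ρ p ≤ A := by
        push_cast at e1
        have := le_abs_self (z * Real.log 2)
        rw [hA]
        linarith
      have e4 := sum_primesLT_sdiff (scale_mono one_le_two (Nat.le_succ m))
        fun p => primeWeight ρ p * Real.log p
      have e5 := mul_le_mul_of_nonneg_right e3 (by positivity : (0 : ℝ) ≤ 2 ^ (m + 1))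
      have e6 : 0 ≤ S0 * 2 ^ m := by positivity
      rw [primeBlock] at *
      rw [pow_succ] at *
      linarith
  refine ⟨2 * (2 * A + S0), by positivity, fun x hx => ?_⟩
  obtain ⟨M, -, hxM, hML, -⟩ := exists_scale_le one_lt_two hx
  calc _ ≤ _ := sum_le_sum_of_subset_of_nonneg (primesLT_mono hxM) fun p _ _ => hnn p
    _ ≤ (2 * A + S0) * 2 ^ (M + 1) := hind _
    _ = 2 * (2 * A + S0) * 2 ^ M := by ring
    _ ≤ _ := by gcongr

/-- A minorant of `G^{-t}` that is linear in `G`, so that only the first moment of `G` is needed;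
for `G ≥ 2A` the left side is nonpositive. -/
lemma rpow_neg_mul_one_sub_le {A G t : ℝ} (hA : 0 < A) (hG : 0 < G) (ht : 0 < t) :
    (2 * A) ^ (-t) * (1 - G / (2 * A)) ≤ G ^ (-t) := by
  have h1 : 0 < (2 * A) ^ (-t) := Real.rpow_pos_of_pos (by linarith) _
  rcases le_total G (2 * A) with h | h
  · calc _ ≤ (2 * A) ^ (-t) * 1 := by
          gcongr; linarith [div_nonneg hG.le (by linarith : 0 ≤ 2 * A)]
      _ ≤ _ := by
          rw [mul_one]
          exact Real.rpow_le_rpow_of_nonpos hG h (by linarith)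
  · have h2 : 1 ≤ G / (2 * A) := (one_le_div (by linarith)).2 h
    have := Real.rpow_nonneg hG.le (-t)
    nlinarith

lemma M_two_nonneg (n : ℕ) : 0 ≤ M 2 n := by
  rw [M_two_eq]
  exact sum_nonneg fun d _ => sum_nonneg fun d' _ => tri_nonneg _

lemma one_le_log {x : ℝ} (hx : 3 ≤ x) : 1 ≤ Real.log x := by
  rw [Real.le_log_iff_exp_le (by linarith)]
  linarith [Real.exp_one_lt_d9]

/-- By the pointwise bound, the moment is at least a constant times the mean of `2^{t#S} (1 + log
n)^{-t}`. Under the weights `2^t ρ(p)/p` the mean of `log n` is `≪ log x`, so the second factor is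
effectively `(log x)^{-t}`, while the change of weights contributes `(log x)^{z(2^t-1)}`. -/
theorem exists_le_moment {z : ℝ} {ρ : ArithmeticFunction ℝ} (hρ : IsClassM z ρ)
    {t : ℝ} (ht : 0 < t) : ∃ c : ℝ, 0 < c ∧ ∀ x : ℝ, 3 ≤ x →
      c * Real.log x ^ (beta t z - z) ≤
        expect ρ x (fun n => M 2 n ^ t / (tau n : ℝ) ^ t) := by
  obtain ⟨c, hc, h⟩ := exists_two_pow_div_log_le_M_two_div_tau
  obtain ⟨C1, hC1, h1⟩ := hρ.exists_abs_sum_le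
  obtain ⟨C2, hC2, h2⟩ := hρ.exists_sum_sq_le
  obtain ⟨C3, hC3, h3⟩ := exists_sum_log_le hρ
  have hv := hρ.primeWeight_nonneg
  set a := (2 : ℝ) ^ t with ha
  have ha1 : 1 ≤ a := Real.one_le_rpow one_le_two ht.le
  have ha0 : 0 < a := by linarith
  refine ⟨c ^ t * (2 * (1 + a * C3)) ^ (-t) * (1 / 2 * Real.exp (-((a - 1) * C1 + a ^ 2 * C2))),
    by positivity, fun x hx => ?_⟩
  have hL := one_le_log hx
  set L := Real.log x with hLdef
  set P := primesLT x
  set v' : ℕ → ℝ := fun p => a * primeWeight ρ p with hv'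
  have hv'0 : ∀ p, 0 ≤ v' p := fun p => mul_nonneg ha0.le (hv p)
  have hZ : 0 < ∏ p ∈ P, (1 + primeWeight ρ p) := prod_pos fun p _ => by linarith [hv p]
  have hZ' : 0 < ∏ p ∈ P, (1 + v' p) := prod_pos fun p _ => by linarith [hv'0 p]
  set A := 1 + a * C3 with hAdef
  have hA0 : 0 < A * L := by positivity
  have hAL : 1 + ∑ p ∈ P, v' p * Real.log p ≤ A * L := by
    have e := mul_le_mul_of_nonneg_left (h3 x hx) ha0.le
    rw [mul_sum] at e
    simp only [hv', mul_assoc] at e ⊢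
    rw [hAdef]
    linarith
  -- Since `1 + log n` has mean at most `A * L`, the linear minorant keeps at least half of the
  -- total mass.
  set X := (2 * (A * L))⁻¹ with hX
  have hX0 : 0 < X := by positivity
  have hXA : X * (A * L) = 1 / 2 := by
    rw [hX, mul_inv, mul_assoc, inv_mul_cancel₀ hA0.ne']; norm_num
  have hX1 : X ≤ 1 := by
    refine inv_le_one_of_one_le₀ ?_
    have : 0 ≤ ∑ p ∈ P, v' p * Real.log p :=
      sum_nonneg fun p _ => mul_nonneg (hv'0 p) (Real.log_natCast_nonneg p)
    linarith
  have hpt : ∀ S ⊆ P, c ^ t * (2 * (A * L)) ^ (-t) * ((∏ _p ∈ S, a) *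
      ((1 - X) * 1 + -X * ∑ p ∈ S, Real.log p)) ≤
      M 2 (∏ p ∈ S, p) ^ t / (tau (∏ p ∈ S, p) : ℝ) ^ t := by
    intro S hS
    have hP := prime_of_subset_primesLT hS
    have hlog : Real.log (∏ p ∈ S, p : ℕ) = ∑ p ∈ S, Real.log p := by
      rw [Nat.cast_prod, Real.log_prod fun p hp => Nat.cast_ne_zero.2 (hP p hp).ne_zero]
    have hS := h S hP
    rw [hlog] at hS
    have hls : 0 ≤ ∑ p ∈ S, Real.log p := sum_nonneg fun p _ => Real.log_natCast_nonneg p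
    set G := 1 + ∑ p ∈ S, Real.log p with hG
    have hG0 : 0 < G := by linarith
    rw [← Real.div_rpow (M_two_nonneg _) (Nat.cast_nonneg _)]
    refine le_trans ?_ (Real.rpow_le_rpow (by positivity) hS ht.le)
    rw [Real.mul_rpow hc.le (by positivity), Real.div_rpow (by positivity) hG0.le,
      ← Real.rpow_pow_comm two_pos.le, prod_const, div_eq_mul_inv, ← Real.rpow_neg hG0.le,
      mul_assoc, mul_left_comm _ (a ^ #S)]
    gcongr
    refine le_trans (le_of_eq ?_) (rpow_neg_mul_one_sub_le hA0 hG0 ht)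
    rw [hG, div_eq_mul_inv, ← hX]
    ring
  have hsub : 1 / 2 * ∏ p ∈ P, (1 + v' p) ≤
      subsetSum v' P fun S => (1 - X) * 1 + -X * ∑ p ∈ S, Real.log p := by
    rw [subsetSum_add, subsetSum_const_mul, subsetSum_const_mul, subsetSum_one]
    have e1 := subsetSum_sum_le hv'0 (fun p => Real.log_natCast_nonneg p) P
    have e2 := mul_le_mul_of_nonneg_left e1 hX0.le
    have e3 := mul_le_mul_of_nonneg_right (mul_le_mul_of_nonneg_left hAL hX0.le) hZ'.le
    rw [hXA] at e3
    linarith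
  have hratio : Real.exp (-((a - 1) * C1 + a ^ 2 * C2)) * L ^ (z * (a - 1)) ≤
      (∏ p ∈ P, (1 + v' p)) / ∏ p ∈ P, (1 + primeWeight ρ p) := by
    have hb := exp_le_prod_one_add (P := P) (v := primeWeight ρ) (h := fun _ => a) (G := a)
      (fun p _ => hv p) (fun _ _ => ha0.le) fun _ _ => le_rfl
    simp only [mul_comm (primeWeight ρ _)] at hb
    refine le_trans ?_ hb
    rw [Real.rpow_def_of_pos (by linarith), ← Real.exp_add]
    refine Real.exp_le_exp.2 ?_
    have i1 := (abs_le.1 (h1 x (by linarith))).1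
    have i2 := h2 P fun p hp => (mem_primesLT.1 hp).2
    have i3 := mul_le_mul_of_nonneg_left i1 (by linarith : 0 ≤ a - 1)
    have i4 := mul_le_mul_of_nonneg_left i2 (by positivity : 0 ≤ a ^ 2)
    rw [← mul_sum]
    linarith
  have hexp : beta t z - z = -t + z * (a - 1) := by rw [beta]; ring
  rw [expect_eq_meanOn hρ.multiplicative]
  refine le_trans ?_ (meanOn_mono hρ hpt)
  rw [meanOn_const_mul, meanOn, subsetSum_prod_mul (primeWeight ρ) (fun _ => a), hexp,
    Real.rpow_add (by linarith), ← mul_assoc 2 A L,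
    Real.mul_rpow (by positivity) (by positivity : 0 ≤ L)]
  calc _ = c ^ t * ((2 * A) ^ (-t) * L ^ (-t)) *
        (1 / 2 * (Real.exp (-((a - 1) * C1 + a ^ 2 * C2)) * L ^ (z * (a - 1)))) := by ring
    _ ≤ c ^ t * ((2 * A) ^ (-t) * L ^ (-t)) *
        (1 / 2 * ((∏ p ∈ P, (1 + v' p)) / ∏ p ∈ P, (1 + primeWeight ρ p))) := by gcongr
    _ ≤ _ := by
        rw [← mul_div_assoc]
        gcongr

end

end DeltaMoments

/-! ### The lower bound in the critical case `β = z`. -/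

namespace DeltaMoments

noncomputable section

open Finset MeasureTheory

lemma signWeight_zero (N : ℕ) : signWeight (0 : Fin N → SignType) = 1 := by simp [signWeight]

lemma signDot_zero {N : ℕ} (th : Fin N → ℝ) : signDot 0 th = 0 := by simp [signDot]

lemma abs_signDot_le_mul {N : ℕ} (e : Fin N → SignType) {th : Fin N → ℝ} {η : ℝ} (hη : 0 < η)
    (hth : ∀ j, th j ∈ Set.Icc 0 η) : |signDot e th| ≤ N * η := by
  have h : signDot e th = signDot e (fun j => th j / η) * η := by
    rw [signDot, signDot, sum_mul]
    exact sum_congr rfl fun j _ => by field_simp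
  rw [h, abs_mul, abs_of_pos hη]
  gcongr
  exact abs_signDot_le e ⟨fun j => div_nonneg (hth j).1 hη.le, fun j =>
      div_le_one_of_le₀ (hth j).2 hη.le⟩

/-- When all `θ_j ≤ η`, every `|ε·θ|` is `≪ η`, so each nonzero sign vector contributes at least `-z
log η - O(1)`. -/
lemma exists_le_meanOn_prod_cosFactor {z : ℝ} (hz : 0 < z) {ρ : ArithmeticFunction ℝ}
    (hρ : IsClassM z ρ) (N : ℕ) : ∃ c : ℝ, 0 < c ∧ ∀ (x η : ℝ) (th : Fin N → ℝ), 3 ≤ x →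
      (Real.log x)⁻¹ ≤ 2 * η → η ≤ 1 → (∀ j, th j ∈ Set.Icc 0 η) →
      c * Real.exp (-(z * (2 ^ N - 1) * Real.log η)) ≤
        meanOn ρ (primesLT x) fun S => ∏ p ∈ S, cosFactor th p := by
  classical
  obtain ⟨C1, h1⟩ := exists_abs_sum_cos_le hρ (N : ℝ)
  obtain ⟨C2, hC2, h2⟩ := hρ.exists_sum_sq_le
  have hv := hρ.primeWeight_nonneg
  refine ⟨Real.exp (-((2 ^ N - 1) * (z * Real.log (N + 2) + C1) + (2 ^ N) ^ 2 * C2)),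
    Real.exp_pos _, fun x η th hx hη hη1 hth => ?_⟩
  have hL := one_le_log hx
  have hη0 : 0 < η := by
    have := inv_pos.2 (by linarith : 0 < Real.log x)
    linarith
  set P := primesLT x
  rw [meanOn, subsetSum_prod]
  refine le_trans ?_ (exp_le_prod_one_add (G := 2 ^ N) (fun p _ => hv p)
    (fun p _ => cosFactor_nonneg th p) fun p _ => cosFactor_le th p)
  rw [← Real.exp_add]
  refine Real.exp_le_exp.2 ?_
  have hsum : ∑ p ∈ P, primeWeight ρ p * cosFactor th p = ∑ e : Fin N → SignType, signWeight e *
      ∑ p ∈ P, primeWeight ρ p * Real.cos (signDot e th * Real.log p) := by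
    simp only [cosFactor, prod_one_add_cos, mul_sum]
    rw [sum_comm]
    exact sum_congr rfl fun e _ => sum_congr rfl fun p _ => by ring
  have hlow : ∀ e : Fin N → SignType, -(z * Real.log η) - (z * Real.log (N + 2) + C1) ≤
      ∑ p ∈ P, primeWeight ρ p * Real.cos (signDot e th * Real.log p) := by
    intro e
    have hd := abs_signDot_le_mul e hη0 hth
    have hdN : |signDot e th| ≤ N := hd.trans (mul_le_of_le_one_right (Nat.cast_nonneg N) hη1)
    have i1 := (abs_le.1 (h1 _ x hdN (by linarith))).1
    have hm : max (Real.log x)⁻¹ |signDot e th| ≤ (N + 2) * η := by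
      have : 0 ≤ (N : ℝ) * η := by positivity
      refine max_le ?_ ?_ <;> linarith
    have i2 := Real.log_le_log (lt_max_of_lt_left (inv_pos.2 (by linarith : 0 < Real.log x))) hm
    rw [Real.log_mul (by positivity) hη0.ne'] at i2
    have i3 := mul_le_mul_of_nonneg_left i2 hz.le
    simp only [primeWeight]
    linarith
  -- The zero sign vector has weight `1` and reproduces `∑ v_p`, which cancels against the
  -- normalisation; the remaining weight is `2^N - 1`.
  have hw : ∑ e ∈ (univ : Finset (Fin N → SignType)).erase 0, signWeight e = 2 ^ N - 1 := by
    rw [← sum_signWeight, ← add_sum_erase univ _ (mem_univ (0 : Fin N → SignType)),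
      signWeight_zero]
    ring
  rw [hsum, ← add_sum_erase univ _ (mem_univ (0 : Fin N → SignType)), signWeight_zero,
    signDot_zero]
  simp only [zero_mul, Real.cos_zero, mul_one, one_mul]
  have j1 : (2 ^ N - 1) * (-(z * Real.log η) - (z * Real.log (N + 2) + C1)) ≤
      ∑ e ∈ (univ : Finset (Fin N → SignType)).erase 0, signWeight e *
        ∑ p ∈ P, primeWeight ρ p * Real.cos (signDot e th * Real.log p) := by
    rw [← hw, sum_mul]
    exact sum_le_sum fun e _ => mul_le_mul_of_nonneg_left (hlow e) (signWeight_nonneg e)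
  have j2 := mul_le_mul_of_nonneg_left (h2 P fun p hp => (mem_primesLT.1 hp).2)
    (by positivity : (0 : ℝ) ≤ (2 ^ N) ^ 2)
  linarith

lemma sum_pow_le_pow_sum {ι : Type*} (s : Finset ι) {f : ι → ℝ} (hf : ∀ i ∈ s, 0 ≤ f i) {t : ℕ}
    (ht : 1 ≤ t) : ∑ i ∈ s, f i ^ t ≤ (∑ i ∈ s, f i) ^ t := by
  obtain ⟨n, rfl⟩ := Nat.exists_eq_add_of_le' ht
  rw [pow_succ', sum_mul]
  refine sum_le_sum fun i hi => ?_
  rw [pow_succ']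
  have := hf i hi
  gcongr
  exact single_le_sum hf hi

/-- The intervals `[η / 2, η]` with `η = 4 ^ (-i) / 2`. -/
def dyadicInterval (i : ℕ) : Set ℝ := Set.Icc ((4 ^ i)⁻¹ / 2 / 2) ((4 ^ i)⁻¹ / 2)

lemma dyadicInterval_subset (i : ℕ) : dyadicInterval i ⊆ Set.Icc 0 (1 / 2) := by
  refine Set.Icc_subset_Icc (by positivity) ?_
  have : ((4 : ℝ) ^ i)⁻¹ ≤ 1 := inv_le_one_of_one_le₀ (one_le_pow₀ (by norm_num))
  linarith

lemma disjoint_dyadicInterval {i j : ℕ} (h : i < j) :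
    Disjoint (dyadicInterval i) (dyadicInterval j) := by
  rw [Set.disjoint_left]
  intro u hi hj
  have h1 : ((4 : ℝ) ^ j)⁻¹ ≤ (4 ^ i)⁻¹ / 4 := by
    rw [div_eq_mul_inv, ← mul_inv, ← pow_succ]
    exact inv_anti₀ (by positivity) (pow_le_pow_right₀ (by norm_num) h)
  have h2 : (0 : ℝ) < (4 ^ i)⁻¹ := by positivity
  have := hi.1
  have := hj.2
  linarith

/-- For disjoint intervals `I_i`, `(∑ ∫_{I_i})^t ≥ ∑ (∫_{I_i})^t`. On `I_i^t` the mean of the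
product is `≫ η^{-z(2^t-1)} = η^{-t}`, which compensates the volume `(η/2)^t`; each of the `M + 1`
scales contributes a constant. -/
theorem exists_log_log_le_moment {z : ℝ} (hz : 0 < z) {ρ : ArithmeticFunction ℝ}
    (hρ : IsClassM z ρ) {t : ℕ} (ht : 1 ≤ t) (hβ : beta t z = z) : ∃ c : ℝ, 0 < c ∧
      ∀ x : ℝ, 3 ≤ x → c * Real.log (Real.log x) ≤
        expect ρ x (fun n => M 2 n ^ t / (tau n : ℝ) ^ t) := by
  obtain ⟨c1, hc1, h1⟩ := exists_setIntegral_le_M_two_div_tau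
  obtain ⟨c2, hc2, h2⟩ := exists_le_meanOn_prod_cosFactor hz hρ t
  have hzt : z * (2 ^ t - 1) = t := by
    rw [beta, Real.rpow_natCast] at hβ; linarith
  have hl4 : 0 < Real.log 4 := Real.log_pos (by norm_num)
  refine ⟨c1 ^ t * (c2 * (1 / 2) ^ t) / Real.log 4, by positivity, fun x hx => ?_⟩
  obtain ⟨M, hMx, hxM, hML, hLM⟩ := exists_scale_le (by norm_num : (1 : ℝ) < 4) hx
  have hL := one_le_log hx
  have hpt : ∀ S ⊆ primesLT x, ∑ i ∈ range (M + 1), c1 ^ t *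
      ∫ th in Set.univ.pi (fun _ : Fin t => dyadicInterval i), ∏ p ∈ S, cosFactor th p ≤
      DeltaMoments.M 2 (∏ p ∈ S, p) ^ t / (tau (∏ p ∈ S, p) : ℝ) ^ t := by
    intro S hS
    have hP := prime_of_subset_primesLT hS
    have hmeas : ∀ i ∈ range (M + 1), MeasurableSet (dyadicInterval i) :=
      fun i _ => measurableSet_Icc
    have hdis : ((range (M + 1) : Finset ℕ) : Set ℕ).Pairwise
        (Function.onFun Disjoint dyadicInterval) := fun i _ j _ hij => by
      rcases lt_or_gt_of_ne hij with h | h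
      · exact disjoint_dyadicInterval h
      · exact (disjoint_dyadicInterval h).symm
    have hb := h1 S hP (⋃ i ∈ range (M + 1), dyadicInterval i)
      (Finset.measurableSet_biUnion _ hmeas)
      (Set.iUnion₂_subset fun i _ => dyadicInterval_subset i)
    rw [integral_biUnion_finset _ hmeas hdis fun i _ =>
      (continuous_cosProd S).integrableOn_Icc] at hb
    have hnn : ∀ i, 0 ≤ ∫ u in dyadicInterval i, cosProd S u := fun i =>
      integral_nonneg fun u => cosProd_nonneg S u
    rw [← div_pow]
    refine le_trans ?_ (pow_le_pow_left₀ (mul_nonneg hc1.le (sum_nonneg fun i _ => hnn i)) hb t)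
    rw [← mul_sum, mul_pow]
    gcongr
    refine le_trans (le_of_eq ?_) (sum_pow_le_pow_sum _ (fun i _ => hnn i) ht)
    refine sum_congr rfl fun i _ => ?_
    rw [← integral_pi_prod]
    simp only [prod_cosProd]
  have hterm : ∀ i ∈ range (M + 1), c2 * (1 / 2) ^ t ≤ meanOn ρ (primesLT x) fun S =>
      ∫ th in Set.univ.pi (fun _ : Fin t => dyadicInterval i), ∏ p ∈ S, cosFactor th p := by
    intro i hi
    rw [mem_range, Nat.lt_succ_iff] at hi
    set η : ℝ := (4 ^ i)⁻¹ / 2 with hη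
    have hη0 : 0 < η := by positivity
    have hη1 : η ≤ 1 := by
      have : ((4 : ℝ) ^ i)⁻¹ ≤ 1 := inv_le_one_of_one_le₀ (one_le_pow₀ (by norm_num))
      linarith
    -- The scales stop where `4^i` reaches `log x`: below `1/log x` the primes up to `x` no longer
    -- distinguish `θ` from `0`.
    have hηL : (Real.log x)⁻¹ ≤ 2 * η := by
      rw [hη, mul_div_cancel₀ _ two_ne_zero]
      exact inv_anti₀ (by positivity) ((pow_le_pow_right₀ (by norm_num) hi).trans hML)
    have hcont := continuous_prod_cosFactor (N := t)
    have hcomp : IsCompact (Set.univ.pi fun _ : Fin t => dyadicInterval i) :=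
      isCompact_univ_pi fun _ => isCompact_Icc
    have hvol : volume.real (Set.univ.pi fun _ : Fin t => dyadicInterval i) = (η / 2) ^ t := by
      rw [measureReal_def, volume_pi_pi]
      simp only [dyadicInterval, Real.volume_Icc, prod_const, card_univ, Fintype.card_fin,
        ENNReal.toReal_pow]
      rw [ENNReal.toReal_ofReal (by linarith)]
      congr 1
      ring
    have hexp : Real.exp (-(z * (2 ^ t - 1) * Real.log η)) = (η ^ t)⁻¹ := by
      rw [hzt, Real.exp_neg, Real.exp_nat_mul, Real.exp_log hη0]
    rw [meanOn_integral _ _ _ _ fun S => (hcont S).continuousOn.integrableOn_compact hcomp]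
    refine le_trans (le_of_eq ?_) (setIntegral_ge_of_const_le_real hcomp.measurableSet
      hcomp.measure_lt_top.ne (fun th hth => h2 x η th hx hηL hη1 fun j => ?_)
      ((continuous_meanOn ρ _ _ hcont).continuousOn.integrableOn_compact hcomp))
    · have hp : η ^ t ≠ 0 := (pow_pos hη0 t).ne'
      rw [hvol, hexp, div_pow η, div_pow 1, one_pow]
      generalize η ^ t = y at hp ⊢
      field_simp
    · have hj := hth j (Set.mem_univ j)
      exact ⟨by linarith [hj.1], hj.2⟩
  have hloglog : Real.log (Real.log x) ≤ Real.log 4 * (M + 1) := by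
    have := Real.log_le_log (by linarith) hLM
    rw [Real.log_pow] at this
    push_cast at this
    linarith
  rw [expect_eq_meanOn hρ.multiplicative]
  refine le_trans ?_ (meanOn_mono hρ hpt)
  have hsum : meanOn ρ (primesLT x) (fun S => ∑ i ∈ range (M + 1), c1 ^ t *
      ∫ th in Set.univ.pi (fun _ : Fin t => dyadicInterval i), ∏ p ∈ S, cosFactor th p) =
      ∑ i ∈ range (M + 1), c1 ^ t * meanOn ρ (primesLT x) fun S =>
        ∫ th in Set.univ.pi (fun _ : Fin t => dyadicInterval i), ∏ p ∈ S, cosFactor th p := by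
    simp only [← meanOn_const_mul]
    rw [meanOn, subsetSum_sum, sum_div]
    rfl
  rw [hsum]
  calc _ ≤ c1 ^ t * (c2 * (1 / 2) ^ t) / Real.log 4 * (Real.log 4 * (M + 1)) := by gcongr
    _ = ∑ i ∈ range (M + 1), c1 ^ t * (c2 * (1 / 2) ^ t) := by
        rw [sum_const, card_range, nsmul_eq_mul]
        push_cast
        field_simp
    _ ≤ _ := by
        gcongr with i hi
        exact hterm i hi

end

end DeltaMoments

/-! ### Assembly of the estimates. -/

theorem proposition4p1 (z : ℝ) (hz : 0 < z) (ρ : ArithmeticFunction ℝ)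
    (hρ : DeltaMoments.IsClassM z ρ) :
    -- (i), real exponents
    (∀ t : ℝ, 0 < t → DeltaMoments.zt t ≤ z →
      ∃ k : ℝ, 0 < k ∧ ∀ x : ℝ, 3 ≤ x →
        k * Real.log x ^ (DeltaMoments.beta t z - z) ≤
          DeltaMoments.expect ρ x
            (fun n => DeltaMoments.M 2 n ^ t / (DeltaMoments.tau n : ℝ) ^ t)) ∧
    -- (ii), positive integer exponents
    (∀ t : ℕ, 1 ≤ t → DeltaMoments.zt t ≤ z →
      (∃ k K : ℝ, 0 < k ∧ 0 < K ∧ ∀ x : ℝ, 3 ≤ x →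
        k * (Real.log x ^ (DeltaMoments.beta t z - z) *
            Real.log (Real.log x) ^ DeltaMoments.delta t z) ≤
          DeltaMoments.expect ρ x
            (fun n => DeltaMoments.M 2 n ^ t / (DeltaMoments.tau n : ℝ) ^ t) ∧
        DeltaMoments.expect ρ x
            (fun n => DeltaMoments.M 2 n ^ t / (DeltaMoments.tau n : ℝ) ^ t) ≤
          K * (Real.log x ^ (DeltaMoments.beta t z - z) *
            Real.log (Real.log x) ^ DeltaMoments.delta t z)) ∧
      (∀ c : ℝ, 0 < c → ∃ K : ℝ, 0 < K ∧ ∀ T x : ℝ, 3 ≤ T → 3 ≤ x →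
        DeltaMoments.expect ρ x ((DeltaMoments.ETtz c t z T).indicator
            (fun n => DeltaMoments.M 2 n ^ (t + 1) / (DeltaMoments.tau n : ℝ) ^ (t + 1))) ≤
          K * (T * Real.log x ^ (DeltaMoments.beta t z - z))) ∧
      (DeltaMoments.zt t < z → ∃ K : ℝ, 0 < K ∧ ∀ T x : ℝ, 3 ≤ T → 3 ≤ x →
        DeltaMoments.expect ρ x ((DeltaMoments.ET T).indicator
            (fun n => DeltaMoments.M 2 n ^ (t + 1) / (DeltaMoments.tau n : ℝ) ^ (t + 1))) ≤
          K * (T * Real.log x ^ (DeltaMoments.beta t z - z)))) := by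
  refine ⟨fun t ht _ => DeltaMoments.exists_le_moment hρ ht, fun t ht hzt => ⟨?_, ?_, ?_⟩⟩
  · obtain ⟨K, hK, hupper⟩ := DeltaMoments.exists_moment_le hz hρ ht hzt
    obtain ⟨k, hk, hlower⟩ : ∃ k : ℝ, 0 < k ∧ ∀ x : ℝ, 3 ≤ x →
        k * (Real.log x ^ (DeltaMoments.beta t z - z) *
            Real.log (Real.log x) ^ DeltaMoments.delta t z) ≤
          DeltaMoments.expect ρ x
            (fun n => DeltaMoments.M 2 n ^ t / (DeltaMoments.tau n : ℝ) ^ t) := by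
      -- Outside the critical case the power of `log log x` is `1`, and the lower bound for real
      -- exponents suffices.
      by_cases hδ : DeltaMoments.beta t z = z
      · obtain ⟨k, hk, h⟩ := DeltaMoments.exists_log_log_le_moment hz hρ ht hδ
        refine ⟨k, hk, fun x hx => ?_⟩
        rw [DeltaMoments.delta, if_pos hδ, hδ, sub_self, Real.rpow_zero, Real.rpow_one, one_mul]
        exact h x hx
      · obtain ⟨k, hk, h⟩ := DeltaMoments.exists_le_moment hρ (t := t) (by exact_mod_cast ht)
        refine ⟨k, hk, fun x hx => ?_⟩
        rw [DeltaMoments.delta, if_neg hδ, Real.rpow_zero, mul_one]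
        simpa only [Real.rpow_natCast] using h x hx
    exact ⟨k, K, hk, hK, fun x hx => ⟨hlower x hx, hupper x hx⟩⟩
  · intro c hc
    obtain ⟨K, hK, h⟩ := DeltaMoments.exists_moment_ET_le hz hρ ht hzt
    refine ⟨K, hK, fun T x hT hx => le_trans ?_ (h T x (by linarith) hx)⟩
    refine DeltaMoments.expect_mono hρ fun n => Set.indicator_le_indicator_of_subset
      (DeltaMoments.ETtz_subset_ET hc.le hT) (fun n => ?_) n
    exact div_nonneg (pow_nonneg (DeltaMoments.M_two_nonneg n) _) (by positivity)
  · intro _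
    obtain ⟨K, hK, h⟩ := DeltaMoments.exists_moment_ET_le hz hρ ht hzt
    exact ⟨K, hK, fun T x hT hx => h T x (by linarith) hx⟩
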